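/- For $z=x+iy\in\mathbb C$ put $(a,b,c)=\frac{1}{|z|^2+1}(2x,\,2y,\,|z|^2-1)$, and $(a,b,c)=(0,0,1)$ for $z=\infty$; with $E=\begin{pmatrix}0&1\\-1&0\end{pmatrix}$ and $I$ the $2\times2$ identity matrix let $$J_z=\begin{pmatrix} aE & bE+cI\\ bE-cI & -aE\end{pmatrix},\qquad z\in\mathbb P^1=\mathbb C\cup\{\infty\},$$ acting on column vectors of $\mathbb R^4$ (an orthogonal complex structure on $\mathbb R^4$). Let $M_1$ be a compact (connected) Riemann surface with complex structure $J_1$, let $f:M_1\to\mathbb P^1$ be a non-constant holomorphic map, and let $T^4=\mathbb R^4/\Lambda$ be a flat $4$-torus, $\Lambda\subset\mathbb R^4$ any lattice of rank $4$. Let $M^3_f$ be $M_1\times T^4$ with the (integrable) complex structure $J=J_1+J_{f(y_1)}$ at $(y_1,y_2)\in M_1\times T^4$, where the tangent spaces of $T^4$ are identified with $\mathbb R^4$ by translation. Then the complex manifold $M^3_f$ admits no pluriclosed Hermitian metric, i.e. no Hermitian metric whose fundamental form $\omega$ satisfies $\partial\bar\partial\omega=0$. In particular $M^3_f$ is non-K\"ahlerian,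 i.e. it admits no Hermitian metric with $d\omega=0$. -/

import Mathlib

open scoped Manifold ContDiff Topology

noncomputable section

/-! ## Differential forms on a manifold and the exterior derivative -/

section DifferentialForms

variable {E : Type*} [NormedAddCommGroup E] [NormedSpace ℝ E]
  {H : Type*} [TopologicalSpace H] (I : ModelWithCorners ℝ E H)
  (M : Type*) [TopologicalSpace M] [ChartedSpace H M]

/-- Complex-valued differential `k`-forms on `M` (no regularity is imposed here). -/
abbrev DiffForm (k : ℕ) : Type _ :=
  ∀ x : M, TangentSpace I x [⋀^Fin k]→L[ℝ] ℂ

variable {I M}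

/-- The expression of a differential form in the preferred chart around `x₀`, i.e. its pullback to
the model vector space under the inverse of that chart. -/
def DiffForm.inChart {k : ℕ} (α : DiffForm I M k) (x₀ : M) : E → E [⋀^Fin k]→L[ℝ] ℂ :=
  fun e => (α ((extChartAt I x₀).symm e)).compContinuousLinearMap
    (mfderivWithin 𝓘(ℝ, E) I (extChartAt I x₀).symm (Set.range I) e)

/-- The exterior derivative of a differential form, computed at each point `x` in the preferred
chart around `x`. -/
def DiffForm.d {k : ℕ} (α : DiffForm I M k) : DiffForm I M (k + 1) :=
  fun x => (extDerivWithin (α.inChart x) (Set.range I)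
    (extChartAt I x x)).compContinuousLinearMap (mfderiv I 𝓘(ℝ, E) (extChartAt I x) x)

end DifferentialForms

/-! ## Decomposition into types -/

section Types

variable {V : Type*} [AddCommGroup V] [Module ℝ V] [TopologicalSpace V]

/-- The `(p, q)`-part of a complex-valued real `k`-form `α` on a real vector space with complex
structure `j`.  With `π¹⁰ v = (v - i j v) / 2` and `π⁰¹ v = (v + i j v) / 2` the components of `v`
in the complexified space, and `α` extended complex multilinearly, it is
`(v₁, …, v_k) ↦ ∑_S α (w₁, …, w_k)` where `S` runs over the sets of `p` indices whose complement has
`q` elements and `w_i` is `π¹⁰ v_i` for `i ∈ S` and `π⁰¹ v_i` for `i ∉ S`.  The inner sum over `T`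
is the expansion of `α (w₁, …, w_k)`, with `T` the set of slots in which `j v_i` is chosen.
It is zero if `p + q ≠ k`. -/
def typePart {k : ℕ} (j : V →L[ℝ] V) (p q : ℕ) (α : V [⋀^Fin k]→L[ℝ] ℂ) :
    V [⋀^Fin k]→L[ℝ] ℂ :=
  { toContinuousMultilinearMap :=
      ∑ S : Finset (Fin k) with S.card = p ∧ Sᶜ.card = q, ∑ T : Finset (Fin k),
        ((1 / 2 : ℂ) ^ k * ∏ i ∈ T, if i ∈ S then -Complex.I else Complex.I) •
          α.toContinuousMultilinearMap.compContinuousLinearMap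
            (fun i => if i ∈ T then j else ContinuousLinearMap.id ℝ V)
    map_eq_zero_of_eq' := by
      intro v a b hv hab
      set σ : Equiv.Perm (Fin k) := Equiv.swap a b with hσ
      have hvσ : ∀ i, v (σ i) = v i := by
        intro i
        by_cases hia : i = a
        · subst hia; simp [hσ, hv]
        by_cases hib : i = b
        · subst hib; simp [hσ, hv]
        simp [hσ, Equiv.swap_apply_of_ne_of_ne hia hib]
      have hmem : ∀ (T : Finset (Fin k)) (i : Fin k),
          i ∈ T.map σ.toEmbedding ↔ σ i ∈ T := by
        intro T i
        rw [Finset.mem_map_equiv]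
        simp [hσ]
      let g : Finset (Fin k) → Finset (Fin k) → ℂ := fun S T =>
        ((1 / 2 : ℂ) ^ k * ∏ i ∈ T, if i ∈ S then -Complex.I else Complex.I) *
          α (fun i => (if i ∈ T then j else ContinuousLinearMap.id ℝ V) (v i))
      have hg : ∀ S T, g (S.map σ.toEmbedding) (T.map σ.toEmbedding) = - g S T := by
        intro S T
        have h1 : (∏ i ∈ T.map σ.toEmbedding,
            if i ∈ S.map σ.toEmbedding then -Complex.I else Complex.I) =
            ∏ i ∈ T, if i ∈ S then -Complex.I else Complex.I := by
          rw [Finset.prod_map]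
          refine Finset.prod_congr rfl fun i _ => ?_
          simp only [hmem]
          simp [hσ]
        have h2 : (fun i => (if i ∈ T.map σ.toEmbedding then j
            else ContinuousLinearMap.id ℝ V) (v i)) =
            (fun i => (if i ∈ T then j else ContinuousLinearMap.id ℝ V) (v i)) ∘ σ := by
          funext i
          simp only [hmem, Function.comp, hvσ]
        have h3 := α.toAlternatingMap.map_swap
          (fun i => (if i ∈ T then j else ContinuousLinearMap.id ℝ V) (v i)) hab
        simp only [g, h1, h2]
        have h4 : α ((fun i => (if i ∈ T then j else ContinuousLinearMap.id ℝ V) (v i)) ∘ σ) =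
            - α (fun i => (if i ∈ T then j else ContinuousLinearMap.id ℝ V) (v i)) := h3
        rw [h4]; ring
      have hsum : (∑ S : Finset (Fin k) with S.card = p ∧ Sᶜ.card = q,
          ∑ T : Finset (Fin k), g S T) = 0 := by
        let e : Equiv.Perm (Finset (Fin k)) := σ.finsetCongr
        have he : ∀ T, e T = T.map σ.toEmbedding := fun T => rfl
        have hcongr : (∑ S : Finset (Fin k) with S.card = p ∧ Sᶜ.card = q,
            ∑ T : Finset (Fin k), g S T) =
            ∑ S : Finset (Fin k) with S.card = p ∧ Sᶜ.card = q,
              ∑ T : Finset (Fin k), g (e S) (e T) := by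
          symm
          refine Finset.sum_equiv e ?_ ?_
          · intro S
            simp [he, Finset.card_compl]
          · intro S _
            exact Equiv.sum_comp e (fun T => g (e S) T)
        simp only [he, hg, Finset.sum_neg_distrib] at hcongr
        linear_combination hcongr / 2
      convert hsum using 1
      simp [g] }

end Types

/-! ## Complex structures, the operators `∂` and `∂̄`, Hermitian metrics -/

section Complex

variable {E : Type*} [NormedAddCommGroup E] [NormedSpace ℝ E]
  {H : Type*} [TopologicalSpace H] (I : ModelWithCorners ℝ E H)
  (M : Type*) [TopologicalSpace M] [ChartedSpace H M] [IsManifold I ∞ M]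

/-- A complex structure on a smooth manifold, given as a smooth field `J` of endomorphisms of the
tangent spaces with `J² = -1` whose Nijenhuis tensor vanishes. -/
structure ComplexStructure where
  /-- the field of endomorphisms `J` -/
  J : ∀ x : M, TangentSpace I x →L[ℝ] TangentSpace I x
  sq_eq_neg : ∀ (x : M) (v : TangentSpace I x), J x (J x v) = -v
  /-- `J` takes smooth vector fields to smooth vector fields -/
  smooth : ∀ (X : ∀ x : M, TangentSpace I x) (x₀ : M),
    ContMDiffAt I I.tangent ∞ (fun x => (⟨x, X x⟩ : TangentBundle I M)) x₀ →
    ContMDiffAt I I.tangent ∞ (fun x => (⟨x, J x (X x)⟩ : TangentBundle I M)) x₀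
  /-- `[X, Y] - [JX, JY] + J [JX, Y] + J [X, JY] = 0` for all (locally defined) smooth vector
  fields `X`, `Y` -/
  integrable : ∀ (X Y : ∀ x : M, TangentSpace I x) (x₀ : M),
    ContMDiffAt I I.tangent ∞ (fun x => (⟨x, X x⟩ : TangentBundle I M)) x₀ →
    ContMDiffAt I I.tangent ∞ (fun x => (⟨x, Y x⟩ : TangentBundle I M)) x₀ →
    VectorField.mlieBracket I X Y x₀
      - VectorField.mlieBracket I (fun x => J x (X x)) (fun x => J x (Y x)) x₀
      + J x₀ (VectorField.mlieBracket I (fun x => J x (X x)) Y x₀)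
      + J x₀ (VectorField.mlieBracket I X (fun x => J x (Y x)) x₀) = 0

variable {I M}

/-- The operator `∂ = π^{p+1,q} ∘ d` on forms of type `(p, q)`. -/
def ComplexStructure.del (𝒥 : ComplexStructure I M) (p q : ℕ) {k : ℕ} (α : DiffForm I M k) :
    DiffForm I M (k + 1) :=
  fun x => typePart (𝒥.J x) (p + 1) q (α.d x)

/-- The operator `∂̄ = π^{p,q+1} ∘ d` on forms of type `(p, q)`. -/
def ComplexStructure.delbar (𝒥 : ComplexStructure I M) (p q : ℕ) {k : ℕ} (α : DiffForm I M k) :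
    DiffForm I M (k + 1) :=
  fun x => typePart (𝒥.J x) p (q + 1) (α.d x)

/-- A Hermitian metric on a complex manifold: a smooth Riemannian metric `h` with
`h (Ju, Jv) = h (u, v)`. -/
structure HermitianMetric (𝒥 : ComplexStructure I M) extends
    Bundle.ContMDiffRiemannianMetric I ∞ E (fun x : M => TangentSpace I x) where
  compatible : ∀ (x : M) (u v : TangentSpace I x), inner x (𝒥.J x u) (𝒥.J x v) = inner x u v

/-- The fundamental form `ω (u, v) = h (Ju, v)` of a Hermitian metric, a `2`-form of type
`(1, 1)`. -/
def HermitianMetric.fundamentalForm {𝒥 : ComplexStructure I M} (h : HermitianMetric 𝒥) :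
    DiffForm I M 2 := fun x =>
  { toFun := fun v => ((h.inner x (𝒥.J x (v 0)) (v 1) : ℝ) : ℂ)
    map_update_add' := by
      intro _ m i u w
      fin_cases i <;> simp [Function.update]
    map_update_smul' := by
      intro _ m i c u
      fin_cases i <;> simp [Function.update]
    cont := by
      have aux : ∀ (B : E →L[ℝ] E →L[ℝ] ℝ) (j : E →L[ℝ] E),
          Continuous fun v : Fin 2 → E => ((B (j (v 0)) (v 1) : ℝ) : ℂ) := by
        intro B j
        fun_prop
      exact aux (h.inner x) (𝒥.J x)
    map_eq_zero_of_eq' := by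
      intro v a b hv hab
      have key : ∀ u : TangentSpace I x, h.inner x (𝒥.J x u) u = 0 := by
        intro u
        have h1 := h.compatible x (𝒥.J x u) u
        rw [𝒥.sq_eq_neg] at h1
        have h2 := h.symm x u (𝒥.J x u)
        simp only [map_neg, neg_apply] at h1
        linarith
      have h01 : v 0 = v 1 := by
        fin_cases a <;> fin_cases b <;> simp_all
      simp [h01, key] }

/-- A Hermitian metric is pluriclosed if its fundamental form satisfies `∂ ∂̄ ω = 0`. -/
def HermitianMetric.IsPluriclosed {𝒥 : ComplexStructure I M} (h : HermitianMetric 𝒥) : Prop :=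
  ∀ x : M, 𝒥.del 1 2 (𝒥.delbar 1 1 h.fundamentalForm) x = 0

/-- A Hermitian metric is Kähler if its fundamental form is closed. -/
def HermitianMetric.IsKahler {𝒥 : ComplexStructure I M} (h : HermitianMetric 𝒥) : Prop :=
  ∀ x : M, h.fundamentalForm.d x = 0

end Complex

/-! ## Flat four-dimensional tori -/

section FlatTorus

/-- The flat torus `ℝ⁴ / Λ`. -/
abbrev FlatTorus (Λ : Submodule ℤ (EuclideanSpace ℝ (Fin 4))) : Type :=
  EuclideanSpace ℝ (Fin 4) ⧸ Λ.toAddSubgroup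

variable (Λ : Submodule ℤ (EuclideanSpace ℝ (Fin 4))) [DiscreteTopology Λ]

theorem FlatTorus.isLocalHomeomorph_mk :
    IsLocalHomeomorph (QuotientAddGroup.mk : EuclideanSpace ℝ (Fin 4) → FlatTorus Λ) :=
  (AddSubgroup.isAddQuotientCoveringMap_of_comm Λ.toAddSubgroup
    (DiscreteTopology.isDiscrete (s := (Λ : Set (EuclideanSpace ℝ (Fin 4)))))).isCoveringMap.isLocalHomeomorph

/-- The charts of `ℝ⁴ / Λ` are the local inverses of the projection `ℝ⁴ → ℝ⁴ / Λ`. -/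
instance FlatTorus.instChartedSpace : ChartedSpace (EuclideanSpace ℝ (Fin 4)) (FlatTorus Λ) :=
  (FlatTorus.isLocalHomeomorph_mk Λ).chartedSpace QuotientAddGroup.mk_surjective

theorem FlatTorus.chart_symm {c : OpenPartialHomeomorph (FlatTorus Λ) (EuclideanSpace ℝ (Fin 4))}
    (hc : c ∈ atlas (EuclideanSpace ℝ (Fin 4)) (FlatTorus Λ)) (v : EuclideanSpace ℝ (Fin 4)) :
    c.symm v = (v : FlatTorus Λ) := by
  obtain ⟨q, rfl⟩ := hc
  have h := (FlatTorus.isLocalHomeomorph_mk Λ).localInverseAt_symm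
    (x := QuotientAddGroup.mk_surjective.hasRightInverse.choose q)
  exact congrFun h v

/-- Changes of charts are locally translations. -/
theorem FlatTorus.transition_eventuallyEq
    {c c' : OpenPartialHomeomorph (FlatTorus Λ) (EuclideanSpace ℝ (Fin 4))}
    (hc : c ∈ atlas (EuclideanSpace ℝ (Fin 4)) (FlatTorus Λ))
    (hc' : c' ∈ atlas (EuclideanSpace ℝ (Fin 4)) (FlatTorus Λ)) {v : EuclideanSpace ℝ (Fin 4)}
    (hv : v ∈ (c.symm ≫ₕ c').source) :
    ∃ b, (fun w => (c.symm ≫ₕ c') w) =ᶠ[𝓝 v] fun w => w + b := by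
  set t : EuclideanSpace ℝ (Fin 4) → EuclideanSpace ℝ (Fin 4) := fun w => (c.symm ≫ₕ c') w with ht
  have hmem : ∀ w ∈ (c.symm ≫ₕ c').source, t w - w ∈ Λ := by
    intro w hw
    have h1 : c.symm w ∈ c'.source := by
      have h2 := hw
      rw [OpenPartialHomeomorph.trans_source] at h2
      exact h2.2
    have h3 : ((t w : EuclideanSpace ℝ (Fin 4)) : FlatTorus Λ) = (w : FlatTorus Λ) := by
      rw [← FlatTorus.chart_symm Λ hc' (t w), ← FlatTorus.chart_symm Λ hc w]
      exact c'.left_inv h1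
    have h4 := QuotientAddGroup.eq.1 h3.symm
    rw [Submodule.mem_toAddSubgroup] at h4
    rwa [neg_add_eq_sub] at h4
  have hopen : (c.symm ≫ₕ c').source ∈ 𝓝 v := (c.symm ≫ₕ c').open_source.mem_nhds hv
  have hcont : ContinuousAt (fun w => t w - w) v :=
    ((c.symm ≫ₕ c').continuousAt hv).sub continuousAt_id
  obtain ⟨U, hU, hUΛ⟩ : ∃ U ∈ 𝓝 (t v - v), U ∩ (Λ : Set (EuclideanSpace ℝ (Fin 4))) ⊆ {t v - v} := by
    obtain ⟨U, hU, hUΛ⟩ := isDiscrete_iff_forall_mem_exists_isOpen.1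
      (DiscreteTopology.isDiscrete (s := (Λ : Set (EuclideanSpace ℝ (Fin 4))))) _ (hmem v hv)
    refine ⟨U, hU.mem_nhds ?_, hUΛ.subset⟩
    have : t v - v ∈ U ∩ (Λ : Set (EuclideanSpace ℝ (Fin 4))) := by rw [hUΛ]; rfl
    exact this.1
  refine ⟨t v - v, ?_⟩
  filter_upwards [hopen, hcont hU] with w hw hwU
  have h5 : t w - w = t v - v := hUΛ ⟨hwU, hmem w hw⟩
  rw [← h5]
  abel

instance FlatTorus.instIsManifold : IsManifold 𝓘(ℝ, EuclideanSpace ℝ (Fin 4)) ω (FlatTorus Λ) := by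
  refine isManifold_of_contDiffOn _ _ _ fun c c' hc hc' => ?_
  simp only [modelWithCornersSelf_coe, modelWithCornersSelf_coe_symm, Function.comp_id,
    Function.id_comp, Set.preimage_id, Set.range_id, Set.inter_univ]
  intro v hv
  obtain ⟨b, hb⟩ := FlatTorus.transition_eventuallyEq Λ hc hc' hv
  refine ContDiffAt.contDiffWithinAt ?_
  exact ContDiffAt.congr_of_eventuallyEq (f := fun w => w + b) (by fun_prop) hb

end FlatTorus

/-! ## Holomorphic maps to the projective line -/

section ProjectiveLine

/-- The affine coordinate `z` on `ℙ¹ = ℂ ∪ {∞}` (with junk value `0` at `∞`). -/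
def affineCoord (p : OnePoint ℂ) : ℂ := p.elim 0 id

/-- The affine coordinate `w = 1 / z` around `∞` on `ℙ¹ = ℂ ∪ {∞}`, with `w (∞) = 0` (and junk
value `0` at `z = 0`). -/
def affineCoordInfty (p : OnePoint ℂ) : ℂ := p.elim 0 fun z => z⁻¹

/-- A map from a complex manifold to `ℙ¹ = ℂ ∪ {∞}` is holomorphic if it is continuous and
holomorphic in the two affine coordinates `z` and `1 / z`. -/
structure IsHolomorphicToP1 {M₁ : Type*} [TopologicalSpace M₁] [ChartedSpace ℂ M₁]
    (f : M₁ → OnePoint ℂ) : Prop where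
  continuous : Continuous f
  affine : ∀ y, f y ≠ OnePoint.infty → MDifferentiableAt 𝓘(ℂ) 𝓘(ℂ) (affineCoord ∘ f) y
  infty : ∀ y, f y ≠ ((0 : ℂ) : OnePoint ℂ) →
    MDifferentiableAt 𝓘(ℂ) 𝓘(ℂ) (affineCoordInfty ∘ f) y

/-- The complex structure `J_{(a,b,c)} = [[aE, bE + cI], [bE - cI, -aE]]`, `E = [[0, 1], [-1, 0]]`,
as a `4 × 4` matrix (acting on column vectors). -/
def quaternionMatrix (a b c : ℝ) : Matrix (Fin 4) (Fin 4) ℝ :=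
  !![ 0,  a,  c,  b;
     -a,  0, -b,  c;
     -c,  b,  0, -a;
     -b, -c,  a,  0]

/-- The identification of `ℙ¹ = ℂ ∪ {∞}` with the unit sphere in `ℝ³`,
`z = x + i y ↦ (2x, 2y, |z|² - 1) / (|z|² + 1)` and `∞ ↦ (0, 0, 1)`. -/
def sphereOfP1 (p : OnePoint ℂ) : ℝ × ℝ × ℝ :=
  p.elim (0, 0, 1) fun z =>
    (2 * z.re / (‖z‖ ^ 2 + 1), 2 * z.im / (‖z‖ ^ 2 + 1), (‖z‖ ^ 2 - 1) / (‖z‖ ^ 2 + 1))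

/-- The orthogonal complex structure `J_z` of `ℝ⁴` with parameter `z ∈ ℙ¹`. -/
def orthogonalJ (p : OnePoint ℂ) : EuclideanSpace ℝ (Fin 4) →L[ℝ] EuclideanSpace ℝ (Fin 4) :=
  Matrix.toEuclideanCLM (n := Fin 4) (𝕜 := ℝ)
    (quaternionMatrix (sphereOfP1 p).1 (sphereOfP1 p).2.1 (sphereOfP1 p).2.2)

theorem quaternionMatrix_mul (a b c p q r : ℝ) :
    quaternionMatrix a b c * quaternionMatrix p q r =
      quaternionMatrix (c * q - b * r) (a * r - c * p) (b * p - a * q)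
        - (a * p + b * q + c * r) • (1 : Matrix (Fin 4) (Fin 4) ℝ) := by
  ext i j
  fin_cases i <;> fin_cases j <;>
    simp [quaternionMatrix, Matrix.mul_apply, Fin.sum_univ_four] <;> ring

theorem hasDerivAt_sphere (x y u v : ℝ) :
    HasDerivAt (fun t : ℝ => 2 * (x + t * u) / ((x + t * u) ^ 2 + (y + t * v) ^ 2 + 1))
      ((2 * u * (x ^ 2 + y ^ 2 + 1) - 2 * x * (2 * x * u + 2 * y * v)) / (x ^ 2 + y ^ 2 + 1) ^ 2) 0 ∧
    HasDerivAt (fun t : ℝ => ((x + t * u) ^ 2 + (y + t * v) ^ 2 - 1) / 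
        ((x + t * u) ^ 2 + (y + t * v) ^ 2 + 1))
      (2 * (2 * x * u + 2 * y * v) / (x ^ 2 + y ^ 2 + 1) ^ 2) 0 := by
  have hx : ∀ x u : ℝ, HasDerivAt (fun t : ℝ => x + t * u) u 0 := by
    intro x u
    simpa using ((hasDerivAt_id (0 : ℝ)).mul_const u).const_add x
  have h2 := ((hx x u).pow 2).add ((hx y v).pow 2)
  have hN : (x + 0 * u) ^ 2 + (y + 0 * v) ^ 2 + 1 ≠ 0 := by positivity
  have hN' : x ^ 2 + y ^ 2 + 1 ≠ 0 := by positivity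
  constructor
  · refine (((hx x u).const_mul 2).div (h2.add_const 1) hN).congr_deriv ?_
    simp
  · refine ((h2.sub_const 1).div (h2.add_const 1) hN).congr_deriv ?_
    simp
    field_simp
    ring

/-- The complex structure of `ℝ⁴` as a function of the coordinate `z` (for `ε = 1`) or of the
coordinate `1 / z` (for `ε = -1`). -/
def sphereJ (ε : ℝ) (z : ℂ) : EuclideanSpace ℝ (Fin 4) →L[ℝ] EuclideanSpace ℝ (Fin 4) :=
  Matrix.toEuclideanCLM (n := Fin 4) (𝕜 := ℝ)
    (quaternionMatrix (2 * z.re / (z.re ^ 2 + z.im ^ 2 + 1))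
      (ε * (2 * z.im / (z.im ^ 2 + z.re ^ 2 + 1)))
      (ε * ((z.re ^ 2 + z.im ^ 2 - 1) / (z.re ^ 2 + z.im ^ 2 + 1))))

theorem quaternionMatrix_eq (a b c : ℝ) : quaternionMatrix a b c =
    a • quaternionMatrix 1 0 0 + b • quaternionMatrix 0 1 0 + c • quaternionMatrix 0 0 1 := by
  ext i j
  fin_cases i <;> fin_cases j <;> simp [quaternionMatrix]

theorem sphereJ_eq (ε : ℝ) (z : ℂ) : sphereJ ε z =
    (2 * z.re / (z.re ^ 2 + z.im ^ 2 + 1)) •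
      Matrix.toEuclideanCLM (n := Fin 4) (𝕜 := ℝ) (quaternionMatrix 1 0 0) +
    (ε * (2 * z.im / (z.im ^ 2 + z.re ^ 2 + 1))) •
      Matrix.toEuclideanCLM (n := Fin 4) (𝕜 := ℝ) (quaternionMatrix 0 1 0) +
    (ε * ((z.re ^ 2 + z.im ^ 2 - 1) / (z.re ^ 2 + z.im ^ 2 + 1))) •
      Matrix.toEuclideanCLM (n := Fin 4) (𝕜 := ℝ) (quaternionMatrix 0 0 1) := by
  rw [sphereJ, quaternionMatrix_eq]
  simp only [map_add, map_smul]

theorem contDiff_sphereJ (ε : ℝ) : ContDiff ℝ ω (sphereJ ε) := by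
  have hre : ContDiff ℝ ω Complex.re := Complex.reCLM.contDiff
  have him : ContDiff ℝ ω Complex.im := Complex.imCLM.contDiff
  have h1 : ∀ z : ℂ, z.re ^ 2 + z.im ^ 2 + 1 ≠ 0 := fun z => by positivity
  have h2 : ∀ z : ℂ, z.im ^ 2 + z.re ^ 2 + 1 ≠ 0 := fun z => by positivity
  have ha : ContDiff ℝ ω fun z : ℂ => 2 * z.re / (z.re ^ 2 + z.im ^ 2 + 1) :=
    (contDiff_const.mul hre).div (((hre.pow 2).add (him.pow 2)).add contDiff_const) h1
  have hb : ContDiff ℝ ω fun z : ℂ => ε * (2 * z.im / (z.im ^ 2 + z.re ^ 2 + 1)) :=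
    contDiff_const.mul
      ((contDiff_const.mul him).div (((him.pow 2).add (hre.pow 2)).add contDiff_const) h2)
  have hc : ContDiff ℝ ω fun z : ℂ =>
      ε * ((z.re ^ 2 + z.im ^ 2 - 1) / (z.re ^ 2 + z.im ^ 2 + 1)) :=
    contDiff_const.mul ((((hre.pow 2).add (him.pow 2)).sub contDiff_const).div
      (((hre.pow 2).add (him.pow 2)).add contDiff_const) h1)
  rw [funext (sphereJ_eq ε)]
  exact ((ha.smul contDiff_const).add (hb.smul contDiff_const)).add (hc.smul contDiff_const)

theorem fderiv_sphereJ (ε : ℝ) (z ζ : ℂ) : fderiv ℝ (sphereJ ε) z ζ =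
    Matrix.toEuclideanCLM (n := Fin 4) (𝕜 := ℝ) (quaternionMatrix
      ((2 * ζ.re * (z.re ^ 2 + z.im ^ 2 + 1) - 2 * z.re * (2 * z.re * ζ.re + 2 * z.im * ζ.im)) /
        (z.re ^ 2 + z.im ^ 2 + 1) ^ 2)
      (ε * ((2 * ζ.im * (z.im ^ 2 + z.re ^ 2 + 1) -
        2 * z.im * (2 * z.im * ζ.im + 2 * z.re * ζ.re)) / (z.im ^ 2 + z.re ^ 2 + 1) ^ 2))
      (ε * (2 * (2 * z.re * ζ.re + 2 * z.im * ζ.im) / (z.re ^ 2 + z.im ^ 2 + 1) ^ 2))) := by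
  have h0 : HasDerivAt (fun t : ℝ => z + t * ζ) ζ 0 := by
    simpa using ((Complex.ofRealCLM.hasDerivAt (x := (0 : ℝ))).mul_const ζ).const_add z
  have hd : HasFDerivAt (sphereJ ε) (fderiv ℝ (sphereJ ε) z) (z + ((0 : ℝ) : ℂ) * ζ) := by
    have h := ((contDiff_sphereJ ε).differentiable (by simp) z).hasFDerivAt
    simpa using h
  have h1 := hd.comp_hasDerivAt (0 : ℝ) h0
  have ha := (hasDerivAt_sphere z.re z.im ζ.re ζ.im).1
  have hb := ((hasDerivAt_sphere z.im z.re ζ.im ζ.re).1).const_mul ε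
  have hc := ((hasDerivAt_sphere z.re z.im ζ.re ζ.im).2).const_mul ε
  let T := Matrix.toEuclideanCLM (n := Fin 4) (𝕜 := ℝ)
  have h2 := ((ha.smul_const (T (quaternionMatrix 1 0 0))).add
    (hb.smul_const (T (quaternionMatrix 0 1 0)))).add (hc.smul_const (T (quaternionMatrix 0 0 1)))
  rw [quaternionMatrix_eq]
  simp only [map_add, map_smul]
  refine h1.unique (h2.congr_of_eventuallyEq (Filter.Eventually.of_forall fun t => ?_))
  simp only [Function.comp, sphereJ]
  rw [quaternionMatrix_eq]
  simp [T]

/-- The Cauchy-Riemann equation `J' = J J̇` for the family of complex structures of `ℝ⁴`. -/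
theorem fderiv_sphereJ_I (ε : ℝ) (hε : ε = 1 ∨ ε = -1) (z ζ : ℂ) :
    fderiv ℝ (sphereJ ε) z (Complex.I * ζ) = sphereJ ε z * fderiv ℝ (sphereJ ε) z ζ := by
  rw [fderiv_sphereJ, fderiv_sphereJ, sphereJ, ← map_mul, quaternionMatrix_mul]
  have hN : z.re ^ 2 + z.im ^ 2 + 1 ≠ 0 := by positivity
  have hN' : z.im ^ 2 + z.re ^ 2 + 1 ≠ 0 := by positivity
  congr 1
  rw [show ∀ (A : Matrix (Fin 4) (Fin 4) ℝ) (r : ℝ), r = 0 → A - r • 1 = A from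
    fun A r h => by simp [h]]
  · simp only [Complex.mul_re, Complex.I_re, Complex.I_im, Complex.mul_im]
    rcases hε with rfl | rfl <;> congr 1 <;> field_simp <;> ring
  · rcases hε with rfl | rfl <;> field_simp <;> ring

theorem quaternionMatrix_sq {a b c : ℝ} (h : a ^ 2 + b ^ 2 + c ^ 2 = 1) :
    quaternionMatrix a b c * quaternionMatrix a b c = -1 := by
  rw [quaternionMatrix_mul]
  ext i j
  fin_cases i <;> fin_cases j <;> simp [quaternionMatrix] <;> linarith

theorem sphereOfP1_mem (p : OnePoint ℂ) :
    (sphereOfP1 p).1 ^ 2 + (sphereOfP1 p).2.1 ^ 2 + (sphereOfP1 p).2.2 ^ 2 = 1 := by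
  induction p using OnePoint.rec with
  | infty => simp [sphereOfP1]
  | coe z =>
    have hN : z.re ^ 2 + z.im ^ 2 + 1 ≠ 0 := by positivity
    simp only [sphereOfP1, OnePoint.elim_some, Complex.sq_norm, Complex.normSq_apply]
    have hN : z.re * z.re + z.im * z.im + 1 ≠ 0 := by nlinarith [sq_nonneg z.re, sq_nonneg z.im]
    field_simp
    ring

theorem orthogonalJ_sq (p : OnePoint ℂ) (v : EuclideanSpace ℝ (Fin 4)) :
    orthogonalJ p (orthogonalJ p v) = -v := by
  have h : orthogonalJ p * orthogonalJ p = -1 := by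
    rw [orthogonalJ, ← map_mul, quaternionMatrix_sq (sphereOfP1_mem p)]
    simp
  exact DFunLike.congr_fun h v

theorem orthogonalJ_of_ne_infty {p : OnePoint ℂ} (hp : p ≠ OnePoint.infty) :
    orthogonalJ p = sphereJ 1 (affineCoord p) := by
  induction p using OnePoint.rec with
  | infty => exact absurd rfl hp
  | coe z =>
    simp only [orthogonalJ, sphereJ, affineCoord, sphereOfP1, OnePoint.elim_some,
      Complex.sq_norm, Complex.normSq_apply, id, one_mul]
    congr 2 <;> ring

theorem orthogonalJ_of_ne_zero {p : OnePoint ℂ} (hp : p ≠ ((0 : ℂ) : OnePoint ℂ)) :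
    orthogonalJ p = sphereJ (-1) (affineCoordInfty p) := by
  induction p using OnePoint.rec with
  | infty => simp [orthogonalJ, sphereJ, affineCoordInfty, sphereOfP1]
  | coe z =>
    have hz : z ≠ 0 := fun h => hp (by rw [h])
    have h1 : 0 < Complex.normSq z := Complex.normSq_pos.2 hz
    simp only [orthogonalJ, sphereJ, affineCoordInfty, sphereOfP1, OnePoint.elim_some,
      Complex.sq_norm, Complex.inv_re, Complex.inv_im]
    have h2 : z.re ^ 2 + z.im ^ 2 = Complex.normSq z := by rw [Complex.normSq_apply]; ring
    have h3 : (z.re / Complex.normSq z) ^ 2 + (-z.im / Complex.normSq z) ^ 2 =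
        1 / Complex.normSq z := by
      rw [div_pow, div_pow, ← add_div, neg_sq, h2]
      field_simp
    have h4 : (-z.im / Complex.normSq z) ^ 2 + (z.re / Complex.normSq z) ^ 2 =
        1 / Complex.normSq z := by rw [add_comm, h3]
    rw [h3, h4]
    congr 2 <;> field_simp <;> ring

end ProjectiveLine

/-! ## The warped complex manifold -/

section Warped

/-- A complex analytic manifold of dimension one is a real analytic surface. -/
instance realManifold (M₁ : Type*) [TopologicalSpace M₁] [ChartedSpace ℂ M₁]
    [IsManifold 𝓘(ℂ) ω M₁] : IsManifold 𝓘(ℝ, ℂ) ω M₁ := by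
  refine isManifold_of_contDiffOn _ _ _ fun c c' hc hc' => ?_
  have := (contDiffGroupoid ω 𝓘(ℂ)).compatible hc hc'
  rw [contDiffGroupoid, mem_groupoid_of_pregroupoid] at this
  exact this.1.restrict_scalars ℝ

section Surface

variable {M₁ : Type*} [TopologicalSpace M₁] [ChartedSpace ℂ M₁] [IsManifold 𝓘(ℂ) ω M₁]

theorem contDiffAt_of_eventually_mdifferentiableAt {g : M₁ → ℂ} {y₀ : M₁}
    (hg : ∀ᶠ y in 𝓝 y₀, MDifferentiableAt 𝓘(ℂ) 𝓘(ℂ) g y) :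
    ContDiffAt ℂ ω (g ∘ (chartAt ℂ y₀).symm) (chartAt ℂ y₀ y₀) := by
  have h1 : ∀ᶠ ζ in 𝓝 (chartAt ℂ y₀ y₀), ζ ∈ (chartAt ℂ y₀).target :=
    (chartAt ℂ y₀).open_target.mem_nhds (mem_chart_target ℂ y₀)
  have h2 : ∀ᶠ ζ in 𝓝 (chartAt ℂ y₀ y₀),
      MDifferentiableAt 𝓘(ℂ) 𝓘(ℂ) g ((chartAt ℂ y₀).symm ζ) := by
    have h3 := (chartAt ℂ y₀).continuousAt_symm (mem_chart_target ℂ y₀)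
    rw [ContinuousAt, (chartAt ℂ y₀).left_inv (mem_chart_source ℂ y₀)] at h3
    exact h3.eventually hg
  refine (Complex.analyticAt_iff_eventually_differentiableAt.2 ?_).contDiffAt
  filter_upwards [h1, h2] with ζ hζ hgζ
  have h4 := mdifferentiableAt_atlas_symm (I := 𝓘(ℂ)) (chart_mem_atlas ℂ y₀) hζ
  exact (hgζ.comp ζ h4).differentiableAt

/-- In the preferred chart around `y₀`, the map `y ↦ J_{f(y)}` is one of the two standard families
composed with a holomorphic function. -/
theorem exists_orthogonalJ_eq {f : M₁ → OnePoint ℂ} (hf : IsHolomorphicToP1 f) (y₀ : M₁) :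
    ∃ (ε : ℝ) (g : M₁ → ℂ), (ε = 1 ∨ ε = -1) ∧
      ContDiffAt ℂ ω (g ∘ (chartAt ℂ y₀).symm) (chartAt ℂ y₀ y₀) ∧ ContinuousAt g y₀ ∧
      ∀ᶠ y in 𝓝 y₀, orthogonalJ (f y) = sphereJ ε (g y) := by
  by_cases h : f y₀ = OnePoint.infty
  · have h1 : ∀ᶠ y in 𝓝 y₀, f y ≠ ((0 : ℂ) : OnePoint ℂ) :=
      hf.continuous.continuousAt.eventually_ne (by rw [h]; exact OnePoint.infty_ne_coe 0)
    exact ⟨-1, affineCoordInfty ∘ f, Or.inr rfl,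
      contDiffAt_of_eventually_mdifferentiableAt (h1.mono hf.infty),
      (hf.infty _ h1.self_of_nhds).continuousAt,
      h1.mono fun y hy => orthogonalJ_of_ne_zero hy⟩
  · have h1 : ∀ᶠ y in 𝓝 y₀, f y ≠ OnePoint.infty :=
      hf.continuous.continuousAt.eventually_ne h
    exact ⟨1, affineCoord ∘ f, Or.inl rfl,
      contDiffAt_of_eventually_mdifferentiableAt (h1.mono hf.affine),
      (hf.affine _ h1.self_of_nhds).continuousAt,
      h1.mono fun y hy => orthogonalJ_of_ne_infty hy⟩

theorem contMDiffAt_orthogonalJ {f : M₁ → OnePoint ℂ} (hf : IsHolomorphicToP1 f) (y₀ : M₁) :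
    ContMDiffAt 𝓘(ℝ, ℂ) 𝓘(ℝ, EuclideanSpace ℝ (Fin 4) →L[ℝ] EuclideanSpace ℝ (Fin 4)) ∞
      (fun y => orthogonalJ (f y)) y₀ := by
  obtain ⟨ε, g, -, hg, hgc, he⟩ := exists_orthogonalJ_eq hf y₀
  have h1 : ContMDiffAt 𝓘(ℝ, ℂ) 𝓘(ℝ, ℂ) ∞ g y₀ := by
    rw [contMDiffAt_iff]
    refine ⟨hgc, ?_⟩
    have := (hg.restrict_scalars ℝ).of_le (m := ∞) le_top
    simpa [mfld_simps, contDiffWithinAt_univ, chartAt_self_eq] using this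
  have h2 := ((contDiff_sphereJ ε).contDiffAt (x := g y₀)).of_le (m := ∞) le_top
  exact (h2.contMDiffAt.comp y₀ h1).congr_of_eventuallyEq he

theorem fderiv_orthogonalJ {f : M₁ → OnePoint ℂ} (hf : IsHolomorphicToP1 f) (y₀ : M₁) :
    ∃ G' : ℂ →L[ℝ] (EuclideanSpace ℝ (Fin 4) →L[ℝ] EuclideanSpace ℝ (Fin 4)),
      HasFDerivAt (fun ζ => orthogonalJ (f ((chartAt ℂ y₀).symm ζ))) G' (chartAt ℂ y₀ y₀) ∧
      ∀ ζ, G' (Complex.I * ζ) = orthogonalJ (f y₀) * G' ζ := by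
  obtain ⟨ε, g, hε, hg, -, he⟩ := exists_orthogonalJ_eq hf y₀
  have h3 := (chartAt ℂ y₀).continuousAt_symm (mem_chart_target ℂ y₀)
  rw [ContinuousAt, (chartAt ℂ y₀).left_inv (mem_chart_source ℂ y₀)] at h3
  have hd := (hg.differentiableAt (by simp)).hasFDerivAt
  have hS := ((contDiff_sphereJ ε).differentiable (by simp)
    ((g ∘ (chartAt ℂ y₀).symm) (chartAt ℂ y₀ y₀))).hasFDerivAt
  refine ⟨_, (hS.comp _ (hd.restrictScalars ℝ)).congr_of_eventuallyEq (h3.eventually he), ?_⟩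
  intro ζ
  simp only [ContinuousLinearMap.comp_apply, ContinuousLinearMap.coe_restrictScalars']
  rw [← smul_eq_mul, map_smul, smul_eq_mul, fderiv_sphereJ_I ε hε, he.self_of_nhds]
  simp [(chartAt ℂ y₀).left_inv (mem_chart_source ℂ y₀)]

end Surface

variable {M₁ : Type*} [TopologicalSpace M₁] [ChartedSpace ℂ M₁] 
  (Λ : Submodule ℤ (EuclideanSpace ℝ (Fin 4))) [DiscreteTopology Λ]

/-- The model with corners of the real six-dimensional manifold `M₁ × ℝ⁴ / Λ`. -/
abbrev warpedModel := (𝓘(ℝ, ℂ)).prod 𝓘(ℝ, EuclideanSpace ℝ (Fin 4))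

/-- `J = J₁ + J_z` on `ℂ × ℝ⁴`. -/
def modelJ (p : OnePoint ℂ) :
    ℂ × EuclideanSpace ℝ (Fin 4) →L[ℝ] ℂ × EuclideanSpace ℝ (Fin 4) :=
  ContinuousLinearMap.prodMap (Complex.I • ContinuousLinearMap.id ℝ ℂ) (orthogonalJ p)

/-- The field of endomorphisms `J = J₁ + J_{f(y₁)}` at `(y₁, y₂) ∈ M₁ × ℝ⁴ / Λ`.  The tangent space
is `ℂ × ℝ⁴`, where `J₁` is multiplication by `i` on `ℂ` (the charts of `M₁` being holomorphic) and
`ℝ⁴` is spanned by the parallel frame of the torus (the changes of charts being translations). -/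
def warpedJ (f : M₁ → OnePoint ℂ) (x : M₁ × FlatTorus Λ) :
    TangentSpace warpedModel x →L[ℝ] TangentSpace warpedModel x :=
  modelJ (f x.1)

variable [IsManifold 𝓘(ℂ) ω M₁]

theorem tangentCoordChange_modelJ (p : OnePoint ℂ) (x y z : M₁ × FlatTorus Λ)
    (hzx : z ∈ (chartAt (ModelProd ℂ (EuclideanSpace ℝ (Fin 4))) x).source)
    (hzy : z ∈ (chartAt (ModelProd ℂ (EuclideanSpace ℝ (Fin 4))) y).source)
    (v : ℂ × EuclideanSpace ℝ (Fin 4)) :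
    tangentCoordChange warpedModel x y z (modelJ p v) =
      modelJ p (tangentCoordChange warpedModel x y z v) := by
  have h := hasFDerivWithinAt_tangentCoordChange (I := warpedModel) (x := x) (y := y) (z := z)
    ⟨by simpa using hzx, by simpa using hzy⟩
  rw [ModelWithCorners.range_eq_univ, hasFDerivWithinAt_univ] at h
  rw [prodChartedSpace_chartAt] at hzx hzy
  have hx1 : z.1 ∈ (chartAt ℂ x.1).source := hzx.1
  have hx2 : z.2 ∈ (chartAt (EuclideanSpace ℝ (Fin 4)) x.2).source := hzx.2
  have hy1 : z.1 ∈ (chartAt ℂ y.1).source := hzy.1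
  have hy2 : z.2 ∈ (chartAt (EuclideanSpace ℝ (Fin 4)) y.2).source := hzy.2
  have ht1 : HasFDerivAt (𝕜 := ℂ) (chartAt ℂ y.1 ∘ (chartAt ℂ x.1).symm)
      (tangentCoordChange 𝓘(ℂ) x.1 y.1 z.1) (chartAt ℂ x.1 z.1) := by
    have h1 := hasFDerivWithinAt_tangentCoordChange (I := 𝓘(ℂ)) (x := x.1) (y := y.1) (z := z.1)
      ⟨by simpa using hx1, by simpa using hy1⟩
    rw [ModelWithCorners.range_eq_univ, hasFDerivWithinAt_univ] at h1
    simpa [mfld_simps] using h1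
  have ht2 : HasFDerivAt (chartAt (EuclideanSpace ℝ (Fin 4)) y.2 ∘
      (chartAt (EuclideanSpace ℝ (Fin 4)) x.2).symm)
      (ContinuousLinearMap.id ℝ (EuclideanSpace ℝ (Fin 4)))
      (chartAt (EuclideanSpace ℝ (Fin 4)) x.2 z.2) := by
    obtain ⟨b, hb⟩ := FlatTorus.transition_eventuallyEq Λ
      (chart_mem_atlas (EuclideanSpace ℝ (Fin 4)) x.2)
      (chart_mem_atlas (EuclideanSpace ℝ (Fin 4)) y.2)
      (v := chartAt (EuclideanSpace ℝ (Fin 4)) x.2 z.2) (by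
        simp [hx2, hy2])
    exact ((hasFDerivAt_id _).add_const b).congr_of_eventuallyEq hb
  have h2 := (ht1.restrictScalars ℝ).prodMap (p := (chartAt ℂ x.1 z.1,
    chartAt (EuclideanSpace ℝ (Fin 4)) x.2 z.2)) ht2
  have h3 := h.unique h2
  rw [h3]
  obtain ⟨v1, v2⟩ := v
  refine Prod.ext ?_ ?_
  · simp [modelJ, mul_assoc]
  · simp [modelJ]

/-- The vector field `X` near `x₀`, written in the preferred chart around `x₀`. -/
def localField (X : ∀ x : M₁ × FlatTorus Λ, TangentSpace warpedModel x) (x₀ x : M₁ × FlatTorus Λ) :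
    ℂ × EuclideanSpace ℝ (Fin 4) :=
  tangentCoordChange warpedModel x x₀ x (X x)

variable {Λ}

theorem contMDiffAt_iff_localField (X : ∀ x : M₁ × FlatTorus Λ, TangentSpace warpedModel x)
    (x₀ : M₁ × FlatTorus Λ) :
    ContMDiffAt warpedModel warpedModel.tangent ∞
      (fun x => (⟨x, X x⟩ : TangentBundle warpedModel (M₁ × FlatTorus Λ))) x₀ ↔
    ContMDiffAt warpedModel 𝓘(ℝ, ℂ × EuclideanSpace ℝ (Fin 4)) ∞ (localField Λ X x₀) x₀ :=
  Bundle.contMDiffAt_section x₀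

theorem localField_warpedJ (f : M₁ → OnePoint ℂ)
    (X : ∀ x : M₁ × FlatTorus Λ, TangentSpace warpedModel x) {x₀ x : M₁ × FlatTorus Λ}
    (hx : x ∈ (chartAt (ModelProd ℂ (EuclideanSpace ℝ (Fin 4))) x₀).source) :
    localField Λ (fun x => warpedJ Λ f x (X x)) x₀ x = modelJ (f x.1) (localField Λ X x₀ x) :=
  tangentCoordChange_modelJ Λ (f x.1) x x₀ x (mem_chart_source _ x) hx (X x)

theorem warpedJ_smooth {f : M₁ → OnePoint ℂ} (hf : IsHolomorphicToP1 f)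
    (X : ∀ x : M₁ × FlatTorus Λ, TangentSpace warpedModel x) (x₀ : M₁ × FlatTorus Λ)
    (hX : ContMDiffAt warpedModel warpedModel.tangent ∞
      (fun x => (⟨x, X x⟩ : TangentBundle warpedModel (M₁ × FlatTorus Λ))) x₀) :
    ContMDiffAt warpedModel warpedModel.tangent ∞
      (fun x => (⟨x, warpedJ Λ f x (X x)⟩ : TangentBundle warpedModel (M₁ × FlatTorus Λ))) x₀ := by
  rw [contMDiffAt_iff_localField] at hX ⊢
  have h1 : ∀ᶠ x in 𝓝 x₀,
      localField Λ (fun x => warpedJ Λ f x (X x)) x₀ x = modelJ (f x.1) (localField Λ X x₀ x) := by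
    filter_upwards [(chartAt (ModelProd ℂ (EuclideanSpace ℝ (Fin 4))) x₀).open_source.mem_nhds
      (mem_chart_source _ x₀)] with x hx
    exact localField_warpedJ f X hx
  refine ContMDiffAt.congr_of_eventuallyEq ?_ h1
  have h2 := (contMDiffAt_orthogonalJ hf x₀.1).comp x₀
    (contMDiffAt_fst (I := 𝓘(ℝ, ℂ)) (J := 𝓘(ℝ, EuclideanSpace ℝ (Fin 4))) (n := ∞) (p := x₀))
  have hL : ContDiff ℝ ∞ (fun q : (ℂ × EuclideanSpace ℝ (Fin 4)) ×
      (EuclideanSpace ℝ (Fin 4) →L[ℝ] EuclideanSpace ℝ (Fin 4)) =>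
      ((Complex.I • q.1.1, q.2 q.1.2) : ℂ × EuclideanSpace ℝ (Fin 4))) := by
    fun_prop
  exact hL.contMDiff.contMDiffAt.comp x₀ (hX.prodMk_space h2)

theorem mlieBracket_eq (X Y : ∀ x : M₁ × FlatTorus Λ, TangentSpace warpedModel x)
    (x₀ : M₁ × FlatTorus Λ) :
    VectorField.mlieBracket warpedModel X Y x₀ =
      VectorField.lieBracket ℝ (fun e => localField Λ X x₀ ((extChartAt warpedModel x₀).symm e))
        (fun e => localField Λ Y x₀ ((extChartAt warpedModel x₀).symm e))
        (extChartAt warpedModel x₀ x₀) := by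
  have hpull : ∀ Z : ∀ x : M₁ × FlatTorus Λ, TangentSpace warpedModel x,
      VectorField.mpullbackWithin 𝓘(ℝ, ℂ × EuclideanSpace ℝ (Fin 4)) warpedModel
        (extChartAt warpedModel x₀).symm Z (Set.range warpedModel)
      =ᶠ[𝓝 (extChartAt warpedModel x₀ x₀)]
      fun e => localField Λ Z x₀ ((extChartAt warpedModel x₀).symm e) := by
    intro Z
    filter_upwards [extChartAt_target_mem_nhds (I := warpedModel) x₀] with e he
    rw [VectorField.mpullbackWithin_apply]
    have h1 := mfderiv_extChartAt_comp_mfderivWithin_extChartAt_symm he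
    have h2 := mfderivWithin_extChartAt_symm_comp_mfderiv_extChartAt he
    have h3 : (extChartAt warpedModel x₀).symm e ∈
        (chartAt (ModelProd ℂ (EuclideanSpace ℝ (Fin 4))) x₀).source := by
      have h4 := (extChartAt warpedModel x₀).map_target he
      rwa [extChartAt_source] at h4
    rw [ContinuousLinearMap.inverse_eq h2 h1, (hasMFDerivAt_extChartAt h3).mfderiv,
      mfderiv_chartAt_eq_tangentCoordChange h3]
    rfl
  have hid : mfderiv warpedModel 𝓘(ℝ, ℂ × EuclideanSpace ℝ (Fin 4)) (extChartAt warpedModel x₀) x₀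
      = ContinuousLinearMap.id ℝ (ℂ × EuclideanSpace ℝ (Fin 4)) := by
    refine ((hasMFDerivAt_extChartAt (I := warpedModel) (mem_chart_source _ x₀)).mfderiv.trans
      (mfderiv_chartAt_eq_tangentCoordChange (I := warpedModel) (mem_chart_source _ x₀))).trans ?_
    exact ContinuousLinearMap.ext fun v =>
      tangentCoordChange_self (I := warpedModel) (mem_extChartAt_source x₀)
  rw [VectorField.mlieBracket, VectorField.mlieBracketWithin_apply, hid]
  rw [Set.preimage_univ, Set.univ_inter]
  have hrange : Set.range (warpedModel : ModelProd ℂ (EuclideanSpace ℝ (Fin 4)) →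
      ℂ × EuclideanSpace ℝ (Fin 4)) = Set.univ := ModelWithCorners.range_eq_univ _
  have h5 := (hpull X).lieBracket_vectorField_eq (𝕜 := ℝ) (hpull Y)
  have h6 : ∀ (V W : ℂ × EuclideanSpace ℝ (Fin 4) → ℂ × EuclideanSpace ℝ (Fin 4)) (e),
      VectorField.lieBracketWithin ℝ V W (Set.range (warpedModel :
        ModelProd ℂ (EuclideanSpace ℝ (Fin 4)) → ℂ × EuclideanSpace ℝ (Fin 4))) e =
      VectorField.lieBracket ℝ V W e := by
    intro V W e
    rw [hrange, VectorField.lieBracketWithin_univ]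
  have hinv : ∀ w : ℂ × EuclideanSpace ℝ (Fin 4),
      (ContinuousLinearMap.id ℝ (ℂ × EuclideanSpace ℝ (Fin 4))).inverse w = w := by simp
  exact (hinv _).trans ((h6 _ _ _).trans h5)

/-- The vector identity behind the vanishing of the Nijenhuis tensor. -/
theorem nijenhuis_aux {W : Type*} [NormedAddCommGroup W] [NormedSpace ℝ W]
    {K : W → W →L[ℝ] W} {K' : W →L[ℝ] W →L[ℝ] W} {X Y : W → W} {e₀ : W}
    (hK : HasFDerivAt K K' e₀) (hX : DifferentiableAt ℝ X e₀) (hY : DifferentiableAt ℝ Y e₀)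
    (hsq : ∀ v, K e₀ (K e₀ v) = -v) (hCR : ∀ v w, K' (K e₀ v) w = K e₀ (K' v w)) :
    VectorField.lieBracket ℝ X Y e₀
      - VectorField.lieBracket ℝ (fun e => K e (X e)) (fun e => K e (Y e)) e₀
      + K e₀ (VectorField.lieBracket ℝ (fun e => K e (X e)) Y e₀)
      + K e₀ (VectorField.lieBracket ℝ X (fun e => K e (Y e)) e₀) = 0 := by
  have h1 := (hK.clm_apply hX.hasFDerivAt).fderiv
  have h2 := (hK.clm_apply hY.hasFDerivAt).fderiv
  simp only [VectorField.lieBracket, h1, h2, add_apply, ContinuousLinearMap.comp_apply,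
    ContinuousLinearMap.flip_apply, map_add, map_sub, hCR, hsq]
  abel

theorem warpedJ_integrable {f : M₁ → OnePoint ℂ} (hf : IsHolomorphicToP1 f)
    (X Y : ∀ x : M₁ × FlatTorus Λ, TangentSpace warpedModel x) (x₀ : M₁ × FlatTorus Λ)
    (hX : ContMDiffAt warpedModel warpedModel.tangent ∞
      (fun x => (⟨x, X x⟩ : TangentBundle warpedModel (M₁ × FlatTorus Λ))) x₀)
    (hY : ContMDiffAt warpedModel warpedModel.tangent ∞
      (fun x => (⟨x, Y x⟩ : TangentBundle warpedModel (M₁ × FlatTorus Λ))) x₀) :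
    VectorField.mlieBracket warpedModel X Y x₀
      - VectorField.mlieBracket warpedModel (fun x => warpedJ Λ f x (X x))
          (fun x => warpedJ Λ f x (Y x)) x₀
      + warpedJ Λ f x₀ (VectorField.mlieBracket warpedModel (fun x => warpedJ Λ f x (X x)) Y x₀)
      + warpedJ Λ f x₀ (VectorField.mlieBracket warpedModel X (fun x => warpedJ Λ f x (Y x)) x₀)
      = 0 := by
  simp only [mlieBracket_eq]
  rw [contMDiffAt_iff_localField] at hX hY
  set e₀ := extChartAt warpedModel x₀ x₀ with he₀
  have hdiff : ∀ Z : ∀ x : M₁ × FlatTorus Λ, TangentSpace warpedModel x,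
      ContMDiffAt warpedModel 𝓘(ℝ, ℂ × EuclideanSpace ℝ (Fin 4)) ∞ (localField Λ Z x₀) x₀ →
      DifferentiableAt ℝ (fun e => localField Λ Z x₀ ((extChartAt warpedModel x₀).symm e)) e₀ := by
    intro Z hZ
    have h := (contMDiffAt_iff.1 hZ).2
    rw [ModelWithCorners.range_eq_univ, contDiffWithinAt_univ] at h
    exact h.differentiableAt (by simp)
  have hJ : ∀ Z : ∀ x : M₁ × FlatTorus Λ, TangentSpace warpedModel x,
      (fun e => localField Λ (fun x => warpedJ Λ f x (Z x)) x₀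
        ((extChartAt warpedModel x₀).symm e)) =ᶠ[𝓝 e₀]
      fun e => modelJ (f ((extChartAt warpedModel x₀).symm e).1)
        (localField Λ Z x₀ ((extChartAt warpedModel x₀).symm e)) := by
    intro Z
    filter_upwards [extChartAt_target_mem_nhds (I := warpedModel) x₀] with e he
    refine localField_warpedJ f Z ?_
    have h4 := (extChartAt warpedModel x₀).map_target he
    rwa [extChartAt_source] at h4
  rw [(hJ X).lieBracket_vectorField_eq (hJ Y),
    (hJ X).lieBracket_vectorField_eq (Filter.EventuallyEq.refl _ _),
    Filter.EventuallyEq.lieBracket_vectorField_eq (Filter.EventuallyEq.refl _ _) (hJ Y)]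
  obtain ⟨G', hG', hCR⟩ := fderiv_orthogonalJ hf x₀.1
  let L : (EuclideanSpace ℝ (Fin 4) →L[ℝ] EuclideanSpace ℝ (Fin 4)) →L[ℝ]
      (ℂ × EuclideanSpace ℝ (Fin 4) →L[ℝ] ℂ × EuclideanSpace ℝ (Fin 4)) :=
    (ContinuousLinearMap.compL ℝ (ℂ × EuclideanSpace ℝ (Fin 4)) (EuclideanSpace ℝ (Fin 4))
      (ℂ × EuclideanSpace ℝ (Fin 4)) (ContinuousLinearMap.inr ℝ ℂ (EuclideanSpace ℝ (Fin 4)))).comp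
    ((ContinuousLinearMap.compL ℝ (ℂ × EuclideanSpace ℝ (Fin 4)) (EuclideanSpace ℝ (Fin 4))
      (EuclideanSpace ℝ (Fin 4))).flip (ContinuousLinearMap.snd ℝ ℂ (EuclideanSpace ℝ (Fin 4))))
  let C : ℂ × EuclideanSpace ℝ (Fin 4) →L[ℝ] ℂ × EuclideanSpace ℝ (Fin 4) :=
    ContinuousLinearMap.prodMap (Complex.I • ContinuousLinearMap.id ℝ ℂ) 0
  have hLK : ∀ p, modelJ p = C + L (orthogonalJ p) := by
    intro p
    refine ContinuousLinearMap.ext fun v => ?_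
    refine Prod.ext ?_ ?_ <;> simp [modelJ, C, L]
  have hfst : HasFDerivAt (fun e : ℂ × EuclideanSpace ℝ (Fin 4) => e.1)
      (ContinuousLinearMap.fst ℝ ℂ (EuclideanSpace ℝ (Fin 4))) e₀ := hasFDerivAt_fst
  have hG2 : HasFDerivAt (fun ζ => orthogonalJ (f ((chartAt ℂ x₀.1).symm ζ))) G' e₀.1 := hG'
  have hK : HasFDerivAt (fun e => modelJ (f ((extChartAt warpedModel x₀).symm e).1))
      (L.comp (G'.comp (ContinuousLinearMap.fst ℝ ℂ (EuclideanSpace ℝ (Fin 4))))) e₀ := by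
    simp only [hLK]
    exact (L.hasFDerivAt.comp e₀ (hG2.comp e₀ hfst)).const_add C
  have hbase : (extChartAt warpedModel x₀).symm e₀ = x₀ := extChartAt_to_inv x₀
  have hfin := nijenhuis_aux hK (hdiff X hX) (hdiff Y hY) ?_ ?_
  · simp only [hbase] at hfin
    exact hfin
  · intro v
    refine Prod.ext ?_ ?_
    · simp [modelJ, ← mul_assoc]
    · simp [modelJ, orthogonalJ_sq]
  · intro v w
    simp only [hbase]
    refine Prod.ext ?_ ?_
    · simp [modelJ, L]
    · simp [modelJ, L, hCR]

/-- The warped complex manifold `M_f = M₁ × ℝ⁴ / Λ`. -/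
def warpedComplexStructure (Λ : Submodule ℤ (EuclideanSpace ℝ (Fin 4))) [DiscreteTopology Λ]
    (f : M₁ → OnePoint ℂ) (hf : IsHolomorphicToP1 f) :
    ComplexStructure warpedModel (M₁ × FlatTorus Λ) where
  J := warpedJ Λ f
  sq_eq_neg x v := by
    have h : ∀ w : ℂ × EuclideanSpace ℝ (Fin 4), modelJ (f x.1) (modelJ (f x.1) w) = -w := by
      intro w
      refine Prod.ext ?_ ?_
      · simp [modelJ, ← mul_assoc]
      · simp [modelJ, orthogonalJ_sq]
    exact h v
  smooth X x₀ hX := warpedJ_smooth hf X x₀ hX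
  integrable X Y x₀ hX hY := warpedJ_integrable hf X Y x₀ hX hY

end Warped

end

/-!
The proof is a maximum principle on `M₁`.

Let `ω` be the fundamental form of a pluriclosed Hermitian metric `h` on `M₁ × ℝ⁴ / Λ`. In the
parametrization of the manifold by a chart of `M₁` times the covering `ℝ⁴ → ℝ⁴ / Λ`, all the data
are periodic under `Λ` and the complex structure is `i ⊕ K(ζ)`, where `K = J_f` depends on the
coordinate `ζ` of `M₁` only. Hence averaging over the torus commutes with `d`
(`torusAverage_extDeriv`) and with taking parts of a given type (`torusAverage_typePart`), and the
averaged form `Ω` is a pluriclosed form of type `(1, 1)` whose coefficients depend on `ζ` only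
(`averagedForm_isPluriclosed`).

Let `A(ζ)` be the endomorphism of `ℝ⁴` representing the restriction of `Ω` to the torus directions,
so that `s = tr (A K)` is the average over the torus of the trace of `h` in these directions; it is
positive. Evaluating `∂∂̄Ω = 0` on a horizontal complex line and a vertical one gives
`tr ((∂_x (K A_x K) + ∂_y (K A_y K)) K) = 0` (`trace_eq_zero_of_invariant`). On the other hand `K`
is a holomorphic map to the sphere of orthogonal complex structures: `K² = -1`, `K_y = K K_x`, and
`K_x² = -κ` with a function `κ ≥ 0` vanishing exactly where the derivative of `f` does. These
relations turn the equation into `Δ s = -2 κ s` (`planeLaplacian_trace`).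

The values of `s` in the charts come from one continuous function on the compact surface `M₁`
(`torusEnergy`), which therefore attains its minimum. It is superharmonic, and since `f` is not
constant, the zeros of `κ` are isolated (`fderiv_chartJ_eventually_ne_zero`), so it is strictly
superharmonic in a punctured neighbourhood of the minimum. This is impossible
(`not_isMin_of_planeLaplacian_neg`). A Kähler metric is pluriclosed, as `dω = 0` implies `∂̄ω = 0`.
-/

noncomputable section

set_option linter.unusedSectionVars false

/-! ### Averaging over the torus -/

section TorusAverage

open MeasureTheory
open scoped Pointwise

variable {X V W : Type} [NormedAddCommGroup X] [NormedSpace ℝ X] [ProperSpace X]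
  [NormedAddCommGroup V] [NormedSpace ℝ V] [FiniteDimensional ℝ V] [MeasureSpace V] [BorelSpace V]
  [(volume : Measure V).IsAddHaarMeasure]
  [NormedAddCommGroup W] [NormedSpace ℝ W]
  (Λ : Submodule ℤ V) [DiscreteTopology Λ] [IsZLattice ℝ Λ]

/-- A bounded fundamental domain of the lattice `Λ`. -/
def latticeCell : Set V :=
  ZSpan.fundamentalDomain ((Module.Free.chooseBasis ℤ Λ).ofZLatticeBasis ℝ)

theorem isAddFundamentalDomain_latticeCell : IsAddFundamentalDomain Λ (latticeCell Λ) volume :=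
  ZLattice.isAddFundamentalDomain _ _

theorem isBounded_latticeCell : Bornology.IsBounded (latticeCell Λ) :=
  ZSpan.fundamentalDomain_isBounded _

theorem measurableSet_latticeCell : MeasurableSet (latticeCell Λ) :=
  ZSpan.fundamentalDomain_measurableSet _

instance isFiniteMeasure_latticeCell :
    IsFiniteMeasure ((volume : Measure V).restrict (latticeCell Λ)) :=
  ⟨by simpa using (isBounded_latticeCell Λ).measure_lt_top⟩

theorem integrableOn_latticeCell {g : V → W} (hg : Continuous g) :
    IntegrableOn g (latticeCell Λ) :=
  (hg.continuousOn.integrableOn_compact (μ := volume)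
    (isBounded_latticeCell Λ).isCompact_closure).mono_set subset_closure

/-- The integral of a periodic function over a fundamental domain is invariant under translations. -/
theorem setIntegral_latticeCell_add (g : V → W) (hg : ∀ t, ∀ l ∈ Λ, g (t + l) = g t) (a : V) :
    ∫ t in latticeCell Λ, g (t + a) = ∫ t in latticeCell Λ, g t := by
  have h1 : IsAddFundamentalDomain Λ (a +ᵥ latticeCell Λ) volume :=
    (isAddFundamentalDomain_latticeCell Λ).vadd_of_comm a
  have : VAddInvariantMeasure Λ V volume :=
    inferInstanceAs (VAddInvariantMeasure Λ.toAddSubgroup V volume)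
  have h2 := h1.setIntegral_eq (isAddFundamentalDomain_latticeCell Λ) (f := g) (by
    intro l x
    have := hg x l l.2
    rw [add_comm] at this
    exact this)
  rw [← h2]
  have h3 := (measurePreserving_vadd a (volume : Measure V)).setIntegral_image_emb
    (measurableEmbedding_const_vadd _) g (latticeCell Λ)
  rw [Set.image_vadd] at h3
  rw [h3]
  simp only [vadd_eq_add, add_comm]

/-- The integral of `G (ζ, ·)` over a fundamental domain of `Λ`: the average up to a constant factor,
the covolume of `Λ`. -/
def torusAverage (G : X × V → W) (ζ : X) : W := ∫ t in latticeCell Λ, G (ζ, t)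

/-- On `U × V`, the function `G` is invariant under translations of the second variable by `Λ`. -/
def IsPeriodicOn (U : Set X) (G : X × V → W) : Prop :=
  ∀ ζ ∈ U, ∀ t, ∀ l ∈ Λ, G (ζ, t + l) = G (ζ, t)

variable {Λ} {U : Set X} {G : X × V → W}

theorem IsPeriodicOn.fderiv (hU : IsOpen U) (hG : IsPeriodicOn Λ U G) :
    IsPeriodicOn Λ U (fderiv ℝ G) := by
  intro ζ hζ t l hl
  have h1 : (fun e : X × V => G (e + (0, l))) =ᶠ[𝓝 (ζ, t)] G := by
    filter_upwards [(hU.prod isOpen_univ).mem_nhds (show (ζ, t) ∈ U ×ˢ Set.univ from ⟨hζ, trivial⟩)]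
      with e he
    have h := hG e.1 he.1 e.2 l hl
    have h2 : e + (0, l) = (e.1, e.2 + l) := by ext <;> simp
    exact h2 ▸ h
  have h2 := h1.fderiv_eq (𝕜 := ℝ)
  rw [fderiv_comp_add_right] at h2
  simpa using h2

/-- Differentiation commutes with averaging over the torus; derivatives in the direction of the
torus average to zero.  The average is rewritten as an integral of translates of `G` along the
torus, so that a single differentiation under the integral sign gives both. -/
theorem hasFDerivAt_torusAverage (hU : IsOpen U) (hG : ContDiffOn ℝ 1 G (U ×ˢ Set.univ))
    (hper : IsPeriodicOn Λ U G) {e : X × V} (he : e.1 ∈ U) :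
    HasFDerivAt (fun e : X × V => torusAverage Λ G e.1) (torusAverage Λ (fderiv ℝ G) e.1) e := by
  obtain ⟨ζ, t₀⟩ := e
  simp only at he
  have hUo : IsOpen (U ×ˢ (Set.univ : Set V)) := hU.prod isOpen_univ
  have hdiff : ∀ e ∈ U ×ˢ (Set.univ : Set V), HasFDerivAt G (fderiv ℝ G e) e := fun e h =>
    ((hG.differentiableOn (by simp)).differentiableAt (hUo.mem_nhds h)).hasFDerivAt
  have hcont' : ContinuousOn (fderiv ℝ G) (U ×ˢ Set.univ) :=
    hG.continuousOn_fderiv_of_isOpen hUo le_rfl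
  obtain ⟨r, hr, hrU⟩ := Metric.isOpen_iff.1 hU ζ he
  have hsub : Metric.closedBall ζ (r / 2) ⊆ U :=
    (Metric.closedBall_subset_ball (by linarith)).trans hrU
  -- all translates by points of the cell of points near `(ζ, 0)` stay in this compact set
  set C : Set (X × V) := Metric.closedBall ζ (r / 2) ×ˢ
    Metric.cthickening 1 (closure (latticeCell Λ)) with hC
  have hCc : IsCompact C := (isCompact_closedBall ζ (r / 2)).prod
    (isBounded_latticeCell Λ).isCompact_closure.cthickening
  have hCU : C ⊆ U ×ˢ Set.univ := fun e h => ⟨hsub h.1, trivial⟩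
  obtain ⟨B, hB⟩ := hCc.exists_bound_of_continuousOn (hcont'.mono hCU)
  have hmem : ∀ e ∈ Metric.ball ((ζ, 0) : X × V) (min (r / 2) 1), ∀ t ∈ latticeCell Λ,
      e + (0, t) ∈ C := by
    intro e h t ht
    rw [Metric.mem_ball, Prod.dist_eq, max_lt_iff, lt_min_iff, lt_min_iff] at h
    refine ⟨?_, ?_⟩
    · simpa using h.1.1.le
    · refine Metric.mem_cthickening_of_dist_le _ t _ _ (subset_closure ht) ?_
      have := h.2.2.le
      simpa [dist_eq_norm] using this
  have hslice : ∀ e : X × V, e.1 ∈ U → ∀ {Z : Type} [NormedAddCommGroup Z] [NormedSpace ℝ Z]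
      (g : X × V → Z), ContinuousOn g (U ×ˢ Set.univ) → Continuous fun t => g (e + (0, t)) := by
    intro e h Z _ _ g hg
    refine hg.comp_continuous (by fun_prop) fun t => ⟨?_, trivial⟩
    simpa using h
  have hI : HasFDerivAt (fun e : X × V => ∫ t in latticeCell Λ, G (e + (0, t)))
      (∫ t in latticeCell Λ, fderiv ℝ G ((ζ, 0) + (0, t))) (ζ, 0) := by
    refine hasFDerivAt_integral_of_dominated_of_fderiv_le
      (F' := fun e t => fderiv ℝ G (e + (0, t))) (bound := fun _ => B)
      (Metric.ball_mem_nhds _ (show 0 < min (r / 2) 1 by positivity)) ?_ ?_ ?_ ?_ ?_ ?_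
    · filter_upwards [hUo.mem_nhds (show ((ζ, 0) : X × V) ∈ U ×ˢ Set.univ from ⟨he, trivial⟩)]
        with e h
      exact (hslice e h.1 G hG.continuousOn).aestronglyMeasurable
    · exact integrableOn_latticeCell Λ (hslice _ he G hG.continuousOn)
    · exact (hslice _ he _ hcont').aestronglyMeasurable
    · filter_upwards [ae_restrict_mem (measurableSet_latticeCell Λ)] with t ht e h
      exact hB _ (hmem e h t ht)
    · exact integrable_const B
    · filter_upwards [ae_restrict_mem (measurableSet_latticeCell Λ)] with t ht e h
      have := hdiff _ (hCU (hmem e h t ht))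
      exact (hasFDerivAt_comp_add_right (0, t)).2 this
  have heq : (fun e : X × V => torusAverage Λ G e.1) =ᶠ[𝓝 (ζ, 0)]
      fun e : X × V => ∫ t in latticeCell Λ, G (e + (0, t)) := by
    filter_upwards [hUo.mem_nhds (show ((ζ, 0) : X × V) ∈ U ×ˢ Set.univ from ⟨he, trivial⟩)]
      with e h
    have := setIntegral_latticeCell_add Λ (fun t => G (e.1, t)) (hper e.1 h.1) e.2
    rw [torusAverage, ← this]
    congr 1
    ext t
    congr 1
    ext <;> simp [add_comm]
  have h0 := hI.congr_of_eventuallyEq heq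
  have hsum : ∀ t : V, ((ζ, 0) : X × V) + (0, t) = (ζ, t) := fun t => by simp
  simp only [hsum] at h0
  have h1 := (hasFDerivAt_comp_add_right (𝕜 := ℝ) (f := fun e : X × V => torusAverage Λ G e.1)
    (f' := torusAverage Λ (fderiv ℝ G) ζ) (x := (ζ, t₀)) ((0, -t₀) : X × V)).2
    (by simpa [torusAverage] using h0)
  simpa using h1

theorem fderiv_torusAverage (hU : IsOpen U) (hG : ContDiffOn ℝ 1 G (U ×ˢ Set.univ))
    (hper : IsPeriodicOn Λ U G) {e : X × V} (he : e.1 ∈ U) :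
    fderiv ℝ (fun e : X × V => torusAverage Λ G e.1) e = torusAverage Λ (fderiv ℝ G) e.1 :=
  (hasFDerivAt_torusAverage hU hG hper he).fderiv

theorem contDiffOn_torusAverage_fst (hU : IsOpen U) (n : ℕ) :
    ∀ {W : Type} [NormedAddCommGroup W] [NormedSpace ℝ W] {G : X × V → W},
      ContDiffOn ℝ (n + 1 : ℕ) G (U ×ˢ Set.univ) → IsPeriodicOn Λ U G →
      ContDiffOn ℝ (n : ℕ) (fun e : X × V => torusAverage Λ G e.1) (U ×ˢ Set.univ) := by
  induction n with
  | zero =>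
    intro W _ _ G hG hper
    rw [Nat.cast_zero, contDiffOn_zero]
    exact fun e he => (hasFDerivAt_torusAverage hU (by simpa using hG) hper
      he.1).continuousAt.continuousWithinAt
  | succ n ih =>
    intro W _ _ G hG hper
    have hUo : IsOpen (U ×ˢ (Set.univ : Set V)) := hU.prod isOpen_univ
    have hG1 : ContDiffOn ℝ 1 G (U ×ˢ Set.univ) := hG.of_le (by norm_cast; omega)
    rw [show ((n + 1 : ℕ) : WithTop ℕ∞) = (n : WithTop ℕ∞) + 1 by push_cast; rfl,
      contDiffOn_succ_iff_fderiv_of_isOpen hUo]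
    refine ⟨fun e he => (hasFDerivAt_torusAverage hU hG1 hper
      he.1).differentiableAt.differentiableWithinAt, by simp, ?_⟩
    have h1 := ih (hG.fderiv_of_isOpen (m := (n + 1 : ℕ)) hUo (by norm_cast)) (hper.fderiv hU)
    exact h1.congr fun e he => fderiv_torusAverage hU hG1 hper he.1

theorem contDiffOn_torusAverage (hU : IsOpen U) (hG : ContDiffOn ℝ ∞ G (U ×ˢ Set.univ))
    (hper : IsPeriodicOn Λ U G) : ContDiffOn ℝ ∞ (torusAverage Λ G) U := by
  rw [contDiffOn_infty]
  intro n
  have h1 := contDiffOn_torusAverage_fst hU n (hG.of_le (by exact_mod_cast le_top)) hper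
  have h2 : ContDiffOn ℝ n (fun ζ : X => ((ζ, 0) : X × V)) U := by fun_prop
  exact h1.comp h2 fun ζ hζ => ⟨hζ, trivial⟩

end TorusAverage

/-! ### Type components of alternating forms -/

section TypePart

variable {V : Type*} [AddCommGroup V] [Module ℝ V] [TopologicalSpace V]
  {V' : Type*} [AddCommGroup V'] [Module ℝ V'] [TopologicalSpace V']

theorem typePart_apply {k : ℕ} (j : V →L[ℝ] V) (p q : ℕ) (α : V [⋀^Fin k]→L[ℝ] ℂ) (v : Fin k → V) :
    typePart j p q α v = ∑ S : Finset (Fin k) with S.card = p ∧ Sᶜ.card = q, ∑ T : Finset (Fin k),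
      ((1 / 2 : ℂ) ^ k * ∏ i ∈ T, if i ∈ S then -Complex.I else Complex.I) *
        α (fun i => if i ∈ T then j (v i) else v i) := by
  have h : ∀ T : Finset (Fin k), (fun i => (if i ∈ T then j else ContinuousLinearMap.id ℝ V) (v i))
      = fun i => if i ∈ T then j (v i) else v i := by
    intro T; ext i; split_ifs <;> rfl
  simp only [← h]
  simp [typePart]

theorem typePart_zero {k : ℕ} (j : V →L[ℝ] V) (p q : ℕ) :
    typePart j p q (0 : V [⋀^Fin k]→L[ℝ] ℂ) = 0 := by
  ext v
  simp [typePart_apply]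

theorem typePart_compContinuousLinearMap {k : ℕ} {j : V →L[ℝ] V} {j' : V' →L[ℝ] V'}
    {L : V' →L[ℝ] V} (hL : ∀ v, L (j' v) = j (L v)) (p q : ℕ) (α : V [⋀^Fin k]→L[ℝ] ℂ) :
    (typePart j p q α).compContinuousLinearMap L =
      typePart j' p q (α.compContinuousLinearMap L) := by
  ext v
  simp only [typePart_apply, ContinuousAlternatingMap.compContinuousLinearMap_apply]
  refine Finset.sum_congr rfl fun S _ => Finset.sum_congr rfl fun T _ => ?_
  congr 2
  ext i
  simp only [Function.comp]
  split_ifs <;> simp [hL]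

theorem typePart_one_two_apply (j : V →L[ℝ] V) (α : V [⋀^Fin 3]→L[ℝ] ℂ) (a b c : V) :
    typePart j 1 2 α ![a, b, c] = (1 / 8 : ℂ) * (3 * α ![a, b, c] +
      Complex.I * (α ![j a, b, c] + α ![a, j b, c] + α ![a, b, j c]) +
      (α ![j a, j b, c] + α ![j a, b, j c] + α ![a, j b, j c]) +
      3 * Complex.I * α ![j a, j b, j c]) := by
  have hS : (Finset.univ.filter fun S : Finset (Fin 3) => S.card = 1 ∧ Sᶜ.card = 2) =
      {{0}, {1}, {2}} := by decide
  have hT : (Finset.univ : Finset (Finset (Fin 3))) =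
      ({0, 1, 2} : Finset (Fin 3)).powerset := by decide
  have hv : ∀ T : Finset (Fin 3), (fun i => if i ∈ T then j (![a, b, c] i) else ![a, b, c] i) =
      ![if 0 ∈ T then j a else a, if 1 ∈ T then j b else b, if 2 ∈ T then j c else c] := by
    intro T
    ext i
    fin_cases i <;> simp
  rw [typePart_apply, hS]
  simp only [hv, hT]
  rw [Finset.sum_insert (by decide), Finset.sum_insert (by decide), Finset.sum_singleton]
  have hp : ({2} : Finset (Fin 3)).powerset = {∅, {2}} := by decide
  simp [Finset.sum_powerset_insert, hp]
  ring_nf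

/-- The `(2, 2)`-part of a form agrees with the form on a quadruple `(a, ja, b, jb)`, as this
quadruple represents a `4`-vector of type `(2, 2)`. -/
theorem typePart_two_two_apply {j : V →L[ℝ] V} (hj : ∀ v, j (j v) = -v)
    (α : V [⋀^Fin 4]→L[ℝ] ℂ) (a b : V) :
    typePart j 2 2 α ![a, j a, b, j b] = α ![a, j a, b, j b] := by
  have hS : (Finset.univ.filter fun S : Finset (Fin 4) => S.card = 2 ∧ Sᶜ.card = 2) =
      {{0, 1}, {0, 2}, {0, 3}, {1, 2}, {1, 3}, {2, 3}} := by decide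
  have hT : (Finset.univ : Finset (Finset (Fin 4))) =
      ({0, 1, 2, 3} : Finset (Fin 4)).powerset := by decide
  have hv : ∀ T : Finset (Fin 4), (fun i => if i ∈ T then j (![a, j a, b, j b] i)
      else ![a, j a, b, j b] i) =
      ![if 0 ∈ T then j a else a, if 1 ∈ T then -a else j a, if 2 ∈ T then j b else b,
        if 3 ∈ T then -b else j b] := by
    intro T
    ext i
    fin_cases i <;> simp [hj]
  have h01 : ∀ x y z : V, α ![x, x, y, z] = 0 := fun x y z =>
    α.map_eq_zero_of_eq _ (i := 0) (j := 1) (by simp) (by decide)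
  have h23 : ∀ x y z : V, α ![x, y, z, z] = 0 := fun x y z =>
    α.map_eq_zero_of_eq _ (i := 2) (j := 3) (by simp) (by decide)
  have n1 : ∀ x y z w : V, α ![x, -y, z, w] = -α ![x, y, z, w] := fun x y z w => by
    have h := α.map_update_neg ![x, y, z, w] 1 y
    have e1 : Function.update ![x, y, z, w] 1 (-y) = ![x, -y, z, w] := by ext i; fin_cases i <;> rfl
    have e2 : Function.update ![x, y, z, w] 1 y = ![x, y, z, w] := by ext i; fin_cases i <;> rfl
    rw [e1, e2] at h
    exact h
  have n3 : ∀ x y z w : V, α ![x, y, z, -w] = -α ![x, y, z, w] := fun x y z w => by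
    have h := α.map_update_neg ![x, y, z, w] 3 w
    have e1 : Function.update ![x, y, z, w] 3 (-w) = ![x, y, z, -w] := by ext i; fin_cases i <;> rfl
    have e2 : Function.update ![x, y, z, w] 3 w = ![x, y, z, w] := by ext i; fin_cases i <;> rfl
    rw [e1, e2] at h
    exact h
  have s01 : ∀ x y z w : V, α ![x, y, z, w] = -α ![y, x, z, w] := fun x y z w => by
    refine Eq.trans ?_ (α.toAlternatingMap.map_swap ![y, x, z, w] (i := 0) (j := 1) (by decide))
    refine congrArg α ?_
    ext i; fin_cases i <;> rfl
  have s23 : ∀ x y z w : V, α ![x, y, z, w] = -α ![x, y, w, z] := fun x y z w => by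
    refine Eq.trans ?_ (α.toAlternatingMap.map_swap ![x, y, w, z] (i := 2) (j := 3) (by decide))
    refine congrArg α ?_
    ext i; fin_cases i <;> rfl
  have e01 : ∀ z w : V, α ![j a, a, z, w] = -α ![a, j a, z, w] := fun z w => s01 _ _ _ _
  have e23 : ∀ x y : V, α ![x, y, j b, b] = -α ![x, y, b, j b] := fun x y => s23 _ _ _ _
  rw [typePart_apply, hS]
  simp only [hv, hT]
  rw [Finset.sum_insert (by decide), Finset.sum_insert (by decide), Finset.sum_insert (by decide),
    Finset.sum_insert (by decide), Finset.sum_insert (by decide), Finset.sum_singleton]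
  have hp : ({3} : Finset (Fin 4)).powerset = {∅, {3}} := by decide
  simp [Finset.sum_powerset_insert, hp, h01, h23, n1, n3,
    e01, e23]
  ring

end TypePart

/-! ### Smoothness of fields of alternating forms -/

section Smoothness

variable {E X : Type*} [NormedAddCommGroup E] [NormedSpace ℝ E]
  [NormedAddCommGroup X] [NormedSpace ℝ X] {k : ℕ} {s : Set X} {n : WithTop ℕ∞}

/-- On a finite-dimensional space an alternating form is a linear function of its values on
tuples of basis vectors; so a field of forms is smooth as soon as its values are. -/
theorem contDiffOn_alternating_of_apply [FiniteDimensional ℝ E] {α : X → E [⋀^Fin k]→L[ℝ] ℂ}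
    (h : ∀ v, ContDiffOn ℝ n (fun x => α x v) s) : ContDiffOn ℝ n α s := by
  let b := Module.finBasis ℝ E
  let Φ : (E [⋀^Fin k]→L[ℝ] ℂ) →ₗ[ℝ] ((Fin k → Fin (Module.finrank ℝ E)) → ℂ) :=
    { toFun := fun α i => α fun l => b (i l)
      map_add' := fun _ _ => rfl
      map_smul' := fun _ _ => rfl }
  have hΦ : LinearMap.ker Φ = ⊥ := by
    rw [LinearMap.ker_eq_bot]
    intro α β hαβ
    refine ContinuousAlternatingMap.toAlternatingMap_injective ?_
    exact b.ext_alternating fun i _ => congrFun hαβ i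
  obtain ⟨g, hg⟩ := Φ.exists_leftInverse_of_injective hΦ
  have h1 : α = fun x => g.toContinuousLinearMap fun i => α x fun l => b (i l) := by
    ext1 x
    exact (LinearMap.congr_fun hg (α x)).symm
  rw [h1]
  exact g.toContinuousLinearMap.contDiff.comp_contDiffOn (contDiffOn_pi.2 fun i => h _)

theorem ContDiffOn.alternating_apply {α : X → E [⋀^Fin k]→L[ℝ] ℂ} {w : X → Fin k → E}
    (hα : ContDiffOn ℝ n α s) (hw : ContDiffOn ℝ n w s) :
    ContDiffOn ℝ n (fun x => α x (w x)) s := by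
  have h1 : ContDiff ℝ n fun p : (E [×k]→L[ℝ] ℂ) × (Fin k → E) => p.1 p.2 :=
    ((ContinuousLinearMap.id ℝ (E [×k]→L[ℝ] ℂ)).analyticOnNhd_uncurry_of_multilinear
      (s := Set.univ)).contDiff
  exact h1.comp_contDiffOn
    (((ContinuousAlternatingMap.toContinuousMultilinearMapCLM ℝ).contDiff.comp_contDiffOn hα).prodMk
      hw)

theorem ContDiffOn.typePart [FiniteDimensional ℝ E] {α : X → E [⋀^Fin k]→L[ℝ] ℂ} {J : X → E →L[ℝ] E}
    (hα : ContDiffOn ℝ n α s) (hJ : ContDiffOn ℝ n J s) (p q : ℕ) :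
    ContDiffOn ℝ n (fun x => typePart (J x) p q (α x)) s := by
  refine contDiffOn_alternating_of_apply fun v => ?_
  simp only [typePart_apply]
  refine ContDiffOn.sum fun S _ => ContDiffOn.sum fun T _ => contDiffOn_const.mul ?_
  refine hα.alternating_apply (contDiffOn_pi.2 fun i => ?_)
  split_ifs
  · exact hJ.clm_apply contDiffOn_const
  · exact contDiffOn_const

theorem ContDiffOn.extDeriv {α : E → E [⋀^Fin k]→L[ℝ] ℂ} {s : Set E} (hs : IsOpen s)
    (hα : ContDiffOn ℝ ∞ α s) : ContDiffOn ℝ ∞ (extDeriv α) s :=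
  (ContinuousAlternatingMap.alternatizeUncurryFinCLM ℝ E ℂ).contDiff.comp_contDiffOn
    (hα.fderiv_of_isOpen hs (by simp))

end Smoothness

/-! ### The parametrizations `ℂ × ℝ⁴ → M₁ × ℝ⁴ / Λ` -/

section Parametrization

variable {M₁ : Type*} [TopologicalSpace M₁] [ChartedSpace ℂ M₁]
  (Λ : Submodule ℤ (EuclideanSpace ℝ (Fin 4))) [DiscreteTopology Λ]

/-- The product of the inverse of the preferred chart of `M₁` around `y` with the projection
`ℝ⁴ → ℝ⁴ / Λ`.  It is a local parametrization of `M₁ × ℝ⁴ / Λ` on `paramDomain y`. -/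
def paramMap (y : M₁) (e : ℂ × EuclideanSpace ℝ (Fin 4)) : M₁ × FlatTorus Λ :=
  ((chartAt ℂ y).symm e.1, (e.2 : FlatTorus Λ))

/-- The open set `φ(U) × ℝ⁴`, where `φ : U → ℂ` is the preferred chart of `M₁` around `y`. -/
def paramDomain (y : M₁) : Set (ℂ × EuclideanSpace ℝ (Fin 4)) := (chartAt ℂ y).target ×ˢ Set.univ

theorem isOpen_paramDomain (y : M₁) : IsOpen (paramDomain y) :=
  (chartAt ℂ y).open_target.prod isOpen_univ

theorem extChartAt_symm_eq_paramMap (x : M₁ × FlatTorus Λ) :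
    ⇑(extChartAt warpedModel x).symm = paramMap Λ x.1 := by
  ext1 e
  refine Prod.ext ?_ ?_
  · rfl
  · exact FlatTorus.chart_symm Λ (chart_mem_atlas _ _) _

theorem paramMap_add (y : M₁) (e : ℂ × EuclideanSpace ℝ (Fin 4)) {l : EuclideanSpace ℝ (Fin 4)}
    (hl : l ∈ Λ) : paramMap Λ y (e + (0, l)) = paramMap Λ y e := by
  refine Prod.ext ?_ ?_
  · simp [paramMap]
  · simp only [paramMap, Prod.snd_add]
    refine (QuotientAddGroup.eq.2 ?_).symm
    simpa using hl

/-- Near `t`, the projection `ℝ⁴ → ℝ⁴ / Λ` is a translation in the preferred chart. -/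
theorem FlatTorus.exists_chartAt_mk_eventuallyEq (t : EuclideanSpace ℝ (Fin 4)) :
    ∃ b, ((t + b ∈ (chartAt (EuclideanSpace ℝ (Fin 4)) (t : FlatTorus Λ)).target) ∧
      (∀ s : EuclideanSpace ℝ (Fin 4), (s : FlatTorus Λ) =
        (chartAt (EuclideanSpace ℝ (Fin 4)) (t : FlatTorus Λ)).symm (s + b)) ∧
      (fun s : EuclideanSpace ℝ (Fin 4) =>
      chartAt (EuclideanSpace ℝ (Fin 4)) (t : FlatTorus Λ) (s : FlatTorus Λ)) =ᶠ[𝓝 t]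
      fun s => s + b) := by
  set c := chartAt (EuclideanSpace ℝ (Fin 4)) (t : FlatTorus Λ) with hc
  have hsymm : ∀ s, c.symm s = (s : FlatTorus Λ) :=
    FlatTorus.chart_symm Λ (chart_mem_atlas _ _)
  have h1 : ((c (t : FlatTorus Λ) : EuclideanSpace ℝ (Fin 4)) : FlatTorus Λ) = t := by
    rw [← hsymm]
    exact c.left_inv (mem_chart_source _ _)
  have hb : c (t : FlatTorus Λ) - t ∈ Λ := by
    have := QuotientAddGroup.eq.1 h1.symm
    rwa [Submodule.mem_toAddSubgroup, neg_add_eq_sub] at this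
  have hmk : ∀ s : EuclideanSpace ℝ (Fin 4), (s : FlatTorus Λ) =
      c.symm (s + (c (t : FlatTorus Λ) - t)) := by
    intro s
    rw [hsymm]
    refine QuotientAddGroup.eq.2 ?_
    simpa using hb
  have ht : t + (c (t : FlatTorus Λ) - t) ∈ c.target := by
    rw [add_sub_cancel]
    exact c.map_source (mem_chart_source _ _)
  refine ⟨c (t : FlatTorus Λ) - t, ht, hmk, ?_⟩
  have hcont : ContinuousAt (fun s => s + (c (t : FlatTorus Λ) - t)) t := by fun_prop
  filter_upwards [hcont (c.open_target.mem_nhds ht)] with s hs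
  rw [hmk s]
  exact c.right_inv hs

theorem FlatTorus.contMDiff_mk :
    ContMDiff 𝓘(ℝ, EuclideanSpace ℝ (Fin 4)) 𝓘(ℝ, EuclideanSpace ℝ (Fin 4)) ∞
      (fun t : EuclideanSpace ℝ (Fin 4) => (t : FlatTorus Λ)) := by
  intro t
  obtain ⟨b, hb, hmk, -⟩ := FlatTorus.exists_chartAt_mk_eventuallyEq Λ t
  have h1 := (contMDiffOn_chart_symm (I := 𝓘(ℝ, EuclideanSpace ℝ (Fin 4))) (n := ∞)
    (x := (t : FlatTorus Λ))).contMDiffAt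
    ((chartAt (EuclideanSpace ℝ (Fin 4)) (t : FlatTorus Λ)).open_target.mem_nhds hb)
  have h2 : ContMDiffAt 𝓘(ℝ, EuclideanSpace ℝ (Fin 4)) 𝓘(ℝ, EuclideanSpace ℝ (Fin 4)) ∞
      (fun s : EuclideanSpace ℝ (Fin 4) => s + b) t := by
    have : ContDiffAt ℝ ∞ (fun s : EuclideanSpace ℝ (Fin 4) => s + b) t := by fun_prop
    exact this.contMDiffAt
  have h3 := ContMDiffAt.comp (x := t) (f := fun s : EuclideanSpace ℝ (Fin 4) => s + b) h1 h2
  refine h3.congr_of_eventuallyEq (Filter.Eventually.of_forall fun s => ?_)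
  exact hmk s

variable [IsManifold 𝓘(ℂ) ω M₁]

theorem contMDiffOn_paramMap (y : M₁) :
    ContMDiffOn 𝓘(ℝ, ℂ × EuclideanSpace ℝ (Fin 4)) warpedModel ∞ (paramMap Λ y)
      (paramDomain y) := by
  have h1 : ContMDiffOn 𝓘(ℝ, ℂ) 𝓘(ℝ, ℂ) ∞ (chartAt ℂ y).symm (chartAt ℂ y).target :=
    (contMDiffOn_chart_symm (I := 𝓘(ℝ, ℂ)) (n := ∞) (x := y))
  have h2 : ContMDiffOn 𝓘(ℝ, ℂ × EuclideanSpace ℝ (Fin 4)) 𝓘(ℝ, ℂ) ∞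
      (Prod.fst : ℂ × EuclideanSpace ℝ (Fin 4) → ℂ) (paramDomain y) :=
    contDiff_fst.contMDiff.contMDiffOn
  have h3 : ContMDiff 𝓘(ℝ, ℂ × EuclideanSpace ℝ (Fin 4)) 𝓘(ℝ, EuclideanSpace ℝ (Fin 4)) ∞
      (Prod.snd : ℂ × EuclideanSpace ℝ (Fin 4) → EuclideanSpace ℝ (Fin 4)) :=
    contDiff_snd.contMDiff
  exact (h1.comp h2 fun e he => he.1).prodMk ((FlatTorus.contMDiff_mk Λ).comp h3).contMDiffOn

/-- The differential of `paramMap y`, as an endomorphism of `ℂ × ℝ⁴`. -/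
def paramDeriv (y : M₁) (e : ℂ × EuclideanSpace ℝ (Fin 4)) :
    ℂ × EuclideanSpace ℝ (Fin 4) →L[ℝ] ℂ × EuclideanSpace ℝ (Fin 4) :=
  mfderiv 𝓘(ℝ, ℂ × EuclideanSpace ℝ (Fin 4)) warpedModel (paramMap Λ y) e

variable {Λ}

theorem contMDiffAt_paramMap {y : M₁} {e : ℂ × EuclideanSpace ℝ (Fin 4)} (he : e ∈ paramDomain y) :
    ContMDiffAt 𝓘(ℝ, ℂ × EuclideanSpace ℝ (Fin 4)) warpedModel ∞ (paramMap Λ y) e :=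
  (contMDiffOn_paramMap Λ y).contMDiffAt ((isOpen_paramDomain y).mem_nhds he)

theorem mdifferentiableAt_paramMap {y : M₁} {e : ℂ × EuclideanSpace ℝ (Fin 4)}
    (he : e ∈ paramDomain y) :
    MDifferentiableAt 𝓘(ℝ, ℂ × EuclideanSpace ℝ (Fin 4)) warpedModel (paramMap Λ y) e :=
  (contMDiffAt_paramMap he).mdifferentiableAt (by simp)

theorem paramDeriv_add {y : M₁} {e : ℂ × EuclideanSpace ℝ (Fin 4)} (he : e ∈ paramDomain y)
    {l : EuclideanSpace ℝ (Fin 4)} (hl : l ∈ Λ) :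
    paramDeriv Λ y (e + (0, l)) = paramDeriv Λ y e := by
  have h1 : e + (0, l) ∈ paramDomain y := ⟨by simpa using he.1, trivial⟩
  have h2 : HasMFDerivAt 𝓘(ℝ, ℂ × EuclideanSpace ℝ (Fin 4)) 𝓘(ℝ, ℂ × EuclideanSpace ℝ (Fin 4))
      (fun e : ℂ × EuclideanSpace ℝ (Fin 4) => e + (0, l)) e
      (ContinuousLinearMap.id ℝ (ℂ × EuclideanSpace ℝ (Fin 4))) :=
    ((hasFDerivAt_id e).add_const ((0, l) : ℂ × EuclideanSpace ℝ (Fin 4))).hasMFDerivAt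
  have h3 := HasMFDerivAt.comp (x := e) (mdifferentiableAt_paramMap (Λ := Λ) h1).hasMFDerivAt h2
  have h4 : paramMap Λ y ∘ (fun e : ℂ × EuclideanSpace ℝ (Fin 4) => e + (0, l)) = paramMap Λ y :=
    funext fun e => paramMap_add Λ y e hl
  rw [h4] at h3
  exact h3.mfderiv.symm

/-- The parametrization `paramMap y` in the preferred chart around the image of `e`. -/
theorem exists_hasFDerivAt_extChartAt_paramMap {y : M₁} {e : ℂ × EuclideanSpace ℝ (Fin 4)}
    (he : e ∈ paramDomain y) :
    ∃ D : ℂ →L[ℂ] ℂ, HasFDerivAt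
      (fun e' => extChartAt warpedModel (paramMap Λ y e) (paramMap Λ y e'))
      (ContinuousLinearMap.prodMap (D.restrictScalars ℝ)
        (ContinuousLinearMap.id ℝ (EuclideanSpace ℝ (Fin 4)))) e := by
  set y' := (chartAt ℂ y).symm e.1 with hy'
  have hy1 : y' ∈ (chartAt ℂ y).source := (chartAt ℂ y).map_target he.1
  have h1 := hasFDerivWithinAt_tangentCoordChange (I := 𝓘(ℂ)) (x := y) (y := y') (z := y')
    ⟨by simpa using hy1, by simp⟩
  rw [ModelWithCorners.range_eq_univ, hasFDerivWithinAt_univ] at h1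
  have h2 : HasFDerivAt (𝕜 := ℂ) (fun ζ => chartAt ℂ y' ((chartAt ℂ y).symm ζ))
      (tangentCoordChange 𝓘(ℂ) y y' y') e.1 := by
    have h3 : extChartAt 𝓘(ℂ) y y' = e.1 := by
      simpa [mfld_simps] using (chartAt ℂ y).right_inv he.1
    rw [h3] at h1
    simpa [mfld_simps, Function.comp_def] using h1
  obtain ⟨b, -, -, hb⟩ := FlatTorus.exists_chartAt_mk_eventuallyEq Λ e.2
  have h4 : HasFDerivAt (fun s : EuclideanSpace ℝ (Fin 4) =>
      chartAt (EuclideanSpace ℝ (Fin 4)) (e.2 : FlatTorus Λ) (s : FlatTorus Λ))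
      (ContinuousLinearMap.id ℝ (EuclideanSpace ℝ (Fin 4))) e.2 :=
    ((hasFDerivAt_id _).add_const b).congr_of_eventuallyEq hb
  refine ⟨tangentCoordChange 𝓘(ℂ) y y' y', ?_⟩
  exact HasFDerivAt.prodMap (p := e) (h2.restrictScalars ℝ) h4

theorem paramDeriv_eq_fderiv {y : M₁} {e : ℂ × EuclideanSpace ℝ (Fin 4)}
    (he : e ∈ paramDomain y) :
    paramDeriv Λ y e =
    fderiv ℝ (fun e' => extChartAt warpedModel (paramMap Λ y e) (paramMap Λ y e')) e := by
  have h1 := HasMFDerivAt.comp (x := e) (I'' := 𝓘(ℝ, ℂ × EuclideanSpace ℝ (Fin 4)))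
    (mdifferentiableAt_extChartAt (I := warpedModel)
      (mem_chart_source _ (paramMap Λ y e))).hasMFDerivAt
    (mdifferentiableAt_paramMap (Λ := Λ) he).hasMFDerivAt
  have h2 := mfderiv_eq_fderiv.symm.trans h1.mfderiv
  rw [mfderiv_extChartAt_self] at h2
  exact h2.symm

/-- The differential of a parametrization is complex linear in the direction of `M₁` and the
identity in the direction of the torus. -/
theorem exists_paramDeriv_eq {y : M₁} {e : ℂ × EuclideanSpace ℝ (Fin 4)}
    (he : e ∈ paramDomain y) :
    ∃ D : ℂ →L[ℂ] ℂ, paramDeriv Λ y e =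
    ContinuousLinearMap.prodMap (D.restrictScalars ℝ)
        (ContinuousLinearMap.id ℝ (EuclideanSpace ℝ (Fin 4))) := by
  obtain ⟨D, hD⟩ := exists_hasFDerivAt_extChartAt_paramMap (Λ := Λ) he
  exact ⟨D, (paramDeriv_eq_fderiv he).trans hD.fderiv⟩

theorem paramDeriv_vertical {y : M₁} {e : ℂ × EuclideanSpace ℝ (Fin 4)}
    (he : e ∈ paramDomain y) (u : EuclideanSpace ℝ (Fin 4)) :
    paramDeriv Λ y e (0, u) = (0, u) := by
  obtain ⟨D, hD⟩ := exists_paramDeriv_eq (Λ := Λ) he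
  rw [hD]
  simp

theorem paramDeriv_modelJ {y : M₁} {e : ℂ × EuclideanSpace ℝ (Fin 4)}
    (he : e ∈ paramDomain y) (p : OnePoint ℂ) (v : ℂ × EuclideanSpace ℝ (Fin 4)) :
    paramDeriv Λ y e (modelJ p v) =
    modelJ p (paramDeriv Λ y e v) := by
  obtain ⟨D, hD⟩ := exists_paramDeriv_eq (Λ := Λ) he
  rw [hD]
  refine Prod.ext ?_ ?_
  · have h := D.map_smul Complex.I v.1
    simpa [modelJ] using h
  · simp [modelJ]

end Parametrization

/-! ### Differential forms in the parametrizations -/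

section FormPull

variable {M₁ : Type*} [TopologicalSpace M₁] [ChartedSpace ℂ M₁] [IsManifold 𝓘(ℂ) ω M₁]
  {Λ : Submodule ℤ (EuclideanSpace ℝ (Fin 4))} [DiscreteTopology Λ] {k : ℕ}

/-- The pullback of a differential form under the parametrization `paramMap y`. -/
def formPull (α : DiffForm warpedModel (M₁ × FlatTorus Λ) k) (y : M₁)
    (e : ℂ × EuclideanSpace ℝ (Fin 4)) : (ℂ × EuclideanSpace ℝ (Fin 4)) [⋀^Fin k]→L[ℝ] ℂ :=
  ContinuousAlternatingMap.compContinuousLinearMap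
    (α (paramMap Λ y e) : (ℂ × EuclideanSpace ℝ (Fin 4)) [⋀^Fin k]→L[ℝ] ℂ) (paramDeriv Λ y e)

/-- A differential form is smooth if its pullbacks under the parametrizations are. -/
def DiffForm.IsSmooth (α : DiffForm warpedModel (M₁ × FlatTorus Λ) k) : Prop :=
  ∀ y, ContDiffOn ℝ ∞ (formPull α y) (paramDomain y)

theorem inChart_eq_formPull (α : DiffForm warpedModel (M₁ × FlatTorus Λ) k)
    (x : M₁ × FlatTorus Λ) : α.inChart x = formPull α x.1 := by
  have h : ∀ g : ℂ × EuclideanSpace ℝ (Fin 4) → M₁ × FlatTorus Λ, g = paramMap Λ x.1 →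
      (fun e => ContinuousAlternatingMap.compContinuousLinearMap (α (g e))
        (mfderivWithin 𝓘(ℝ, ℂ × EuclideanSpace ℝ (Fin 4)) warpedModel g
          (Set.range warpedModel) e)) = formPull α x.1 := by
    rintro g rfl
    rw [ModelWithCorners.range_eq_univ]
    simp only [mfderivWithin_univ]
    rfl
  exact h _ (extChartAt_symm_eq_paramMap Λ x)

theorem d_eq_extDeriv_formPull (α : DiffForm warpedModel (M₁ × FlatTorus Λ) k)
    (x : M₁ × FlatTorus Λ) :
    α.d x = extDeriv (formPull α x.1) (extChartAt warpedModel x x) := by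
  unfold DiffForm.d
  rw [ModelWithCorners.range_eq_univ, extDerivWithin_univ, inChart_eq_formPull,
    mfderiv_extChartAt_self]
  rfl

theorem extChartAt_mem_paramDomain (x : M₁ × FlatTorus Λ) :
    extChartAt warpedModel x x ∈ paramDomain x.1 :=
  ⟨mem_chart_target ℂ x.1, trivial⟩

/-- The exterior derivative, defined at each point through the preferred chart there, is computed in
every parametrization, by the naturality of `extDeriv` under the change of coordinates. -/
theorem formPull_d {α : DiffForm warpedModel (M₁ × FlatTorus Λ) k} (hα : α.IsSmooth) {y : M₁}
    {e : ℂ × EuclideanSpace ℝ (Fin 4)} (he : e ∈ paramDomain y) :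
    formPull α.d y e = extDeriv (formPull α y) e := by
  set x := paramMap Λ y e with hx
  set τ : ℂ × EuclideanSpace ℝ (Fin 4) → ℂ × EuclideanSpace ℝ (Fin 4) :=
    fun e' => extChartAt warpedModel x (paramMap Λ y e') with hτ
  have hτ1 : ContDiffAt ℝ ∞ τ e :=
    ((contMDiffAt_extChartAt (I := warpedModel) (x := x) (n := ∞)).comp (x := e)
      (contMDiffAt_paramMap he)).contDiffAt
  have hdom : ∀ᶠ e' in 𝓝 e, e' ∈ paramDomain y := (isOpen_paramDomain y).mem_nhds he
  have hsrc : ∀ᶠ e' in 𝓝 e, paramMap Λ y e' ∈ (extChartAt warpedModel x).source :=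
    (contMDiffAt_paramMap he).continuousAt.preimage_mem_nhds (extChartAt_source_mem_nhds x)
  have hfac : ∀ᶠ e' in 𝓝 e, paramMap Λ x.1 (τ e') = paramMap Λ y e' := by
    filter_upwards [hsrc] with e' h
    rw [← extChartAt_symm_eq_paramMap]
    exact (extChartAt warpedModel x).left_inv h
  have hτdom : ∀ᶠ e' in 𝓝 e, τ e' ∈ paramDomain x.1 :=
    hτ1.continuousAt.preimage_mem_nhds
      ((isOpen_paramDomain x.1).mem_nhds (extChartAt_mem_paramDomain x))
  have hderiv : ∀ᶠ e' in 𝓝 e, paramDeriv Λ y e' =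
      (paramDeriv Λ x.1 (τ e')).comp (fderiv ℝ τ e') := by
    filter_upwards [hfac.eventually_nhds, hτdom,
      (hτ1.of_le (m := 1) (by norm_cast)).eventually (by simp)] with e' h1 h2 h3
    have h4 := HasMFDerivAt.comp (x := e') (mdifferentiableAt_paramMap (Λ := Λ) h2).hasMFDerivAt
      (h3.differentiableAt (by simp)).hasFDerivAt.hasMFDerivAt
    exact (h4.congr_of_eventuallyEq (h1.mono fun _ h => h.symm)).mfderiv
  have hpull : formPull α y =ᶠ[𝓝 e]
      fun e' => (formPull α x.1 (τ e')).compContinuousLinearMap (fderiv ℝ τ e') := by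
    filter_upwards [hfac, hderiv] with e' h1 h2
    unfold formPull
    rw [h1, h2]
    rfl
  rw [hpull.extDeriv_eq, extDeriv_pullback (r := 2) _ (hτ1.of_le ENat.LEInfty.out) (by simp)]
  · unfold formPull
    rw [d_eq_extDeriv_formPull, paramDeriv_eq_fderiv he]
    rfl
  · exact ((hα x.1).differentiableOn (by simp)).differentiableAt
      ((isOpen_paramDomain x.1).mem_nhds (extChartAt_mem_paramDomain x))

theorem isPeriodicOn_formPull (α : DiffForm warpedModel (M₁ × FlatTorus Λ) k) (y : M₁) :
    IsPeriodicOn Λ (chartAt ℂ y).target (formPull α y) := by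
  intro ζ hζ t l hl
  have h1 : ((ζ, t + l) : ℂ × EuclideanSpace ℝ (Fin 4)) = (ζ, t) + (0, l) := by simp
  unfold formPull
  rw [h1, paramDeriv_add (e := (ζ, t)) ⟨hζ, trivial⟩ hl, paramMap_add Λ y (ζ, t) hl]

/-- The complex structure of `M_f` in the parametrization `paramMap y`; it is constant along the
torus, and so a function on the chart domain in `ℂ`. -/
def paramJ (f : M₁ → OnePoint ℂ) (y : M₁) (ζ : ℂ) :
    ℂ × EuclideanSpace ℝ (Fin 4) →L[ℝ] ℂ × EuclideanSpace ℝ (Fin 4) :=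
  modelJ (f ((chartAt ℂ y).symm ζ))

theorem contDiffOn_orthogonalJ {f : M₁ → OnePoint ℂ} (hf : IsHolomorphicToP1 f) (y : M₁) :
    ContDiffOn ℝ ∞ (fun ζ => orthogonalJ (f ((chartAt ℂ y).symm ζ))) (chartAt ℂ y).target := by
  have h1 : ContMDiff 𝓘(ℝ, ℂ) 𝓘(ℝ, EuclideanSpace ℝ (Fin 4) →L[ℝ] EuclideanSpace ℝ (Fin 4)) ∞
      (fun y => orthogonalJ (f y)) := contMDiffAt_orthogonalJ hf
  exact (h1.comp_contMDiffOn
    (contMDiffOn_chart_symm (I := 𝓘(ℝ, ℂ)) (n := ∞) (x := y))).contDiffOn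

theorem contDiffOn_paramJ {f : M₁ → OnePoint ℂ} (hf : IsHolomorphicToP1 f) (y : M₁) :
    ContDiffOn ℝ ∞ (paramJ f y) (chartAt ℂ y).target := by
  have h1 : ∀ ζ, paramJ f y ζ =
      ContinuousLinearMap.prodMapL ℝ ℂ ℂ (EuclideanSpace ℝ (Fin 4)) (EuclideanSpace ℝ (Fin 4))
        (Complex.I • ContinuousLinearMap.id ℝ ℂ, orthogonalJ (f ((chartAt ℂ y).symm ζ))) :=
    fun ζ => rfl
  rw [funext h1]
  exact (ContinuousLinearMap.contDiff _).comp_contDiffOn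
    (contDiffOn_const.prodMk (contDiffOn_orthogonalJ hf y))

theorem formPull_typePart (f : M₁ → OnePoint ℂ) (p q : ℕ)
    (α : DiffForm warpedModel (M₁ × FlatTorus Λ) k) {y : M₁} {e : ℂ × EuclideanSpace ℝ (Fin 4)}
    (he : e ∈ paramDomain y) :
    formPull (fun x => typePart (warpedJ Λ f x) p q (α x)) y e =
      typePart (paramJ f y e.1) p q (formPull α y e) :=
  typePart_compContinuousLinearMap (fun v => paramDeriv_modelJ he _ v) p q _

/-! ### The metric in the parametrizations -/

variable {f : M₁ → OnePoint ℂ} {hf : IsHolomorphicToP1 f}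

/-- The coefficients of a Hermitian metric in the parametrization `paramMap y`. -/
def metricPull (h : HermitianMetric (warpedComplexStructure Λ f hf)) (y : M₁)
    (e u v : ℂ × EuclideanSpace ℝ (Fin 4)) : ℝ :=
  h.inner (paramMap Λ y e) (paramDeriv Λ y e u) (paramDeriv Λ y e v)

theorem contMDiffAt_paramDeriv {y : M₁} {e : ℂ × EuclideanSpace ℝ (Fin 4)}
    (he : e ∈ paramDomain y) (u : ℂ × EuclideanSpace ℝ (Fin 4)) :
    ContMDiffAt 𝓘(ℝ, ℂ × EuclideanSpace ℝ (Fin 4)) warpedModel.tangent ∞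
      (fun e => (⟨paramMap Λ y e, paramDeriv Λ y e u⟩ :
        TangentBundle warpedModel (M₁ × FlatTorus Λ))) e := by
  have h1 : ContMDiffAt (𝓘(ℝ, ℂ × EuclideanSpace ℝ (Fin 4)))
      (𝓘(ℝ, ℂ × EuclideanSpace ℝ (Fin 4))).tangent ∞
      (fun e => (⟨e, u⟩ : TangentBundle 𝓘(ℝ, ℂ × EuclideanSpace ℝ (Fin 4))
        (ℂ × EuclideanSpace ℝ (Fin 4)))) e := by
    refine (Bundle.contMDiffAt_section e).2 ?_
    simp only [mfld_simps]
    exact contMDiffAt_const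
  have h2 : ContMDiffAt (𝓘(ℝ, ℂ × EuclideanSpace ℝ (Fin 4))).tangent warpedModel.tangent ∞
      (tangentMap 𝓘(ℝ, ℂ × EuclideanSpace ℝ (Fin 4)) warpedModel (paramMap Λ y))
      (⟨e, u⟩ : TangentBundle 𝓘(ℝ, ℂ × EuclideanSpace ℝ (Fin 4))
        (ℂ × EuclideanSpace ℝ (Fin 4))) := by
    have hopen := isOpen_paramDomain y
    have hnhds : Bundle.TotalSpace.proj ⁻¹' paramDomain y ∈ 𝓝
        (⟨e, u⟩ : TangentBundle 𝓘(ℝ, ℂ × EuclideanSpace ℝ (Fin 4))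
          (ℂ × EuclideanSpace ℝ (Fin 4))) :=
      (hopen.preimage (FiberBundle.continuous_proj _ _)).mem_nhds he
    have h3 := ((contMDiffOn_paramMap Λ y).contMDiffOn_tangentMapWithin (m := ∞) (by simp)
      hopen.uniqueMDiffOn).contMDiffAt hnhds
    refine h3.congr_of_eventuallyEq ?_
    filter_upwards [hnhds] with p hp
    exact (tangentMapWithin_eq_tangentMap (hopen.uniqueMDiffWithinAt hp)
      (mdifferentiableAt_paramMap hp)).symm
  exact h2.comp e h1

theorem contDiffOn_metricPull (h : HermitianMetric (warpedComplexStructure Λ f hf)) (y : M₁)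
    (u v : ℂ × EuclideanSpace ℝ (Fin 4)) :
    ContDiffOn ℝ ∞ (fun e => metricPull h y e u v) (paramDomain y) := by
  intro e he
  refine ContDiffAt.contDiffWithinAt ?_
  have h1 := h.contMDiff.contMDiffAt.comp e (contMDiffAt_paramMap (Λ := Λ) he)
  have h2 := ContMDiffAt.clm_bundle_apply₂ (F₁ := ℂ × EuclideanSpace ℝ (Fin 4))
    (F₂ := ℂ × EuclideanSpace ℝ (Fin 4)) (F₃ := ℝ) (E₃ := Bundle.Trivial (M₁ × FlatTorus Λ) ℝ)
    h1 (contMDiffAt_paramDeriv (Λ := Λ) he u)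
    (contMDiffAt_paramDeriv (Λ := Λ) he v)
  rw [← contMDiffWithinAt_univ, Bundle.contMDiffWithinAt_totalSpace] at h2
  exact (contMDiffWithinAt_univ.1 h2.2).contDiffAt

theorem formPull_fundamentalForm (h : HermitianMetric (warpedComplexStructure Λ f hf)) {y : M₁}
    {e : ℂ × EuclideanSpace ℝ (Fin 4)} (he : e ∈ paramDomain y)
    (v : Fin 2 → ℂ × EuclideanSpace ℝ (Fin 4)) :
    formPull h.fundamentalForm y e v = (metricPull h y e (paramJ f y e.1 (v 0)) (v 1) : ℝ) := by
  rw [metricPull, paramJ, paramDeriv_modelJ he]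
  rfl

theorem isSmooth_fundamentalForm (h : HermitianMetric (warpedComplexStructure Λ f hf)) :
    h.fundamentalForm.IsSmooth := by
  intro y
  let B : ℂ × EuclideanSpace ℝ (Fin 4) → ℂ × EuclideanSpace ℝ (Fin 4) →L[ℝ]
      ℂ × EuclideanSpace ℝ (Fin 4) →L[ℝ] ℝ := fun e =>
    (ContinuousLinearMap.compL ℝ _ _ _).flip (paramDeriv Λ y e) ∘L
      (show ℂ × EuclideanSpace ℝ (Fin 4) →L[ℝ] ℂ × EuclideanSpace ℝ (Fin 4) →L[ℝ] ℝ from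
      h.inner (paramMap Λ y e)) ∘L paramDeriv Λ y e
  have hB : ContDiffOn ℝ ∞ B (paramDomain y) := by
    rw [contDiffOn_clm_apply]
    intro u
    rw [contDiffOn_clm_apply]
    intro v
    exact contDiffOn_metricPull h y u v
  refine contDiffOn_alternating_of_apply fun v => ?_
  have hJ : ContDiffOn ℝ ∞ (fun e : ℂ × EuclideanSpace ℝ (Fin 4) => paramJ f y e.1)
      (paramDomain y) := (contDiffOn_paramJ hf y).comp contDiffOn_fst fun e he => he.1
  have h1 := (hB.clm_apply (hJ.clm_apply (contDiffOn_const (c := v 0)))).clm_apply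
    (contDiffOn_const (c := v 1))
  exact (Complex.ofRealCLM.contDiff.comp_contDiffOn h1).congr fun e he =>
    formPull_fundamentalForm h he v

end FormPull

/-! ### The equation for the trace -/

section Trace

/-- The Laplacian `∂²/∂x² + ∂²/∂y²` of a function on the complex plane. -/
def planeLaplacian (s : ℂ → ℝ) (ζ : ℂ) : ℝ :=
  fderiv ℝ (fun ζ => fderiv ℝ s ζ 1) ζ 1 +
    fderiv ℝ (fun ζ => fderiv ℝ s ζ Complex.I) ζ Complex.I

variable {𝒜 : Type*} [NormedRing 𝒜] [NormedAlgebra ℝ 𝒜] {U : Set ℂ} {A K : ℂ → 𝒜}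

theorem ContDiffOn.fderiv_apply_const {F : Type*} [NormedAddCommGroup F] [NormedSpace ℝ F]
    {g : ℂ → F} (hU : IsOpen U) (hg : ContDiffOn ℝ ∞ g U) (w : ℂ) :
    ContDiffOn ℝ ∞ (fun ζ => fderiv ℝ g ζ w) U :=
  (hg.fderiv_of_isOpen hU (by simp)).clm_apply contDiffOn_const

theorem ContDiffOn.hasFDerivAt_of_mem {F : Type*} [NormedAddCommGroup F] [NormedSpace ℝ F]
    {g : ℂ → F} (hU : IsOpen U) (hg : ContDiffOn ℝ ∞ g U) {ζ : ℂ} (hζ : ζ ∈ U) :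
    HasFDerivAt g (fderiv ℝ g ζ) ζ :=
  ((hg.differentiableOn (by simp)).differentiableAt (hU.mem_nhds hζ)).hasFDerivAt

theorem fderiv_apply_of_hasFDerivAt {F G : Type*} [NormedAddCommGroup F] [NormedSpace ℝ F]
    [NormedAddCommGroup G] [NormedSpace ℝ G] {g : F → G} {g' : F →L[ℝ] G} {x : F}
    (h : HasFDerivAt g g' x) (w : F) : fderiv ℝ g x w = g' w := by
  rw [h.fderiv]

/-- A field `K` of complex structures satisfying the Cauchy-Riemann equation `∂_y K = K ∂_x K` is
a harmonic map: its Laplacian is `2 K (∂_x K)²`. -/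
theorem fderiv_fderiv_add_of_cauchyRiemann (hU : IsOpen U) (hK : ContDiffOn ℝ ∞ K U)
    (hsq : ∀ ζ ∈ U, K ζ * K ζ = -1)
    (hCR : ∀ ζ ∈ U, ∀ w, fderiv ℝ K ζ (Complex.I * w) = K ζ * fderiv ℝ K ζ w) {ζ : ℂ} (hζ : ζ ∈ U) :
    fderiv ℝ (fun ζ => fderiv ℝ K ζ 1) ζ 1 + fderiv ℝ (fun ζ => fderiv ℝ K ζ Complex.I) ζ Complex.I
      = 2 * (K ζ * (fderiv ℝ K ζ 1 * fderiv ℝ K ζ 1)) := by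
  have hI : ∀ ζ ∈ U, fderiv ℝ K ζ Complex.I = K ζ * fderiv ℝ K ζ 1 := fun ζ hζ => by
    simpa using hCR ζ hζ 1
  have h1 : ∀ w, fderiv ℝ (fun ζ => fderiv ℝ K ζ Complex.I) ζ w =
      K ζ * fderiv ℝ (fun ζ => fderiv ℝ K ζ 1) ζ w + fderiv ℝ K ζ w * fderiv ℝ K ζ 1 := by
    intro w
    have he : (fun ζ => fderiv ℝ K ζ Complex.I) =ᶠ[𝓝 ζ] fun ζ => K ζ * fderiv ℝ K ζ 1 := by
      filter_upwards [hU.mem_nhds hζ] with ζ' h using hI ζ' h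
    rw [he.fderiv_eq]
    exact fderiv_apply_of_hasFDerivAt ((hK.hasFDerivAt_of_mem hU hζ).mul'
      ((hK.fderiv_apply_const hU 1).hasFDerivAt_of_mem hU hζ)) w
  have hd : DifferentiableAt ℝ (fderiv ℝ K) ζ :=
    (((hK.fderiv_of_isOpen hU (m := ∞) (by simp)).differentiableOn (by simp)).differentiableAt
      (hU.mem_nhds hζ))
  have h2 : ∀ v w, fderiv ℝ (fun ζ => fderiv ℝ K ζ v) ζ w = fderiv ℝ (fderiv ℝ K) ζ w v := by
    intro v w
    rw [(hd.hasFDerivAt.clm_apply (hasFDerivAt_const v ζ)).fderiv]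
    simp
  have hsymm : fderiv ℝ (fun ζ => fderiv ℝ K ζ 1) ζ Complex.I =
      fderiv ℝ (fun ζ => fderiv ℝ K ζ Complex.I) ζ 1 := by
    rw [h2, h2]
    exact ((hK.contDiffAt (hU.mem_nhds hζ)).of_le (m := 2) ENat.LEInfty.out).isSymmSndFDerivAt
      (by simp) _ _
  rw [h1 Complex.I, hsymm, h1 1, hI ζ hζ]
  linear_combination (norm := noncomm_ring) hsq ζ hζ * fderiv ℝ (fun ζ => fderiv ℝ K ζ 1) ζ 1

/-- Let `K` be a field of complex structures satisfying the Cauchy-Riemann equation.  If `A` solves the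
second order equation to which the pluriclosed condition averages, then the function `s = tr (A K)`
solves `Δ s = -2 κ s`, where `(∂_x K)² = -κ`. -/
theorem planeLaplacian_trace (hU : IsOpen U) (tr : 𝒜 →L[ℝ] ℝ) (htr : ∀ a b, tr (a * b) = tr (b * a))
    (hA : ContDiffOn ℝ ∞ A U) (hK : ContDiffOn ℝ ∞ K U) (hsq : ∀ ζ ∈ U, K ζ * K ζ = -1)
    (hCR : ∀ ζ ∈ U, ∀ w, fderiv ℝ K ζ (Complex.I * w) = K ζ * fderiv ℝ K ζ w) {ζ : ℂ} (hζ : ζ ∈ U)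
    (hpde : tr ((fderiv ℝ (fun ζ => K ζ * fderiv ℝ A ζ 1 * K ζ) ζ 1 +
      fderiv ℝ (fun ζ => K ζ * fderiv ℝ A ζ Complex.I * K ζ) ζ Complex.I) * K ζ) = 0)
    {κ : ℝ} (hκ : fderiv ℝ K ζ 1 * fderiv ℝ K ζ 1 = -(κ • 1)) :
    planeLaplacian (fun ζ => tr (A ζ * K ζ)) ζ = -2 * κ * tr (A ζ * K ζ) := by
  have hA' := fun w => (hA.fderiv_apply_const hU w)
  have hK' := fun w => (hK.fderiv_apply_const hU w)
  have e1 : ∀ w, fderiv ℝ (fun ζ => K ζ * fderiv ℝ A ζ w * K ζ) ζ w =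
      K ζ * fderiv ℝ A ζ w * fderiv ℝ K ζ w + (K ζ * fderiv ℝ (fun ζ => fderiv ℝ A ζ w) ζ w +
        fderiv ℝ K ζ w * fderiv ℝ A ζ w) * K ζ := by
    intro w
    exact fderiv_apply_of_hasFDerivAt (((hK.hasFDerivAt_of_mem hU hζ).mul'
      ((hA' w).hasFDerivAt_of_mem hU hζ)).mul' (hK.hasFDerivAt_of_mem hU hζ)) w
  have e2 : ∀ w, ∀ ζ ∈ U, fderiv ℝ (fun ζ => tr (A ζ * K ζ)) ζ w =
      tr (A ζ * fderiv ℝ K ζ w + fderiv ℝ A ζ w * K ζ) := by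
    intro w ζ hζ
    exact fderiv_apply_of_hasFDerivAt (tr.hasFDerivAt.comp ζ ((hA.hasFDerivAt_of_mem hU hζ).mul'
      (hK.hasFDerivAt_of_mem hU hζ))) w
  have e3 : ∀ w, fderiv ℝ (fun ζ => fderiv ℝ (fun ζ => tr (A ζ * K ζ)) ζ w) ζ w =
      tr (A ζ * fderiv ℝ (fun ζ => fderiv ℝ K ζ w) ζ w + fderiv ℝ A ζ w * fderiv ℝ K ζ w +
        (fderiv ℝ A ζ w * fderiv ℝ K ζ w + fderiv ℝ (fun ζ => fderiv ℝ A ζ w) ζ w * K ζ)) := by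
    intro w
    have he : (fun ζ => fderiv ℝ (fun ζ => tr (A ζ * K ζ)) ζ w) =ᶠ[𝓝 ζ]
        fun ζ => tr (A ζ * fderiv ℝ K ζ w + fderiv ℝ A ζ w * K ζ) := by
      filter_upwards [hU.mem_nhds hζ] with ζ' h using e2 w ζ' h
    rw [he.fderiv_eq]
    exact fderiv_apply_of_hasFDerivAt (tr.hasFDerivAt.comp ζ (((hA.hasFDerivAt_of_mem hU hζ).mul'
      ((hK' w).hasFDerivAt_of_mem hU hζ)).add (((hA' w).hasFDerivAt_of_mem hU hζ).mul'
      (hK.hasFDerivAt_of_mem hU hζ)))) w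
  have e4 : ∀ w, tr (fderiv ℝ (fun ζ => K ζ * fderiv ℝ A ζ w * K ζ) ζ w * K ζ) =
      -(2 * tr (fderiv ℝ A ζ w * fderiv ℝ K ζ w)
        + tr (fderiv ℝ (fun ζ => fderiv ℝ A ζ w) ζ w * K ζ)) := by
    intro w
    have t1 : tr (K ζ * fderiv ℝ A ζ w * fderiv ℝ K ζ w * K ζ) =
        -tr (fderiv ℝ A ζ w * fderiv ℝ K ζ w) := by
      rw [htr, ← mul_assoc, ← mul_assoc, hsq ζ hζ]
      simp
    have t2 : ∀ X, tr (X * K ζ * K ζ) = -tr X := by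
      intro X
      rw [mul_assoc, hsq ζ hζ]
      simp
    rw [e1, add_mul, map_add, t1, t2, map_add, htr (K ζ), htr (fderiv ℝ K ζ w)]
    ring
  have hlap := fderiv_fderiv_add_of_cauchyRiemann hU hK hsq hCR hζ
  rw [hκ] at hlap
  have hlap' := congrArg (fun X => tr (A ζ * X)) hlap
  have h5 : A ζ * (2 * (K ζ * -(κ • 1))) = (-2 * κ) • (A ζ * K ζ) := by
    rw [mul_neg, mul_smul_comm, mul_one, two_mul, ← neg_add, ← add_smul, mul_neg, mul_smul_comm,
      ← neg_smul]
    congr 1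
    ring
  simp only [h5, mul_add, map_add, map_smul, smul_eq_mul] at hlap'
  rw [add_mul, map_add, e4, e4] at hpde
  rw [planeLaplacian, e3, e3]
  simp only [map_add]
  linarith

/-- The algebra behind the formula for the imaginary part of `∂̄Ω` on a horizontal and two vertical
vectors: `X`, `Y` stand for the derivatives of `A` in the directions `a`, `i a` and `P`, `K P`
for those of `K`. -/
theorem commuting_deriv_identity {R : Type*} [Ring R] {A K X Y P : R} (hsq : K * K = -1)
    (hcomm : A * K = K * A) (hKP : K * P + P * K = 0) (hX : A * P + X * K = K * X + P * A)
    (hY : A * (K * P) + Y * K = K * Y + K * P * A) : Y - K * X + X * K = -(K * Y * K) := by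
  linear_combination (norm := noncomm_ring) hX - hY * K + Y * hsq + A * hKP * K - A * P * hsq
    - K * P * hcomm - (hKP * K - P * hsq) * A

end Trace

/-! ### Forms on `ℂ × V` that are constant along `V` -/

section InvariantForms

variable {V : Type*} [NormedAddCommGroup V] [InnerProductSpace ℝ V] [FiniteDimensional ℝ V]

instance finiteDimensional_alternating {E : Type*} [NormedAddCommGroup E] [NormedSpace ℝ E]
    [FiniteDimensional ℝ E] {k : ℕ} : FiniteDimensional ℝ (E [⋀^Fin k]→L[ℝ] ℂ) := by
  let b := Module.finBasis ℝ E
  let Φ : (E [⋀^Fin k]→L[ℝ] ℂ) →ₗ[ℝ] ((Fin k → Fin (Module.finrank ℝ E)) → ℂ) :=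
    { toFun := fun α i => α fun l => b (i l)
      map_add' := fun _ _ => rfl
      map_smul' := fun _ _ => rfl }
  refine FiniteDimensional.of_injective Φ fun α β hαβ => ?_
  refine ContinuousAlternatingMap.toAlternatingMap_injective ?_
  exact b.ext_alternating fun i _ => congrFun hαβ i

/-- The restriction of a `2`-form to the vertical directions, as a bilinear form. -/
def verticalBilin (α : (ℂ × V) [⋀^Fin 2]→L[ℝ] ℂ) : V →ₗ[ℝ] V →ₗ[ℝ] ℝ :=
  have swap : ∀ a b : ℂ × V, α ![a, b] = -α ![b, a] := fun a b => by
    refine Eq.trans ?_ (α.toAlternatingMap.map_swap ![b, a] (i := 0) (j := 1) (by decide))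
    refine congrArg α ?_
    ext i <;> fin_cases i <;> rfl
  have add_left : ∀ (u u' v : V), α ![(0, u + u'), (0, v)] =
      α ![(0, u), (0, v)] + α ![(0, u'), (0, v)] := fun u u' v => by
    rw [← α.vecCons_add]
    simp
  have smul_left : ∀ (c : ℝ) (u v : V), α ![(0, c • u), (0, v)] = c • α ![(0, u), (0, v)] :=
    fun c u v => by
      rw [← α.vecCons_smul]
      simp
  LinearMap.mk₂ ℝ (fun u v => (α ![(0, u), (0, v)]).re)
    (fun u u' v => by rw [add_left, Complex.add_re])
    (fun c u v => by rw [smul_left, Complex.smul_re])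
    (fun u v v' => by
      rw [swap, add_left, swap (0, u) (0, v), swap (0, u) (0, v'), ← Complex.add_re, neg_add])
    (fun c u v => by
      rw [swap, smul_left, swap (0, u) (0, v), ← smul_neg, Complex.smul_re])

theorem verticalBilin_apply (α : (ℂ × V) [⋀^Fin 2]→L[ℝ] ℂ) (u v : V) :
    verticalBilin α u v = (α ![(0, u), (0, v)]).re := rfl

/-- The endomorphism `A` of `V` with `⟪u, A v⟫ = Re α (u, v)` for all vertical vectors `u`, `v`. -/
def verticalOperator : ((ℂ × V) [⋀^Fin 2]→L[ℝ] ℂ) →L[ℝ] (V →L[ℝ] V) :=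
  LinearMap.toContinuousLinearMap
    { toFun := fun α => ∑ i, ∑ j, verticalBilin α (stdOrthonormalBasis ℝ V i)
        (stdOrthonormalBasis ℝ V j) •
        InnerProductSpace.rankOne ℝ (stdOrthonormalBasis ℝ V i) (stdOrthonormalBasis ℝ V j)
      map_add' := fun α β => by
        simp only [verticalBilin_apply, ContinuousAlternatingMap.add_apply, Complex.add_re,
          add_smul, Finset.sum_add_distrib]
      map_smul' := fun c α => by
        simp only [verticalBilin_apply, ContinuousAlternatingMap.smul_apply, Complex.smul_re,
          smul_assoc, Finset.smul_sum, RingHom.id_apply] }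

theorem inner_verticalOperator (α : (ℂ × V) [⋀^Fin 2]→L[ℝ] ℂ) (u v : V) :
    inner ℝ u (verticalOperator α v) = (α ![(0, u), (0, v)]).re := by
  rw [← verticalBilin_apply]
  have hu := (stdOrthonormalBasis ℝ V).sum_repr' u
  have hv := (stdOrthonormalBasis ℝ V).sum_repr' v
  conv_rhs => rw [← hu, ← hv]
  have h : verticalOperator α = ∑ i, ∑ j, verticalBilin α (stdOrthonormalBasis ℝ V i)
      (stdOrthonormalBasis ℝ V j) • InnerProductSpace.rankOne ℝ (stdOrthonormalBasis ℝ V i)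
        (stdOrthonormalBasis ℝ V j) := rfl
  rw [h]
  simp only [sum_apply, smul_apply, InnerProductSpace.rankOne_apply, inner_sum, inner_smul_right,
    map_sum, map_smul, LinearMap.sum_apply, LinearMap.smul_apply, smul_eq_mul, Finset.mul_sum]
  rw [Finset.sum_comm]
  refine Finset.sum_congr rfl fun i _ => Finset.sum_congr rfl fun j _ => ?_
  rw [real_inner_comm (stdOrthonormalBasis ℝ V j) u]
  ring

/-- The trace of an endomorphism, as a continuous linear functional. -/
def traceCLM : (V →L[ℝ] V) →L[ℝ] ℝ :=
  LinearMap.toContinuousLinearMap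
    ((LinearMap.trace ℝ V).comp (ContinuousLinearMap.coeLM ℝ))

theorem traceCLM_mul_comm (a b : V →L[ℝ] V) : traceCLM (a * b) = traceCLM (b * a) :=
  LinearMap.trace_mul_comm ℝ (a : V →ₗ[ℝ] V) (b : V →ₗ[ℝ] V)

theorem traceCLM_eq_sum {ι : Type*} [Fintype ι] (b : OrthonormalBasis ι ℝ V) (a : V →L[ℝ] V) :
    traceCLM a = ∑ i, inner ℝ (b i) (a (b i)) :=
  LinearMap.trace_eq_sum_inner (a : V →ₗ[ℝ] V) b

theorem extDeriv_comp_clm {E : Type*} [NormedAddCommGroup E] [NormedSpace ℝ E] {k : ℕ}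
    {b : ℂ → E [⋀^Fin k]→L[ℝ] ℂ} {e : E} (π : E →L[ℝ] ℂ) (hb : DifferentiableAt ℝ b (π e))
    (v : Fin (k + 1) → E) :
    extDeriv (fun e => b (π e)) e v =
      ∑ i : Fin (k + 1), (-1) ^ (i : ℕ) • fderiv ℝ b (π e) (π (v i)) (i.removeNth v) := by
  have h : HasFDerivAt (fun e => b (π e)) ((fderiv ℝ b (π e)).comp π) e :=
    hb.hasFDerivAt.comp e π.hasFDerivAt
  rw [extDeriv, h.fderiv, ContinuousAlternatingMap.alternatizeUncurryFin_apply]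
  rfl

theorem extDeriv_comp_fst {k : ℕ} {b : ℂ → (ℂ × V) [⋀^Fin k]→L[ℝ] ℂ} {e : ℂ × V}
    (hb : DifferentiableAt ℝ b e.1) (v : Fin (k + 1) → ℂ × V) :
    extDeriv (fun e : ℂ × V => b e.1) e v =
      ∑ i : Fin (k + 1), (-1) ^ (i : ℕ) • fderiv ℝ b e.1 (v i).1 (i.removeNth v) :=
  extDeriv_comp_clm (ContinuousLinearMap.fst ℝ ℂ V) hb v

/-- An instance of the chain rule, stated for an arbitrary `E`: on a product space `E` the two
topologies of the space of forms do not unify in the general chain rule. -/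
theorem HasFDerivAt.clm_alternating {D E F : Type*} [NormedAddCommGroup D] [NormedSpace ℝ D]
    [NormedAddCommGroup E] [NormedSpace ℝ E] [NormedAddCommGroup F] [NormedSpace ℝ F] {k : ℕ}
    {b : D → E [⋀^Fin k]→L[ℝ] ℂ} {e : D} {b' : D →L[ℝ] E [⋀^Fin k]→L[ℝ] ℂ}
    (hb : HasFDerivAt b b' e) (L : (E [⋀^Fin k]→L[ℝ] ℂ) →L[ℝ] F) :
    HasFDerivAt (fun e => L (b e)) (L.comp b') e :=
  L.hasFDerivAt.comp e hb

theorem ContDiffOn.clm_alternating {D E F : Type*} [NormedAddCommGroup D] [NormedSpace ℝ D]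
    [NormedAddCommGroup E] [NormedSpace ℝ E] [NormedAddCommGroup F] [NormedSpace ℝ F] {k : ℕ}
    {b : D → E [⋀^Fin k]→L[ℝ] ℂ} {U : Set D} (hb : ContDiffOn ℝ ∞ b U)
    (L : (E [⋀^Fin k]→L[ℝ] ℂ) →L[ℝ] F) : ContDiffOn ℝ ∞ (fun e => L (b e)) U :=
  L.contDiff.comp_contDiffOn hb

theorem extDeriv_comp_fst_three {b : ℂ → (ℂ × V) [⋀^Fin 2]→L[ℝ] ℂ} {e : ℂ × V}
    (hb : DifferentiableAt ℝ b e.1) (a : ℂ) (u v : V) :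
    extDeriv (fun e : ℂ × V => b e.1) e ![(a, 0), (0, u), (0, v)] =
      fderiv ℝ b e.1 a ![(0, u), (0, v)] := by
  rw [extDeriv_comp_fst hb]
  have h0 : (0 : Fin 3).removeNth ![((a, 0) : ℂ × V), (0, u), (0, v)] = ![(0, u), (0, v)] := rfl
  simp [Fin.sum_univ_three, h0]

theorem extDeriv_comp_fst_four {b : ℂ → (ℂ × V) [⋀^Fin 3]→L[ℝ] ℂ} {e : ℂ × V}
    (hb : DifferentiableAt ℝ b e.1) (a c : ℂ) (u v : V) :
    extDeriv (fun e : ℂ × V => b e.1) e ![(a, 0), (c, 0), (0, u), (0, v)] =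
      fderiv ℝ b e.1 a ![(c, 0), (0, u), (0, v)] - fderiv ℝ b e.1 c ![(a, 0), (0, u), (0, v)] := by
  rw [extDeriv_comp_fst hb]
  have h0 : (0 : Fin 4).removeNth ![((a, 0) : ℂ × V), (c, 0), (0, u), (0, v)] =
    ![(c, 0), (0, u), (0, v)] := rfl
  have h1 : (1 : Fin 4).removeNth ![((a, 0) : ℂ × V), (c, 0), (0, u), (0, v)] =
    ![(a, 0), (0, u), (0, v)] := by ext i <;> fin_cases i <;> rfl
  simp [Fin.sum_univ_four, h0, h1, sub_eq_add_neg]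

/-- The complex structure `i ⊕ K` of `ℂ × V`. -/
def prodJ (K : V →L[ℝ] V) : ℂ × V →L[ℝ] ℂ × V :=
  ContinuousLinearMap.prodMap (Complex.I • ContinuousLinearMap.id ℝ ℂ) K

theorem prodJ_horizontal (K : V →L[ℝ] V) (a : ℂ) : prodJ K (a, 0) = (Complex.I * a, 0) := by
  simp [prodJ]

theorem prodJ_vertical (K : V →L[ℝ] V) (u : V) : prodJ K (0, u) = (0, K u) := by
  simp [prodJ]

theorem prodJ_sq {K : V →L[ℝ] V} (hK : K * K = -1) (v : ℂ × V) : prodJ K (prodJ K v) = -v := by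
  have h : ∀ u, K (K u) = -u := fun u => by
    have := DFunLike.congr_fun hK u
    simpa using this
  refine Prod.ext ?_ ?_
  · simp [prodJ, ← mul_assoc]
  · simp [prodJ, h]

variable {U : Set ℂ} {Ω : ℂ → (ℂ × V) [⋀^Fin 2]→L[ℝ] ℂ} {K : ℂ → V →L[ℝ] V}

/-- The operator `∂̄` on `2`-forms of type `(1, 1)` that are constant along `V`. -/
def invariantDelbar (K : ℂ → V →L[ℝ] V) (Ω : ℂ → (ℂ × V) [⋀^Fin 2]→L[ℝ] ℂ) (ζ : ℂ) :
    (ℂ × V) [⋀^Fin 3]→L[ℝ] ℂ :=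
  typePart (prodJ (K ζ)) 1 2 (extDeriv (fun e : ℂ × V => Ω e.1) (ζ, 0))

theorem contDiffOn_invariantDelbar (hU : IsOpen U) (hΩ : ContDiffOn ℝ ∞ Ω U)
    (hK : ContDiffOn ℝ ∞ K U) : ContDiffOn ℝ ∞ (invariantDelbar K Ω) U := by
  have hJ : ContDiffOn ℝ ∞ (fun ζ => prodJ (K ζ)) U := by
    have h1 : ∀ ζ, prodJ (K ζ) = ContinuousLinearMap.prodMapL ℝ ℂ ℂ V V
        (Complex.I • ContinuousLinearMap.id ℝ ℂ, K ζ) := fun ζ => rfl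
    simp only [h1]
    exact (ContinuousLinearMap.contDiff _).comp_contDiffOn (contDiffOn_const.prodMk hK)
  have h2 : ContDiffOn ℝ ∞ (fun e : ℂ × V => Ω e.1) (U ×ˢ Set.univ) :=
    hΩ.comp contDiffOn_fst fun e he => he.1
  have h3 : ContDiffOn ℝ ∞ (fun ζ : ℂ => ((ζ, 0) : ℂ × V)) U := by fun_prop
  exact ((h2.extDeriv (hU.prod isOpen_univ)).comp h3 fun ζ hζ => ⟨hζ, trivial⟩).typePart hJ 1 2

theorem commute_verticalOperator {K : V →L[ℝ] V} (hsq : K * K = -1)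
    (hskew : ∀ u v, inner ℝ (K u) v = -inner ℝ u (K v)) {α : (ℂ × V) [⋀^Fin 2]→L[ℝ] ℂ}
    (hinv : ∀ u v, α ![(0, K u), (0, K v)] = α ![(0, u), (0, v)]) :
    verticalOperator α * K = K * verticalOperator α := by
  have h1 : K * verticalOperator α * K = -verticalOperator α := by
    ext v
    refine ext_inner_left ℝ fun u => ?_
    have h2 : inner ℝ (K u) (verticalOperator α (K v)) = inner ℝ u (verticalOperator α v) := by
      rw [inner_verticalOperator, inner_verticalOperator, hinv]
    rw [hskew] at h2
    simp only [mul_apply_eq_comp, neg_apply, inner_neg_right]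
    linarith
  have h3 := congrArg (fun X => K * X) h1
  simp only [← mul_assoc, hsq] at h3
  linear_combination (norm := noncomm_ring) -h3

/-- The imaginary part of `∂̄Ω` on a horizontal vector and two vertical ones.  The hypotheses say
that `i ⊕ K` is an integrable complex structure, orthogonal in the vertical directions, and that the
restriction of `Ω` to these directions is real and of type `(1, 1)`. -/
theorem im_invariantDelbar (hU : IsOpen U) (hΩ : ContDiffOn ℝ ∞ Ω U) (hK : ContDiffOn ℝ ∞ K U)
    (hsq : ∀ ζ ∈ U, K ζ * K ζ = -1)
    (hCR : ∀ ζ ∈ U, ∀ w, fderiv ℝ K ζ (Complex.I * w) = K ζ * fderiv ℝ K ζ w)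
    (hskew : ∀ ζ ∈ U, ∀ u v, inner ℝ (K ζ u) v = -inner ℝ u (K ζ v))
    (hreal : ∀ ζ ∈ U, ∀ u v, (Ω ζ ![(0, u), (0, v)]).im = 0)
    (hinv : ∀ ζ ∈ U, ∀ u v, Ω ζ ![(0, K ζ u), (0, K ζ v)] = Ω ζ ![(0, u), (0, v)])
    {ζ : ℂ} (hζ : ζ ∈ U) (a : ℂ) (u v : V) :
    (invariantDelbar K Ω ζ ![(a, 0), (0, u), (0, v)]).im = -(1 / 2) * inner ℝ u ((K ζ *
      fderiv ℝ (fun ζ => verticalOperator (Ω ζ)) ζ (Complex.I * a) * K ζ) v) := by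
  have hdΩ := hΩ.hasFDerivAt_of_mem hU hζ
  have hA : ContDiffOn ℝ ∞ (fun ζ => verticalOperator (Ω ζ)) U :=
    hΩ.clm_alternating verticalOperator
  have hdA := hA.hasFDerivAt_of_mem hU hζ
  have hdK := hK.hasFDerivAt_of_mem hU hζ
  have hA1 : ∀ w, fderiv ℝ (fun ζ => verticalOperator (Ω ζ)) ζ w =
      verticalOperator (fderiv ℝ Ω ζ w) := fun w =>
    fderiv_apply_of_hasFDerivAt (hdΩ.clm_alternating verticalOperator) w
  have hre : ∀ w u v, (fderiv ℝ Ω ζ w ![(0, u), (0, v)]).re =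
      inner ℝ u (fderiv ℝ (fun ζ => verticalOperator (Ω ζ)) ζ w v) := by
    intro w u v
    rw [hA1, inner_verticalOperator]
  have him : ∀ w u v, (fderiv ℝ Ω ζ w ![(0, u), (0, v)]).im = 0 := by
    intro w u v
    have h1 : HasFDerivAt (fun ζ => (Ω ζ ![(0, u), (0, v)]).im) _ ζ :=
      Complex.imCLM.hasFDerivAt.comp ζ (hdΩ.continuousAlternatingMap_apply_const ![(0, u), (0, v)])
    have h2 : (fun ζ => (Ω ζ ![(0, u), (0, v)]).im) =ᶠ[𝓝 ζ] fun _ => 0 := by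
      filter_upwards [hU.mem_nhds hζ] with ζ' h using hreal ζ' h u v
    have h3 := fderiv_apply_of_hasFDerivAt h1 w
    rw [h2.fderiv_eq] at h3
    simpa using h3.symm
  -- the derivatives of the identities `A K = K A` and `K K = -1`
  have hcomm : ∀ ζ ∈ U, verticalOperator (Ω ζ) * K ζ = K ζ * verticalOperator (Ω ζ) := fun ζ hζ =>
    commute_verticalOperator (hsq ζ hζ) (hskew ζ hζ) (hinv ζ hζ)
  have hdcomm : ∀ w, verticalOperator (Ω ζ) * fderiv ℝ K ζ w +
      fderiv ℝ (fun ζ => verticalOperator (Ω ζ)) ζ w * K ζ =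
      K ζ * fderiv ℝ (fun ζ => verticalOperator (Ω ζ)) ζ w +
        fderiv ℝ K ζ w * verticalOperator (Ω ζ) := by
    intro w
    have h1 := fderiv_apply_of_hasFDerivAt (hdA.mul' hdK) w
    have h2 := fderiv_apply_of_hasFDerivAt (hdK.mul' hdA) w
    have h3 : (fun ζ => verticalOperator (Ω ζ)) * K =ᶠ[𝓝 ζ]
        K * fun ζ => verticalOperator (Ω ζ) := by
      filter_upwards [hU.mem_nhds hζ] with ζ' h using hcomm ζ' h
    rw [h3.fderiv_eq] at h1
    exact h1.symm.trans h2
  have hdsq : K ζ * fderiv ℝ K ζ a + fderiv ℝ K ζ a * K ζ = 0 := by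
    have h1 := fderiv_apply_of_hasFDerivAt (hdK.mul' hdK) a
    have h3 : K * K =ᶠ[𝓝 ζ] fun _ => -1 := by
      filter_upwards [hU.mem_nhds hζ] with ζ' h using hsq ζ' h
    rw [h3.fderiv_eq] at h1
    simpa using h1.symm
  have hY := hdcomm (Complex.I * a)
  rw [hCR ζ hζ] at hY
  have hkey := commuting_deriv_identity (hsq ζ hζ) (hcomm ζ hζ) hdsq (hdcomm a) hY
  have hkey' := congrArg (fun T : V →L[ℝ] V => inner ℝ u (T v)) hkey
  simp only [add_apply, sub_apply, neg_apply, mul_apply_eq_comp, inner_add_right,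
    inner_sub_right, inner_neg_right] at hkey'
  rw [invariantDelbar, typePart_one_two_apply]
  simp only [prodJ_horizontal, prodJ_vertical,
    extDeriv_comp_fst_three (e := (ζ, (0 : V))) hdΩ.differentiableAt]
  have hs := hskew ζ hζ
  simp only [Complex.mul_im, Complex.add_im, Complex.add_re, Complex.mul_re, hre, him,
    Complex.I_re, Complex.I_im, hs, mul_apply_eq_comp]
  norm_num
  linarith

/-- For a form `Ω` constant along `V`, the vanishing of the `(2, 2)`-part of `d ∂̄Ω` gives a
second order equation for the field of endomorphisms representing the restriction of `Ω` to `V`. -/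
theorem trace_eq_zero_of_invariant (hU : IsOpen U) (hΩ : ContDiffOn ℝ ∞ Ω U)
    (hK : ContDiffOn ℝ ∞ K U) (hsq : ∀ ζ ∈ U, K ζ * K ζ = -1)
    (hCR : ∀ ζ ∈ U, ∀ w, fderiv ℝ K ζ (Complex.I * w) = K ζ * fderiv ℝ K ζ w)
    (hskew : ∀ ζ ∈ U, ∀ u v, inner ℝ (K ζ u) v = -inner ℝ u (K ζ v))
    (hreal : ∀ ζ ∈ U, ∀ u v, (Ω ζ ![(0, u), (0, v)]).im = 0)
    (hinv : ∀ ζ ∈ U, ∀ u v, Ω ζ ![(0, K ζ u), (0, K ζ v)] = Ω ζ ![(0, u), (0, v)])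
    {ζ : ℂ} (hζ : ζ ∈ U) (hpl : typePart (prodJ (K ζ)) 2 2
      (extDeriv (fun e : ℂ × V => invariantDelbar K Ω e.1) (ζ, 0)) = 0) :
    traceCLM ((fderiv ℝ (fun ζ => K ζ * fderiv ℝ (fun ζ => verticalOperator (Ω ζ)) ζ 1 * K ζ) ζ 1 +
      fderiv ℝ (fun ζ => K ζ * fderiv ℝ (fun ζ => verticalOperator (Ω ζ)) ζ Complex.I * K ζ) ζ
        Complex.I) * K ζ) = 0 := by
  have hA : ContDiffOn ℝ ∞ (fun ζ => verticalOperator (Ω ζ)) U :=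
    hΩ.clm_alternating verticalOperator
  have hβ := (contDiffOn_invariantDelbar hU hΩ hK).hasFDerivAt_of_mem hU hζ
  have hN : ∀ w, DifferentiableAt ℝ
      (fun ζ => K ζ * fderiv ℝ (fun ζ => verticalOperator (Ω ζ)) ζ w * K ζ) ζ := fun w =>
    (((hK.hasFDerivAt_of_mem hU hζ).mul' ((hA.fderiv_apply_const hU w).hasFDerivAt_of_mem hU hζ)).mul'
      (hK.hasFDerivAt_of_mem hU hζ)).differentiableAt
  -- the imaginary part of the derivative of `∂̄Ω`, for constant vectors
  have hder : ∀ (a w : ℂ) (u v : V),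
      (fderiv ℝ (invariantDelbar K Ω) ζ w ![(a, 0), (0, u), (0, v)]).im =
      -(1 / 2) * inner ℝ u (fderiv ℝ (fun ζ => K ζ *
        fderiv ℝ (fun ζ => verticalOperator (Ω ζ)) ζ (Complex.I * a) * K ζ) ζ w v) := by
    intro a w u v
    have h1 : HasFDerivAt (fun ζ => (invariantDelbar K Ω ζ ![(a, 0), (0, u), (0, v)]).im) _ ζ :=
      Complex.imCLM.hasFDerivAt.comp ζ
        (hβ.continuousAlternatingMap_apply_const ![(a, 0), (0, u), (0, v)])
    let L : (V →L[ℝ] V) →L[ℝ] ℝ := (innerSL ℝ u).comp (ContinuousLinearMap.apply ℝ V v)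
    have h2 := ((L.hasFDerivAt.comp ζ (hN (Complex.I * a)).hasFDerivAt).const_mul (-(1 / 2)))
    have h3 : (fun ζ => (invariantDelbar K Ω ζ ![(a, 0), (0, u), (0, v)]).im) =ᶠ[𝓝 ζ] fun ζ =>
        -(1 / 2) * L (K ζ * fderiv ℝ (fun ζ => verticalOperator (Ω ζ)) ζ (Complex.I * a) * K ζ) := by
      filter_upwards [hU.mem_nhds hζ] with ζ' h
      exact im_invariantDelbar hU hΩ hK hsq hCR hskew hreal hinv h a u v
    have h4 := fderiv_apply_of_hasFDerivAt h1 w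
    rw [h3.fderiv_eq] at h4
    exact h4.symm.trans (fderiv_apply_of_hasFDerivAt h2 w)
  -- each diagonal entry is a multiple of the imaginary part of `∂∂̄Ω` on `(1, i, u, K u)`
  rw [traceCLM_eq_sum (stdOrthonormalBasis ℝ V)]
  refine Finset.sum_eq_zero fun i _ => ?_
  set u := stdOrthonormalBasis ℝ V i
  have h1 := typePart_two_two_apply (prodJ_sq (hsq ζ hζ))
    (extDeriv (fun e : ℂ × V => invariantDelbar K Ω e.1) (ζ, 0)) (1, 0) (0, u)
  rw [hpl, prodJ_horizontal, prodJ_vertical,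
    extDeriv_comp_fst_four (e := (ζ, (0 : V))) hβ.differentiableAt] at h1
  have h2 := congrArg Complex.im h1
  rw [Complex.sub_im, hder, hder] at h2
  have h3 : ∀ w, (fun ζ => K ζ * fderiv ℝ (fun ζ => verticalOperator (Ω ζ)) ζ (-w) * K ζ) =
      fun ζ => -(K ζ * fderiv ℝ (fun ζ => verticalOperator (Ω ζ)) ζ w * K ζ) := by
    intro w; ext1 ζ; simp
  have h4 : Complex.I * (Complex.I * 1) = -1 := by simp
  rw [h4, h3, fderiv_fun_neg] at h2
  simp only [mul_apply_eq_comp, add_apply, inner_add_right]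
  simp at h2
  linarith

end InvariantForms

/-! ### Averages of differential forms over the torus -/

section AverageForms

open MeasureTheory

variable {X V : Type} [NormedAddCommGroup X] [NormedSpace ℝ X] [FiniteDimensional ℝ X]
  [NormedAddCommGroup V] [NormedSpace ℝ V] [FiniteDimensional ℝ V] [MeasureSpace V] [BorelSpace V]
  [(volume : Measure V).IsAddHaarMeasure]
  {Λ : Submodule ℤ V} [DiscreteTopology Λ] [IsZLattice ℝ Λ] {U : Set X} {k : ℕ}

theorem torusAverage_congr {W : Type} [NormedAddCommGroup W] [NormedSpace ℝ W] {G H : X × V → W}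
    (h : ∀ e ∈ U ×ˢ Set.univ, G e = H e) {ζ : X} (hζ : ζ ∈ U) :
    torusAverage Λ G ζ = torusAverage Λ H ζ := by
  unfold torusAverage
  exact congrArg (fun g => ∫ t in latticeCell Λ, g t) (funext fun t => h (ζ, t) ⟨hζ, trivial⟩)

theorem continuous_slice {W : Type} [NormedAddCommGroup W] {G : X × V → W}
    (hG : ContinuousOn G (U ×ˢ Set.univ)) {ζ : X} (hζ : ζ ∈ U) : Continuous fun t => G (ζ, t) :=
  hG.comp_continuous (by fun_prop) fun _ => ⟨hζ, trivial⟩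

theorem torusAverage_clm {W Z : Type} [NormedAddCommGroup W] [NormedSpace ℝ W] [CompleteSpace W]
    [NormedAddCommGroup Z] [NormedSpace ℝ Z] [CompleteSpace Z] (L : W →L[ℝ] Z) {G : X × V → W}
    (hG : ContinuousOn G (U ×ˢ Set.univ)) {ζ : X} (hζ : ζ ∈ U) :
    torusAverage Λ (fun e => L (G e)) ζ = L (torusAverage Λ G ζ) :=
  L.integral_comp_comm (integrableOn_latticeCell Λ (continuous_slice hG hζ))

theorem torusAverage_clm_alternating {E Z : Type} [NormedAddCommGroup E] [NormedSpace ℝ E]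
    [NormedAddCommGroup Z] [NormedSpace ℝ Z] [CompleteSpace Z]
    (L : (E [⋀^Fin k]→L[ℝ] ℂ) →L[ℝ] Z) {G : X × V → E [⋀^Fin k]→L[ℝ] ℂ}
    (hG : ContinuousOn G (U ×ˢ Set.univ)) {ζ : X} (hζ : ζ ∈ U) :
    torusAverage Λ (fun e => L (G e)) ζ = L (torusAverage Λ G ζ) :=
  torusAverage_clm L hG hζ

theorem torusAverage_alternatize {E : Type} [NormedAddCommGroup E] [NormedSpace ℝ E]
    {G : X × V → E →L[ℝ] E [⋀^Fin k]→L[ℝ] ℂ} (hG : ContinuousOn G (U ×ˢ Set.univ)) {ζ : X}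
    (hζ : ζ ∈ U) :
    torusAverage Λ (fun e => ContinuousAlternatingMap.alternatizeUncurryFin (G e)) ζ =
      ContinuousAlternatingMap.alternatizeUncurryFin (torusAverage Λ G ζ) :=
  torusAverage_clm (W := E →L[ℝ] E [⋀^Fin k]→L[ℝ] ℂ) (Z := E [⋀^Fin (k + 1)]→L[ℝ] ℂ)
    (ContinuousAlternatingMap.alternatizeUncurryFinCLM ℝ E ℂ) hG hζ

/-- Taking the part of type `(p, q)`, as a continuous linear map. -/
def typePartCLM {E : Type*} [NormedAddCommGroup E] [NormedSpace ℝ E] [FiniteDimensional ℝ E]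
    (j : E →L[ℝ] E) (p q : ℕ) : (E [⋀^Fin k]→L[ℝ] ℂ) →L[ℝ] (E [⋀^Fin k]→L[ℝ] ℂ) :=
  LinearMap.toContinuousLinearMap
    { toFun := typePart j p q
      map_add' := fun α β => by
        ext v
        simp only [typePart_apply, ContinuousAlternatingMap.add_apply, mul_add,
          Finset.sum_add_distrib]
      map_smul' := fun c α => by
        ext v
        simp only [typePart_apply, ContinuousAlternatingMap.smul_apply, RingHom.id_apply,
          Finset.smul_sum, mul_smul_comm] }

theorem torusAverage_typePart {E : Type} [NormedAddCommGroup E] [NormedSpace ℝ E]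
    [FiniteDimensional ℝ E] {J : X → E →L[ℝ] E} (p q : ℕ) {G : X × V → E [⋀^Fin k]→L[ℝ] ℂ}
    (hG : ContinuousOn G (U ×ˢ Set.univ)) {ζ : X} (hζ : ζ ∈ U) :
    torusAverage Λ (fun e => typePart (J e.1) p q (G e)) ζ =
      typePart (J ζ) p q (torusAverage Λ G ζ) :=
  torusAverage_clm_alternating (typePartCLM (J ζ) p q) hG hζ

/-- Averaging over the torus commutes with the exterior derivative. -/
theorem torusAverage_extDeriv {G : X × V → (X × V) [⋀^Fin k]→L[ℝ] ℂ} (hU : IsOpen U)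
    (hG : ContDiffOn ℝ ∞ G (U ×ˢ Set.univ)) (hper : IsPeriodicOn Λ U G) {e : X × V}
    (he : e.1 ∈ U) :
    torusAverage Λ (extDeriv G) e.1 = extDeriv (fun e : X × V => torusAverage Λ G e.1) e := by
  have h1 := fderiv_torusAverage hU (hG.of_le (by simp)) hper he
  have h2 : ContinuousOn (fderiv ℝ G) (U ×ˢ Set.univ) :=
    hG.continuousOn_fderiv_of_isOpen (hU.prod isOpen_univ) (by simp)
  rw [extDeriv, h1]
  exact torusAverage_alternatize h2 he

end AverageForms

/-! ### The averaged fundamental form -/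

section AveragedForm

variable {M₁ : Type*} [TopologicalSpace M₁] [ChartedSpace ℂ M₁] [IsManifold 𝓘(ℂ) ω M₁]
  {Λ : Submodule ℤ (EuclideanSpace ℝ (Fin 4))} [DiscreteTopology Λ] [IsZLattice ℝ Λ]
  {f : M₁ → OnePoint ℂ} {hf : IsHolomorphicToP1 f}

/-- The fundamental form in the parametrization `paramMap y`, averaged over the torus. -/
def averagedForm (h : HermitianMetric (warpedComplexStructure Λ f hf)) (y : M₁) :
    ℂ → (ℂ × EuclideanSpace ℝ (Fin 4)) [⋀^Fin 2]→L[ℝ] ℂ :=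
  torusAverage Λ (formPull h.fundamentalForm y)

theorem contDiffOn_averagedForm (h : HermitianMetric (warpedComplexStructure Λ f hf)) (y : M₁) :
    ContDiffOn ℝ ∞ (averagedForm h y) (chartAt ℂ y).target :=
  contDiffOn_torusAverage (chartAt ℂ y).open_target (isSmooth_fundamentalForm h y)
    (isPeriodicOn_formPull _ y)

theorem formPull_typePart_d {k : ℕ} {α : DiffForm warpedModel (M₁ × FlatTorus Λ) k}
    (hα : α.IsSmooth) (p q : ℕ) {y : M₁} {e : ℂ × EuclideanSpace ℝ (Fin 4)}
    (he : e ∈ paramDomain y) :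
    formPull (fun x => typePart (warpedJ Λ f x) p q (α.d x)) y e =
      typePart (paramJ f y e.1) p q (extDeriv (formPull α y) e) := by
  rw [formPull_typePart f p q α.d he, formPull_d hα he]

theorem isSmooth_typePart_d (hf : IsHolomorphicToP1 f) {k : ℕ}
    {α : DiffForm warpedModel (M₁ × FlatTorus Λ) k} (hα : α.IsSmooth) (p q : ℕ) :
    DiffForm.IsSmooth (fun x => typePart (warpedJ Λ f x) p q (α.d x)) := fun y =>
  (((hα y).extDeriv (isOpen_paramDomain y)).typePart
    ((contDiffOn_paramJ hf y).comp contDiffOn_fst fun _ he => he.1) p q).congr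
    fun _ he => formPull_typePart_d hα p q he

theorem torusAverage_formPull_typePart_d {k : ℕ} {α : DiffForm warpedModel (M₁ × FlatTorus Λ) k}
    (hα : α.IsSmooth) (p q : ℕ) {y : M₁} {ζ : ℂ} (hζ : ζ ∈ (chartAt ℂ y).target) :
    torusAverage Λ (formPull (fun x => typePart (warpedJ Λ f x) p q (α.d x)) y) ζ =
      typePart (paramJ f y ζ) p q (extDeriv (fun e : ℂ × EuclideanSpace ℝ (Fin 4) =>
        torusAverage Λ (formPull α y) e.1) (ζ, 0)) := by
  have h1 := torusAverage_extDeriv (chartAt ℂ y).open_target (hα y) (isPeriodicOn_formPull α y)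
    (e := (ζ, 0)) hζ
  rw [← h1, torusAverage_congr (fun e he => formPull_typePart_d (f := f) hα p q he) hζ]
  exact torusAverage_typePart p q ((hα y).extDeriv (isOpen_paramDomain y)).continuousOn hζ

/-- The averaged fundamental form of a pluriclosed metric is pluriclosed. -/
theorem averagedForm_isPluriclosed {h : HermitianMetric (warpedComplexStructure Λ f hf)}
    (hpl : h.IsPluriclosed) {y : M₁} {ζ : ℂ} (hζ : ζ ∈ (chartAt ℂ y).target) :
    typePart (prodJ (orthogonalJ (f ((chartAt ℂ y).symm ζ)))) 2 2
      (extDeriv (fun e : ℂ × EuclideanSpace ℝ (Fin 4) =>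
        invariantDelbar (fun ζ => orthogonalJ (f ((chartAt ℂ y).symm ζ))) (averagedForm h y) e.1)
        (ζ, 0)) = 0 := by
  have hω := isSmooth_fundamentalForm h
  have hβ := isSmooth_typePart_d hf hω 1 2
  have h1 := torusAverage_formPull_typePart_d (f := f) hβ 2 2 hζ
  have h2 : torusAverage Λ (formPull (fun x => typePart (warpedJ Λ f x) 2 2
      (DiffForm.d (fun x => typePart (warpedJ Λ f x) 1 2 (h.fundamentalForm.d x)) x)) y) ζ = 0 := by
    have h3 : (fun x => typePart (warpedJ Λ f x) 2 2
      (DiffForm.d (fun x => typePart (warpedJ Λ f x) 1 2 (h.fundamentalForm.d x)) x)) =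
      fun x => 0 := funext hpl
    rw [h3]
    unfold torusAverage formPull
    exact (MeasureTheory.integral_congr_ae (Filter.Eventually.of_forall fun t => by
      ext v; rfl)).trans (MeasureTheory.integral_zero _ _)
  rw [h2] at h1
  rw [h1]
  refine congrArg (typePart _ 2 2) (Filter.EventuallyEq.extDeriv_eq ?_)
  have h4 : ∀ᶠ e : ℂ × EuclideanSpace ℝ (Fin 4) in 𝓝 (ζ, 0), e ∈ paramDomain y :=
    (isOpen_paramDomain y).mem_nhds ⟨hζ, trivial⟩
  filter_upwards [h4] with e he
  exact (torusAverage_formPull_typePart_d hω 1 2 he.1).symm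

end AveragedForm

/-! ### The field of complex structures of `ℝ⁴` -/

section OrthogonalComplexStructures

theorem orthogonalJ_mul_self (p : OnePoint ℂ) : orthogonalJ p * orthogonalJ p = -1 :=
  ContinuousLinearMap.ext fun v => orthogonalJ_sq p v

theorem inner_orthogonalJ_left (p : OnePoint ℂ) (u v : EuclideanSpace ℝ (Fin 4)) :
    inner ℝ (orthogonalJ p u) v = -inner ℝ u (orthogonalJ p v) := by
  simp only [orthogonalJ, PiLp.inner_apply, Matrix.ofLp_toEuclideanCLM, Matrix.mulVec,
    dotProduct, quaternionMatrix, Fin.sum_univ_four]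
  simp
  ring

theorem sphereOfP1_injective : Function.Injective sphereOfP1 := by
  intro p q h
  have hN : ∀ z : ℂ, (‖z‖ ^ 2 - 1) / (‖z‖ ^ 2 + 1) = 1 - 2 / (‖z‖ ^ 2 + 1) := fun z => by
    have : ‖z‖ ^ 2 + 1 ≠ 0 := by positivity
    field_simp
    ring
  have hpos : ∀ z : ℂ, 0 < ‖z‖ ^ 2 + 1 := fun z => by positivity
  induction p using OnePoint.rec with
  | infty =>
    induction q using OnePoint.rec with
    | infty => rfl
    | coe w =>
      have h3 := congrArg (fun t => t.2.2) h
      simp only [sphereOfP1, OnePoint.elim_some, OnePoint.elim_infty, hN] at h3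
      have := div_pos two_pos (hpos w)
      linarith
  | coe z =>
    induction q using OnePoint.rec with
    | infty =>
      have h3 := congrArg (fun t => t.2.2) h
      simp only [sphereOfP1, OnePoint.elim_some, OnePoint.elim_infty, hN] at h3
      have := div_pos two_pos (hpos z)
      linarith
    | coe w =>
      have h1 := congrArg (fun t => t.1) h
      have h2 := congrArg (fun t => t.2.1) h
      have h3 := congrArg (fun t => t.2.2) h
      simp only [sphereOfP1, OnePoint.elim_some, hN] at h1 h2 h3
      have h4 : ‖z‖ ^ 2 + 1 = ‖w‖ ^ 2 + 1 := by
        have h5 : 2 / (‖z‖ ^ 2 + 1) = 2 / (‖w‖ ^ 2 + 1) := by linarith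
        have hz := (hpos z).ne'
        have hw := (hpos w).ne'
        field_simp at h5
        linarith
      rw [h4] at h1 h2
      rw [div_left_inj' (hpos w).ne'] at h1 h2
      exact congrArg _ (Complex.ext (by linarith) (by linarith))

theorem orthogonalJ_injective : Function.Injective orthogonalJ := by
  intro p q h
  have h1 := (Matrix.toEuclideanCLM (n := Fin 4) (𝕜 := ℝ)).injective h
  refine sphereOfP1_injective (Prod.ext ?_ (Prod.ext ?_ ?_))
  · simpa [quaternionMatrix] using congrFun (congrFun h1 0) 1
  · simpa [quaternionMatrix] using congrFun (congrFun h1 0) 3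
  · simpa [quaternionMatrix] using congrFun (congrFun h1 0) 2

/-- The square of the derivative of `sphereJ`; the factor is the squared length of the image of `ξ`
under the differential of the stereographic parametrization of the sphere. -/
theorem fderiv_sphereJ_mul_self {ε : ℝ} (hε : ε = 1 ∨ ε = -1) (z ξ : ℂ) :
    fderiv ℝ (sphereJ ε) z ξ * fderiv ℝ (sphereJ ε) z ξ =
      -((4 * (ξ.re ^ 2 + ξ.im ^ 2) / (z.re ^ 2 + z.im ^ 2 + 1) ^ 2) • 1) := by
  have hN : z.re ^ 2 + z.im ^ 2 + 1 ≠ 0 := by positivity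
  have hN' : z.im ^ 2 + z.re ^ 2 + 1 ≠ 0 := by positivity
  have h0 : ∀ r s a b c : ℝ, a = 0 → b = 0 → c = 0 → r = s →
      Matrix.toEuclideanCLM (n := Fin 4) (𝕜 := ℝ) (quaternionMatrix a b c - r • 1) = -(s • 1) := by
    rintro r _ _ _ _ rfl rfl rfl rfl
    have : quaternionMatrix 0 0 0 = 0 := by
      rw [quaternionMatrix_eq]; simp
    rw [this]
    simp
  rw [fderiv_sphereJ, ← map_mul, quaternionMatrix_mul]
  refine h0 _ _ _ _ _ (by ring) (by ring) (by ring) ?_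
  rcases hε with rfl | rfl <;> field_simp <;> ring

end OrthogonalComplexStructures

section LocalField

variable {M₁ : Type*} [TopologicalSpace M₁] [ChartedSpace ℂ M₁] [IsManifold 𝓘(ℂ) ω M₁]
  {f : M₁ → OnePoint ℂ}

/-- The field of complex structures `J_f` in the preferred chart around `y`. -/
def chartJ (f : M₁ → OnePoint ℂ) (y : M₁) (ζ : ℂ) :
    EuclideanSpace ℝ (Fin 4) →L[ℝ] EuclideanSpace ℝ (Fin 4) :=
  orthogonalJ (f ((chartAt ℂ y).symm ζ))

theorem contDiffOn_chartJ (hf : IsHolomorphicToP1 f) (y : M₁) :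
    ContDiffOn ℝ ∞ (chartJ f y) (chartAt ℂ y).target :=
  contDiffOn_orthogonalJ hf y

theorem analyticAt_comp_chart_symm {g : M₁ → ℂ} {y : M₁} {ζ : ℂ}
    (hζ : ζ ∈ (chartAt ℂ y).target)
    (hg : ∀ᶠ y' in 𝓝 ((chartAt ℂ y).symm ζ), MDifferentiableAt 𝓘(ℂ) 𝓘(ℂ) g y') :
    AnalyticAt ℂ (g ∘ (chartAt ℂ y).symm) ζ := by
  refine Complex.analyticAt_iff_eventually_differentiableAt.2 ?_
  filter_upwards [(chartAt ℂ y).open_target.mem_nhds hζ,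
    ((chartAt ℂ y).continuousAt_symm hζ).eventually hg] with ζ' h hgζ
  exact (hgζ.comp ζ' (mdifferentiableAt_atlas_symm (I := 𝓘(ℂ))
    (chart_mem_atlas ℂ y) h)).differentiableAt

/-- Near every point of the chart domain, `J_f` is one of the two standard families composed with an
analytic function: the affine coordinate of `f` away from its poles, and its inverse at a pole. -/
theorem exists_chartJ_eq (hf : IsHolomorphicToP1 f) {y : M₁} {ζ : ℂ}
    (hζ : ζ ∈ (chartAt ℂ y).target) :
    ∃ (ε : ℝ) (g : ℂ → ℂ), (ε = 1 ∨ ε = -1) ∧ AnalyticAt ℂ g ζ ∧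
      ∀ᶠ ζ' in 𝓝 ζ, chartJ f y ζ' = sphereJ ε (g ζ') := by
  have hc := (chartAt ℂ y).continuousAt_symm hζ
  by_cases h : f ((chartAt ℂ y).symm ζ) = OnePoint.infty
  · have h1 : ∀ᶠ y' in 𝓝 ((chartAt ℂ y).symm ζ), f y' ≠ ((0 : ℂ) : OnePoint ℂ) :=
      hf.continuous.continuousAt.eventually_ne (by rw [h]; exact OnePoint.infty_ne_coe 0)
    exact ⟨-1, _, Or.inr rfl, analyticAt_comp_chart_symm hζ (h1.mono hf.infty),
      (hc.eventually h1).mono fun ζ' hy => orthogonalJ_of_ne_zero hy⟩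
  · have h1 : ∀ᶠ y' in 𝓝 ((chartAt ℂ y).symm ζ), f y' ≠ OnePoint.infty :=
      hf.continuous.continuousAt.eventually_ne h
    exact ⟨1, _, Or.inl rfl, analyticAt_comp_chart_symm hζ (h1.mono hf.affine),
      (hc.eventually h1).mono fun ζ' hy => orthogonalJ_of_ne_infty hy⟩

theorem fderiv_chartJ_apply {y : M₁} {ζ : ℂ} {ε : ℝ} {g : ℂ → ℂ} (hg : AnalyticAt ℂ g ζ)
    (he : ∀ᶠ ζ' in 𝓝 ζ, chartJ f y ζ' = sphereJ ε (g ζ')) (w : ℂ) :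
    fderiv ℝ (chartJ f y) ζ w = fderiv ℝ (sphereJ ε) (g ζ) (deriv g ζ * w) := by
  have hd := hg.differentiableAt.hasFDerivAt
  have hS := ((contDiff_sphereJ ε).differentiable (by simp) (g ζ)).hasFDerivAt
  have h := fderiv_apply_of_hasFDerivAt
    ((hS.comp ζ (hd.restrictScalars ℝ)).congr_of_eventuallyEq he) w
  rw [h]
  simp only [ContinuousLinearMap.comp_apply, ContinuousLinearMap.coe_restrictScalars']
  rw [fderiv_eq_smul_deriv, smul_eq_mul, mul_comm]

theorem fderiv_chartJ_I (hf : IsHolomorphicToP1 f) {y : M₁} {ζ : ℂ}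
    (hζ : ζ ∈ (chartAt ℂ y).target) (w : ℂ) :
    fderiv ℝ (chartJ f y) ζ (Complex.I * w) = chartJ f y ζ * fderiv ℝ (chartJ f y) ζ w := by
  obtain ⟨ε, g, hε, hg, he⟩ := exists_chartJ_eq hf hζ
  rw [fderiv_chartJ_apply hg he, fderiv_chartJ_apply hg he, mul_left_comm, fderiv_sphereJ_I ε hε,
    he.self_of_nhds]

theorem fderiv_sphereJ_eq_zero_iff {ε : ℝ} (hε : ε = 1 ∨ ε = -1) (z ξ : ℂ) :
    fderiv ℝ (sphereJ ε) z ξ = 0 ↔ ξ = 0 := by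
  refine ⟨fun h => ?_, fun h => by rw [h, map_zero]⟩
  have h1 := fderiv_sphereJ_mul_self hε z ξ
  rw [h, zero_mul, eq_comm, neg_eq_zero] at h1
  have hN : z.re ^ 2 + z.im ^ 2 + 1 ≠ 0 := by positivity
  have h2 : 4 * (ξ.re ^ 2 + ξ.im ^ 2) / (z.re ^ 2 + z.im ^ 2 + 1) ^ 2 = 0 := by
    simpa using congrArg (fun v : EuclideanSpace ℝ (Fin 4) => v 0)
      (DFunLike.congr_fun h1 (EuclideanSpace.single 0 1))
  rw [div_eq_zero_iff, or_iff_left (pow_ne_zero 2 hN)] at h2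
  exact Complex.ext (by simp; nlinarith [sq_nonneg ξ.re, sq_nonneg ξ.im])
    (by simp; nlinarith [sq_nonneg ξ.re, sq_nonneg ξ.im])

/-- The derivative of `J_f` in the direction of the real axis squares to a non-positive scalar `-κ`,
and the whole derivative vanishes where `κ` does. -/
theorem exists_fderiv_chartJ_mul_self (hf : IsHolomorphicToP1 f) {y : M₁} {ζ : ℂ}
    (hζ : ζ ∈ (chartAt ℂ y).target) :
    ∃ κ : ℝ, 0 ≤ κ ∧ fderiv ℝ (chartJ f y) ζ 1 * fderiv ℝ (chartJ f y) ζ 1 = -(κ • 1) ∧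
      (κ = 0 → fderiv ℝ (chartJ f y) ζ = 0) := by
  obtain ⟨ε, g, hε, hg, he⟩ := exists_chartJ_eq hf hζ
  have h1 := fderiv_sphereJ_mul_self hε (g ζ) (deriv g ζ * 1)
  rw [← fderiv_chartJ_apply hg he] at h1
  refine ⟨_, by positivity, h1, fun h => ?_⟩
  have hN : (g ζ).re ^ 2 + (g ζ).im ^ 2 + 1 ≠ 0 := by positivity
  rw [div_eq_zero_iff, or_iff_left (pow_ne_zero 2 hN), mul_one] at h
  have h2 : deriv g ζ = 0 := by
    refine Complex.ext ?_ ?_ <;>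
      simp <;> nlinarith [sq_nonneg (deriv g ζ).re, sq_nonneg (deriv g ζ).im]
  ext1 w
  rw [fderiv_chartJ_apply hg he, h2, zero_mul, map_zero]
  rfl

/-- The zeros of the derivative of `J_f` are the zeros of the derivative of an analytic function, so
they are isolated unless `J_f` is locally constant. -/
theorem fderiv_chartJ_eventually (hf : IsHolomorphicToP1 f) {y : M₁} {ζ : ℂ}
    (hζ : ζ ∈ (chartAt ℂ y).target) :
    (∀ᶠ ζ' in 𝓝 ζ, fderiv ℝ (chartJ f y) ζ' = 0) ∨
      ∀ᶠ ζ' in 𝓝[≠] ζ, fderiv ℝ (chartJ f y) ζ' ≠ 0 := by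
  obtain ⟨ε, g, hε, hg, he⟩ := exists_chartJ_eq hf hζ
  have h1 : ∀ᶠ ζ' in 𝓝 ζ, (fderiv ℝ (chartJ f y) ζ' = 0 ↔ deriv g ζ' = 0) := by
    filter_upwards [hg.eventually_analyticAt, he.eventually_nhds] with ζ' hg' he'
    constructor
    · intro h
      have h2 := fderiv_chartJ_apply hg' he' 1
      rw [h, zero_apply, eq_comm, fderiv_sphereJ_eq_zero_iff hε, mul_one] at h2
      exact h2
    · intro h
      ext1 w
      rw [fderiv_chartJ_apply hg' he', h, zero_mul, map_zero]
      rfl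
  rcases hg.deriv.eventually_eq_zero_or_eventually_ne_zero with h | h
  · left
    filter_upwards [h1, h] with ζ' h2 h3 using h2.2 h3
  · right
    filter_upwards [h1.filter_mono nhdsWithin_le_nhds, h] with ζ' h2 h3 using fun h4 => h3 (h2.1 h4)

/-- As `z ↦ J_z` is injective, `f` is constant where `J_f` is. -/
theorem eventually_eq_of_fderiv_chartJ (hf : IsHolomorphicToP1 f) {y : M₁} {ζ : ℂ}
    (hζ : ζ ∈ (chartAt ℂ y).target) (h : ∀ᶠ ζ' in 𝓝 ζ, fderiv ℝ (chartJ f y) ζ' = 0) :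
    ∀ᶠ y' in 𝓝 ((chartAt ℂ y).symm ζ), f y' = f ((chartAt ℂ y).symm ζ) := by
  obtain ⟨r, hr, hball⟩ := Metric.eventually_nhds_iff_ball.1
    (h.and ((chartAt ℂ y).open_target.mem_nhds hζ))
  have h1 : ∀ ζ' ∈ Metric.ball ζ r, chartJ f y ζ' = chartJ f y ζ := fun ζ' hζ' =>
    Metric.isOpen_ball.is_const_of_fderiv_eq_zero (convex_ball ζ r).isPreconnected
      (fun ζ'' h'' => ((contDiffOn_chartJ hf y).hasFDerivAt_of_mem (chartAt ℂ y).open_target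
        (hball ζ'' h'').2).differentiableAt.differentiableWithinAt)
      (fun ζ'' h'' => (hball ζ'' h'').1) hζ' (Metric.mem_ball_self hr)
  have hs : (chartAt ℂ y).symm ζ ∈ (chartAt ℂ y).source := (chartAt ℂ y).map_target hζ
  have h2 : ContinuousAt (chartAt ℂ y) ((chartAt ℂ y).symm ζ) := (chartAt ℂ y).continuousAt hs
  rw [ContinuousAt, (chartAt ℂ y).right_inv hζ] at h2
  filter_upwards [h2.eventually (Metric.ball_mem_nhds ζ hr),
    (chartAt ℂ y).open_source.mem_nhds hs] with y' hy' hys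
  have h3 := orthogonalJ_injective (h1 _ hy')
  rwa [(chartAt ℂ y).left_inv hys] at h3

theorem fderiv_chartJ_of_eventually_eq {y : M₁} {ζ : ℂ} (hζ : ζ ∈ (chartAt ℂ y).target)
    (h : ∀ᶠ y' in 𝓝 ((chartAt ℂ y).symm ζ), f y' = f ((chartAt ℂ y).symm ζ)) :
    fderiv ℝ (chartJ f y) ζ = 0 := by
  have h1 : chartJ f y =ᶠ[𝓝 ζ] fun _ => chartJ f y ζ := by
    filter_upwards [((chartAt ℂ y).continuousAt_symm hζ).eventually h] with ζ' h2
    exact congrArg orthogonalJ h2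
  rw [h1.fderiv_eq, fderiv_fun_const]
  rfl

/-- If the map `f` is not constant, the zeros of the derivative of `J_f` are isolated. -/
theorem fderiv_chartJ_eventually_ne_zero [ConnectedSpace M₁] (hf : IsHolomorphicToP1 f)
    (hnc : ∃ y y', f y ≠ f y') {y : M₁} {ζ : ℂ} (hζ : ζ ∈ (chartAt ℂ y).target) :
    ∀ᶠ ζ' in 𝓝[≠] ζ, fderiv ℝ (chartJ f y) ζ' ≠ 0 := by
  refine (fderiv_chartJ_eventually hf hζ).resolve_left fun h => ?_
  -- the set of points near which `f` is constant is open and closed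
  let S : Set M₁ := {y | ∀ᶠ y' in 𝓝 y, f y' = f y}
  have hopen : IsOpen S := by
    rw [isOpen_iff_mem_nhds]
    intro y₀ hy₀
    have h1 : ∀ᶠ y' in 𝓝 y₀, f y' = f y₀ := hy₀
    filter_upwards [h1.eventually_nhds, h1] with y₁ h2 h3
    exact h2.mono fun y' h4 => h4.trans h3.symm
  have hclosed : IsClosed S := by
    refine isClosed_of_closure_subset fun y₀ hy₀ => ?_
    have ht := mem_chart_target ℂ y₀
    have hinv := (chartAt ℂ y₀).left_inv (mem_chart_source ℂ y₀)
    by_contra hnS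
    rcases fderiv_chartJ_eventually hf ht with h1 | h1
    · have h2 := eventually_eq_of_fderiv_chartJ hf ht h1
      rw [hinv] at h2
      exact hnS h2
    · rw [eventually_nhdsWithin_iff] at h1
      have h2 := (chartAt ℂ y₀).continuousAt (mem_chart_source ℂ y₀)
      obtain ⟨y₁, hy₁, hy₂, hy₃⟩ := ((mem_closure_iff_frequently.1 hy₀).and_eventually
        ((h2.eventually h1).and
          ((chartAt ℂ y₀).open_source.mem_nhds (mem_chart_source ℂ y₀)))).exists
      refine hy₂ ?_ (fderiv_chartJ_of_eventually_eq ((chartAt ℂ y₀).map_source hy₃) ?_)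
      · intro h3
        have h4 := (chartAt ℂ y₀).injOn hy₃ (mem_chart_source ℂ y₀) h3
        exact hnS (h4 ▸ hy₁)
      · rw [(chartAt ℂ y₀).left_inv hy₃]
        exact hy₁
  have huniv : S = Set.univ :=
    IsClopen.eq_univ ⟨hclosed, hopen⟩ ⟨_, eventually_eq_of_fderiv_chartJ hf hζ h⟩
  have hloc : IsLocallyConstant f := (IsLocallyConstant.iff_eventually_eq f).2 fun y =>
    (huniv ▸ Set.mem_univ y : y ∈ S)
  obtain ⟨y₁, y₂, h12⟩ := hnc
  exact h12 (hloc.apply_eq_of_preconnectedSpace y₁ y₂)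

end LocalField

/-! ### A minimum principle in the plane -/

section MinimumPrinciple

variable {U : Set ℂ} {s : ℂ → ℝ}

theorem fderiv_fderiv_nonneg_of_isLocalMin (hU : IsOpen U) (hs : ContDiffOn ℝ ∞ s U) {ζ : ℂ}
    (hζ : ζ ∈ U) (hmin : IsLocalMin s ζ) (w : ℂ) :
    0 ≤ fderiv ℝ (fun ζ => fderiv ℝ s ζ w) ζ w := by
  let l : ℝ → ℂ := fun t => ζ + t • w
  have hl : ∀ t, HasDerivAt l w t := fun t => by
    simpa [l] using ((hasDerivAt_id t).smul_const w).const_add ζ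
  have hl0 : l 0 = ζ := by simp [l]
  have hlU : ∀ᶠ t in 𝓝 (0 : ℝ), l t ∈ U :=
    (hl 0).continuousAt.eventually (by rw [hl0]; exact hU.mem_nhds hζ)
  have hd1 : deriv (s ∘ l) =ᶠ[𝓝 0] fun t => fderiv ℝ s (l t) w := by
    filter_upwards [hlU] with t ht
    exact ((hs.hasFDerivAt_of_mem hU ht).comp_hasDerivAt t (hl t)).deriv
  have hd2 : deriv (deriv (s ∘ l)) 0 = fderiv ℝ (fun ζ => fderiv ℝ s ζ w) ζ w := by
    rw [hd1.deriv_eq]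
    have h1 := (hs.fderiv_apply_const hU w).hasFDerivAt_of_mem hU hζ
    rw [← hl0] at h1
    have h2 := (h1.comp_hasDerivAt (0 : ℝ) (hl 0)).deriv
    rw [hl0] at h2
    exact h2
  have hmin' : IsLocalMin (s ∘ l) 0 := by
    refine IsMinFilter.comp_tendsto (l' := 𝓝 0) (g := l) ?_ (hl 0).continuousAt
    rwa [hl0]
  rw [← hd2]
  by_contra! hneg
  -- a negative second derivative makes `0` a local maximum as well, so the restriction to the
  -- line is locally constant
  have hcont : ContinuousAt (s ∘ l) 0 := by
    have h1 := (hs.hasFDerivAt_of_mem hU hζ).continuousAt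
    rw [← hl0] at h1
    exact ContinuousAt.comp h1 (hl 0).continuousAt
  have hmax := isLocalMax_of_deriv_deriv_neg hneg hmin'.deriv_eq_zero hcont
  have heq : s ∘ l =ᶠ[𝓝 0] fun _ => (s ∘ l) 0 := by
    filter_upwards [hmin', hmax] with t h1 h2 using le_antisymm h2 h1
  have h3 : deriv (s ∘ l) =ᶠ[𝓝 0] fun _ => 0 := by
    filter_upwards [heq.eventually_nhds] with t ht
    rw [Filter.EventuallyEq.deriv_eq ht, deriv_const]
  rw [h3.deriv_eq, deriv_const] at hneg
  exact lt_irrefl _ hneg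

theorem planeLaplacian_nonneg_of_isLocalMin (hU : IsOpen U) (hs : ContDiffOn ℝ ∞ s U) {ζ : ℂ}
    (hζ : ζ ∈ U) (hmin : IsLocalMin s ζ) : 0 ≤ planeLaplacian s ζ :=
  add_nonneg (fderiv_fderiv_nonneg_of_isLocalMin hU hs hζ hmin 1)
    (fderiv_fderiv_nonneg_of_isLocalMin hU hs hζ hmin Complex.I)

theorem planeLaplacian_sub_mul_norm_sq (hU : IsOpen U) (hs : ContDiffOn ℝ ∞ s U) {ζ : ℂ}
    (hζ : ζ ∈ U) (ζ₀ : ℂ) (ε : ℝ) :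
    planeLaplacian (fun ζ => s ζ - ε * ‖ζ - ζ₀‖ ^ 2) ζ = planeLaplacian s ζ - 4 * ε := by
  have h1 : ∀ w, (fun ζ => fderiv ℝ (fun ζ => s ζ - ε * ‖ζ - ζ₀‖ ^ 2) ζ w) =ᶠ[𝓝 ζ]
      fun ζ => fderiv ℝ s ζ w - ε * (2 * inner ℝ (ζ - ζ₀) w) := by
    intro w
    filter_upwards [hU.mem_nhds hζ] with ζ' hζ'
    have h2 := ((hasFDerivAt_id (𝕜 := ℝ) ζ').sub_const ζ₀).norm_sq
    have h3 := (hs.hasFDerivAt_of_mem hU hζ').sub (h2.const_mul ε)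
    refine (fderiv_apply_of_hasFDerivAt h3 w).trans ?_
    simp only [sub_apply, smul_apply, ContinuousLinearMap.comp_apply, innerSL_apply_apply, id,
      ContinuousLinearMap.coe_id', nsmul_eq_mul, smul_eq_mul, Nat.cast_ofNat]
  have h4 : ∀ w, fderiv ℝ (fun ζ => fderiv ℝ (fun ζ => s ζ - ε * ‖ζ - ζ₀‖ ^ 2) ζ w) ζ w =
      fderiv ℝ (fun ζ => fderiv ℝ s ζ w) ζ w - ε * (2 * ‖w‖ ^ 2) := by
    intro w
    rw [(h1 w).fderiv_eq]
    have h2 := (((innerSL ℝ w).hasFDerivAt (x := ζ - ζ₀)).comp ζ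
      ((hasFDerivAt_id (𝕜 := ℝ) ζ).sub_const ζ₀)).const_mul 2
    have h3 := ((hs.fderiv_apply_const hU w).hasFDerivAt_of_mem hU hζ).sub (h2.const_mul ε)
    have h5 : (fun ζ => fderiv ℝ s ζ w - ε * (2 * inner ℝ (ζ - ζ₀) w)) =
        (fun ζ => fderiv ℝ s ζ w) - fun ζ => ε * (2 * (innerSL ℝ w ∘ fun x => id x - ζ₀) ζ) := by
      ext1 ζ'
      simp [real_inner_comm]
    rw [h5]
    refine (fderiv_apply_of_hasFDerivAt h3 w).trans ?_
    simp
  rw [planeLaplacian, planeLaplacian, h4, h4]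
  simp
  ring

/-- A superharmonic function that is strictly superharmonic in a punctured neighbourhood of a point
does not have a minimum there. -/
theorem not_isMin_of_planeLaplacian_neg (hU : IsOpen U) (hs : ContDiffOn ℝ ∞ s U) {ζ₀ : ℂ}
    (hζ₀ : ζ₀ ∈ U) (hlap : ∀ ζ ∈ U, planeLaplacian s ζ ≤ 0)
    (hneg : ∀ᶠ ζ in 𝓝[≠] ζ₀, planeLaplacian s ζ < 0) : ¬ ∀ ζ ∈ U, s ζ₀ ≤ s ζ := by
  intro hmin
  rw [eventually_nhdsWithin_iff] at hneg
  obtain ⟨r, hr, hball⟩ := Metric.nhds_basis_closedBall.eventually_iff.1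
    (hneg.and (hU.mem_nhds hζ₀))
  have hcont : ContinuousOn s (Metric.closedBall ζ₀ r) :=
    hs.continuousOn.mono fun ζ h => (hball h).2
  -- the minimum is not attained on the boundary circle
  have hstrict : ∀ ζ ∈ Metric.sphere ζ₀ r, s ζ₀ < s ζ := by
    intro ζ hζ
    have hζb := Metric.sphere_subset_closedBall hζ
    refine lt_of_le_of_ne (hmin ζ (hball hζb).2) fun heq => ?_
    have h1 : IsLocalMin s ζ := by
      filter_upwards [hU.mem_nhds (hball hζb).2] with ζ' h
      rw [← heq]
      exact hmin ζ' h
    exact absurd (planeLaplacian_nonneg_of_isLocalMin hU hs (hball hζb).2 h1)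
      (not_le.2 ((hball hζb).1 (Metric.ne_of_mem_sphere hζ hr.ne')))
  obtain ⟨ζ₁, hζ₁, hζ₁min⟩ := (isCompact_sphere ζ₀ r).exists_isMinOn
    (NormedSpace.sphere_nonempty.2 hr.le) (hcont.mono Metric.sphere_subset_closedBall)
  have hδ := sub_pos.2 (hstrict ζ₁ hζ₁)
  set δ := s ζ₁ - s ζ₀ with hδdef
  set ε := δ / (2 * r ^ 2) with hε
  have hεpos : 0 < ε := by positivity
  have hεr : ε * r ^ 2 = δ / 2 := by rw [hε]; field_simp
  -- an interior minimum of the perturbed function contradicts the sign of its Laplacian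
  let φ : ℂ → ℝ := fun ζ => s ζ - ε * ‖ζ - ζ₀‖ ^ 2
  have hφ : ContDiffOn ℝ ∞ φ U := by
    refine hs.sub (contDiffOn_const.mul ?_)
    exact ((contDiff_id.sub contDiff_const).norm_sq ℝ).contDiffOn
  obtain ⟨ζ₂, hζ₂, hζ₂min⟩ := (isCompact_closedBall ζ₀ r).exists_isMinOn
    (Metric.nonempty_closedBall.2 hr.le) (hφ.continuousOn.mono fun ζ h => (hball h).2)
  have hζ₂r : dist ζ₂ ζ₀ < r := by
    refine lt_of_le_of_ne hζ₂ fun h => ?_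
    have h1 : φ ζ₂ ≤ φ ζ₀ := hζ₂min (Metric.mem_closedBall_self hr.le)
    have h2 : s ζ₁ ≤ s ζ₂ := hζ₁min h
    rw [dist_eq_norm] at h
    simp only [φ, h, hεr, sub_self, norm_zero] at h1
    norm_num at h1
    linarith
  have hloc : IsLocalMin φ ζ₂ :=
    hζ₂min.isLocalMin (Filter.mem_of_superset (Metric.isOpen_ball.mem_nhds hζ₂r)
      Metric.ball_subset_closedBall)
  have h1 := planeLaplacian_nonneg_of_isLocalMin hU hφ (hball hζ₂).2 hloc
  rw [planeLaplacian_sub_mul_norm_sq hU hs (hball hζ₂).2] at h1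
  have h2 := hlap ζ₂ (hball hζ₂).2
  linarith

end MinimumPrinciple

/-! ### The mean energy of the parallel frame -/

section Energy

open MeasureTheory

theorem torusAverage_alternating_apply {X V E : Type} [NormedAddCommGroup X] [NormedSpace ℝ X]
    [FiniteDimensional ℝ X] [NormedAddCommGroup V] [NormedSpace ℝ V] [FiniteDimensional ℝ V]
    [MeasureSpace V] [BorelSpace V] [(volume : Measure V).IsAddHaarMeasure]
    {Λ : Submodule ℤ V} [DiscreteTopology Λ] [IsZLattice ℝ Λ] {U : Set X} {k : ℕ}
    [NormedAddCommGroup E] [NormedSpace ℝ E] {G : X × V → E [⋀^Fin k]→L[ℝ] ℂ}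
    (hG : ContinuousOn G (U ×ˢ Set.univ)) {ζ : X} (hζ : ζ ∈ U) (v : Fin k → E) :
    torusAverage Λ G ζ v = torusAverage Λ (fun e => G e v) ζ :=
  (torusAverage_clm_alternating (ContinuousAlternatingMap.apply ℝ E ℂ v) hG hζ).symm

variable {M₁ : Type*} [TopologicalSpace M₁] [ChartedSpace ℂ M₁] [IsManifold 𝓘(ℂ) ω M₁]
  {Λ : Submodule ℤ (EuclideanSpace ℝ (Fin 4))} [DiscreteTopology Λ] [IsZLattice ℝ Λ]
  {f : M₁ → OnePoint ℂ} {hf : IsHolomorphicToP1 f}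
  (h : HermitianMetric (warpedComplexStructure Λ f hf))

theorem metricPull_paramJ {y : M₁} {e : ℂ × EuclideanSpace ℝ (Fin 4)} (he : e ∈ paramDomain y)
    (u v : ℂ × EuclideanSpace ℝ (Fin 4)) :
    metricPull h y e (paramJ f y e.1 u) (paramJ f y e.1 v) = metricPull h y e u v := by
  rw [metricPull, paramJ, paramDeriv_modelJ he, paramDeriv_modelJ he]
  exact h.compatible (paramMap Λ y e) (paramDeriv Λ y e u) (paramDeriv Λ y e v)

theorem averagedForm_apply {y : M₁} {ζ : ℂ} (hζ : ζ ∈ (chartAt ℂ y).target)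
    (v : Fin 2 → ℂ × EuclideanSpace ℝ (Fin 4)) :
    averagedForm h y ζ v =
      ((∫ t in latticeCell Λ, metricPull h y (ζ, t) (paramJ f y ζ (v 0)) (v 1) : ℝ) : ℂ) := by
  rw [averagedForm, torusAverage_alternating_apply (isSmooth_fundamentalForm h y).continuousOn hζ,
    torusAverage_congr (fun e he => formPull_fundamentalForm h he v) hζ]
  exact integral_ofReal

theorem averagedForm_vertical {y : M₁} {ζ : ℂ} (hζ : ζ ∈ (chartAt ℂ y).target)
    (u v : EuclideanSpace ℝ (Fin 4)) :
    averagedForm h y ζ ![(0, u), (0, v)] =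
      ((∫ t in latticeCell Λ, metricPull h y (ζ, t) (0, chartJ f y ζ u) (0, v) : ℝ) : ℂ) := by
  rw [averagedForm_apply h hζ]
  have h1 : paramJ f y ζ (0, u) = (0, chartJ f y ζ u) := prodJ_vertical _ u
  simp only [Matrix.cons_val_zero, Matrix.cons_val_one, h1]

theorem metricPull_chartJ {y : M₁} {ζ : ℂ} (hζ : ζ ∈ (chartAt ℂ y).target)
    (t u v : EuclideanSpace ℝ (Fin 4)) :
    metricPull h y (ζ, t) (0, chartJ f y ζ u) (0, chartJ f y ζ v) =
      metricPull h y (ζ, t) (0, u) (0, v) := by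
  have h1 : ∀ u, paramJ f y ζ (0, u) = (0, chartJ f y ζ u) := prodJ_vertical _
  rw [← h1, ← h1]
  exact metricPull_paramJ h (e := (ζ, t)) ⟨hζ, trivial⟩ (0, u) (0, v)

theorem averagedForm_chartJ {y : M₁} {ζ : ℂ} (hζ : ζ ∈ (chartAt ℂ y).target)
    (u v : EuclideanSpace ℝ (Fin 4)) :
    averagedForm h y ζ ![(0, chartJ f y ζ u), (0, chartJ f y ζ v)] =
      averagedForm h y ζ ![(0, u), (0, v)] := by
  simp only [averagedForm_vertical h hζ, metricPull_chartJ h hζ]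

/-- The integral over the torus `{y} × ℝ⁴ / Λ` of the trace of the metric with respect to the
Euclidean metric of `ℝ⁴`. -/
def torusEnergy (y : M₁) : ℝ :=
  ∑ i, ∫ t in latticeCell Λ, h.inner (y, (t : FlatTorus Λ))
    ((0, EuclideanSpace.basisFun (Fin 4) ℝ i) : ℂ × EuclideanSpace ℝ (Fin 4))
    ((0, EuclideanSpace.basisFun (Fin 4) ℝ i) : ℂ × EuclideanSpace ℝ (Fin 4))

/-- The operator on `ℝ⁴` representing the averaged fundamental form. -/
def averagedOperator (y : M₁) (ζ : ℂ) : EuclideanSpace ℝ (Fin 4) →L[ℝ] EuclideanSpace ℝ (Fin 4) :=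
  verticalOperator (averagedForm h y ζ)

theorem contDiffOn_averagedOperator (y : M₁) :
    ContDiffOn ℝ ∞ (averagedOperator h y) (chartAt ℂ y).target :=
  (contDiffOn_averagedForm h y).clm_alternating verticalOperator

theorem contDiffOn_traceCLM_mul_chartJ (y : M₁) :
    ContDiffOn ℝ ∞ (fun ζ => traceCLM (averagedOperator h y ζ * chartJ f y ζ))
      (chartAt ℂ y).target :=
  ContDiff.comp_contDiffOn (g := traceCLM (V := EuclideanSpace ℝ (Fin 4)))
    (f := fun ζ => averagedOperator h y ζ * chartJ f y ζ)
    (ContinuousLinearMap.contDiff (traceCLM (V := EuclideanSpace ℝ (Fin 4))))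
    ((contDiffOn_averagedOperator h y).mul (contDiffOn_chartJ hf y))

theorem metricPull_vertical {y : M₁} {ζ : ℂ} (hζ : ζ ∈ (chartAt ℂ y).target)
    (t u v : EuclideanSpace ℝ (Fin 4)) :
    metricPull h y (ζ, t) (0, u) (0, v) = h.inner ((chartAt ℂ y).symm ζ, (t : FlatTorus Λ))
      ((0, u) : ℂ × EuclideanSpace ℝ (Fin 4)) ((0, v) : ℂ × EuclideanSpace ℝ (Fin 4)) := by
  have he : ((ζ, t) : ℂ × EuclideanSpace ℝ (Fin 4)) ∈ paramDomain y := ⟨hζ, trivial⟩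
  rw [metricPull, paramDeriv_vertical he, paramDeriv_vertical he]
  rfl

/-- The trace of `A K` is the averaged vertical trace of `h`, since
`ω (e, K e) = h (K e, K e) = h (e, e)` for vertical vectors `e`. -/
theorem traceCLM_mul_chartJ {y : M₁} {ζ : ℂ} (hζ : ζ ∈ (chartAt ℂ y).target) :
    traceCLM (averagedOperator h y ζ * chartJ f y ζ) =
      torusEnergy h ((chartAt ℂ y).symm ζ) := by
  rw [traceCLM_eq_sum (EuclideanSpace.basisFun (Fin 4) ℝ), torusEnergy]
  refine Finset.sum_congr rfl fun i _ => ?_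
  rw [mul_apply_eq_comp, averagedOperator, inner_verticalOperator, averagedForm_vertical h hζ,
    Complex.ofReal_re]
  simp only [metricPull_chartJ h hζ, metricPull_vertical h hζ]

theorem continuous_torusEnergy : Continuous (torusEnergy h) := by
  refine continuous_iff_continuousAt.2 fun y => ?_
  have h1 := ((contDiffOn_traceCLM_mul_chartJ h y).continuousOn.continuousAt
    ((chartAt ℂ y).open_target.mem_nhds (mem_chart_target ℂ y)))
  refine (ContinuousAt.comp (f := chartAt ℂ y) h1
    ((chartAt ℂ y).continuousAt (mem_chart_source ℂ y))).congr ?_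
  filter_upwards [(chartAt ℂ y).open_source.mem_nhds (mem_chart_source ℂ y)] with y' hy'
  simp only [Function.comp]
  rw [traceCLM_mul_chartJ h ((chartAt ℂ y).map_source hy'), (chartAt ℂ y).left_inv hy']

theorem torusEnergy_pos (y : M₁) : 0 < torusEnergy h y := by
  refine Finset.sum_pos (fun i _ => ?_) Finset.univ_nonempty
  set b := EuclideanSpace.basisFun (Fin 4) ℝ i with hb
  have hb0 : ((0, b) : ℂ × EuclideanSpace ℝ (Fin 4)) ≠ 0 := fun h0 => by
    have := congrArg (fun v : ℂ × EuclideanSpace ℝ (Fin 4) => v.2 i) h0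
    simp [hb] at this
  have hpos : ∀ t : EuclideanSpace ℝ (Fin 4), 0 < h.inner (y, (t : FlatTorus Λ))
      ((0, b) : ℂ × EuclideanSpace ℝ (Fin 4)) ((0, b) : ℂ × EuclideanSpace ℝ (Fin 4)) :=
    fun t => h.pos (y, (t : FlatTorus Λ)) (0, b) hb0
  have hcont : Continuous fun t : EuclideanSpace ℝ (Fin 4) => h.inner (y, (t : FlatTorus Λ))
      ((0, b) : ℂ × EuclideanSpace ℝ (Fin 4)) ((0, b) : ℂ × EuclideanSpace ℝ (Fin 4)) := by
    have h1 := continuous_slice (contDiffOn_metricPull h y (0, b) (0, b)).continuousOn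
      (mem_chart_target ℂ y)
    simp only [metricPull_vertical h (mem_chart_target ℂ y)] at h1
    have h2 : ∀ z, z = y → (Continuous fun t : EuclideanSpace ℝ (Fin 4) =>
        h.inner (z, (t : FlatTorus Λ)) ((0, b) : ℂ × EuclideanSpace ℝ (Fin 4))
          ((0, b) : ℂ × EuclideanSpace ℝ (Fin 4))) →
        Continuous fun t : EuclideanSpace ℝ (Fin 4) => h.inner (y, (t : FlatTorus Λ))
          ((0, b) : ℂ × EuclideanSpace ℝ (Fin 4)) ((0, b) : ℂ × EuclideanSpace ℝ (Fin 4)) := by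
      rintro _ rfl hc
      exact hc
    exact h2 _ ((chartAt ℂ y).left_inv (mem_chart_source ℂ y)) h1
  rw [integral_pos_iff_support_of_nonneg (fun t => (hpos t).le) (integrableOn_latticeCell Λ hcont)]
  have hsupp : (Function.support fun t : EuclideanSpace ℝ (Fin 4) =>
      h.inner (y, (t : FlatTorus Λ)) ((0, b) : ℂ × EuclideanSpace ℝ (Fin 4))
        ((0, b) : ℂ × EuclideanSpace ℝ (Fin 4))) = Set.univ :=
    Set.eq_univ_of_forall fun t => (hpos t).ne'
  rw [hsupp, Measure.restrict_apply_univ, pos_iff_ne_zero]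
  have : VAddInvariantMeasure Λ (EuclideanSpace ℝ (Fin 4)) volume :=
    inferInstanceAs (VAddInvariantMeasure Λ.toAddSubgroup (EuclideanSpace ℝ (Fin 4)) volume)
  exact (isAddFundamentalDomain_latticeCell Λ).measure_ne_zero (NeZero.ne _)

/-- For a pluriclosed metric, the energy is superharmonic; it is strictly superharmonic where the
derivative of `J_f` does not vanish. -/
theorem planeLaplacian_torusEnergy {h : HermitianMetric (warpedComplexStructure Λ f hf)}
    (hpl : h.IsPluriclosed) {y : M₁} {ζ : ℂ} (hζ : ζ ∈ (chartAt ℂ y).target) :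
    ∃ κ : ℝ, 0 ≤ κ ∧ (κ = 0 → fderiv ℝ (chartJ f y) ζ = 0) ∧
      planeLaplacian (fun ζ => traceCLM (averagedOperator h y ζ * chartJ f y ζ)) ζ =
        -2 * κ * torusEnergy h ((chartAt ℂ y).symm ζ) := by
  obtain ⟨κ, hκ0, hκ, hκz⟩ := exists_fderiv_chartJ_mul_self hf hζ
  refine ⟨κ, hκ0, hκz, ?_⟩
  have hU := (chartAt ℂ y).open_target
  have hsq : ∀ ζ ∈ (chartAt ℂ y).target, chartJ f y ζ * chartJ f y ζ = -1 := fun ζ _ =>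
    orthogonalJ_mul_self _
  have hCR : ∀ ζ ∈ (chartAt ℂ y).target, ∀ w, fderiv ℝ (chartJ f y) ζ (Complex.I * w) =
      chartJ f y ζ * fderiv ℝ (chartJ f y) ζ w := fun ζ hζ w => fderiv_chartJ_I hf hζ w
  have hpde := trace_eq_zero_of_invariant hU (contDiffOn_averagedForm h y) (contDiffOn_chartJ hf y)
    hsq hCR (fun ζ _ u v => inner_orthogonalJ_left _ u v)
    (fun ζ hζ u v => by rw [averagedForm_vertical h hζ, Complex.ofReal_im])
    (fun ζ hζ u v => averagedForm_chartJ h hζ u v) hζ (averagedForm_isPluriclosed hpl hζ)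
  have h1 := planeLaplacian_trace hU traceCLM traceCLM_mul_comm (contDiffOn_averagedOperator h y)
    (contDiffOn_chartJ hf y) hsq hCR hζ hpde hκ
  rw [h1, traceCLM_mul_chartJ h hζ]

/-- The energy attains its minimum on the compact surface `M₁`, against the minimum principle. -/
theorem not_isPluriclosed [CompactSpace M₁] [ConnectedSpace M₁] (hnc : ∃ y y', f y ≠ f y') :
    ¬ h.IsPluriclosed := by
  intro hpl
  obtain ⟨y, -, hy⟩ := isCompact_univ.exists_isMinOn Set.univ_nonempty
    (continuous_torusEnergy h).continuousOn
  have hζ := mem_chart_target ℂ y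
  refine not_isMin_of_planeLaplacian_neg (chartAt ℂ y).open_target
    (contDiffOn_traceCLM_mul_chartJ h y) hζ ?_ ?_ ?_
  · intro ζ hζ
    obtain ⟨κ, hκ, -, h1⟩ := planeLaplacian_torusEnergy hpl hζ
    rw [h1]
    have := mul_nonneg hκ (torusEnergy_pos h ((chartAt ℂ y).symm ζ)).le
    linarith
  · filter_upwards [fderiv_chartJ_eventually_ne_zero hf hnc hζ,
      nhdsWithin_le_nhds ((chartAt ℂ y).open_target.mem_nhds hζ)] with ζ hne hζ
    obtain ⟨κ, hκ, hκz, h1⟩ := planeLaplacian_torusEnergy hpl hζ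
    rw [h1]
    have := mul_pos (lt_of_le_of_ne hκ fun h0 => hne (hκz h0.symm))
      (torusEnergy_pos h ((chartAt ℂ y).symm ζ))
    linarith
  · intro ζ hζ'
    rw [traceCLM_mul_chartJ h hζ, traceCLM_mul_chartJ h hζ',
      (chartAt ℂ y).left_inv (mem_chart_source ℂ y)]
    exact hy (Set.mem_univ _)

end Energy

/-! ### Kähler metrics are pluriclosed -/

section Kahler

variable {E : Type*} [NormedAddCommGroup E] [NormedSpace ℝ E] {H : Type*} [TopologicalSpace H]
  {I : ModelWithCorners ℝ E H} {M : Type*} [TopologicalSpace M] [ChartedSpace H M]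

theorem DiffForm.d_zero {k : ℕ} (x : M) :
    DiffForm.d (I := I) (M := M) (k := k) (fun _ => 0) x = 0 := by
  have h1 : DiffForm.inChart (I := I) (M := M) (k := k) (fun _ => 0) x = 0 := by
    ext e v
    rfl
  unfold DiffForm.d
  rw [h1]
  have h2 : extDerivWithin (0 : E → E [⋀^Fin k]→L[ℝ] ℂ) (Set.range I) (extChartAt I x x) = 0 := by
    rw [extDerivWithin, fderivWithin_zero]
    exact (ContinuousAlternatingMap.alternatizeUncurryFinCLM ℝ E ℂ).map_zero
  rw [h2]
  ext v
  rfl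

theorem HermitianMetric.IsKahler.isPluriclosed [IsManifold I ∞ M] {𝒥 : ComplexStructure I M}
    {h : HermitianMetric 𝒥} (hk : h.IsKahler) : h.IsPluriclosed := by
  intro x
  have h1 : 𝒥.delbar 1 1 h.fundamentalForm = fun _ => 0 := by
    funext x
    rw [ComplexStructure.delbar, hk x]
    exact typePart_zero _ _ _
  rw [h1, ComplexStructure.del, DiffForm.d_zero]
  exact typePart_zero _ _ _

end Kahler

end

theorem mainTheorem3 {M₁ : Type*} [TopologicalSpace M₁] [T2Space M₁] [CompactSpace M₁]
    [ConnectedSpace M₁] [ChartedSpace ℂ M₁] [IsManifold 𝓘(ℂ) ω M₁]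
    (Λ : Submodule ℤ (EuclideanSpace ℝ (Fin 4))) [DiscreteTopology Λ] [IsZLattice ℝ Λ]
    (f : M₁ → OnePoint ℂ) (hf : IsHolomorphicToP1 f) (hnc : ∃ y y', f y ≠ f y') :
    (¬ ∃ h : HermitianMetric (warpedComplexStructure Λ f hf), h.IsPluriclosed) ∧
    ¬ ∃ h : HermitianMetric (warpedComplexStructure Λ f hf), h.IsKahler := by
  refine ⟨?_, ?_⟩
  · rintro ⟨h, hpl⟩
    exact not_isPluriclosed h hnc hpl
  · rintro ⟨h, hk⟩
    exact not_isPluriclosed h hnc hk.isPluriclosed
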